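/- Let $C$ be an Abelian von Neumann algebra, with positive part $C^+$. A Banach $C$-bimodule $Z$ is in ${\rm CNRM}_C$ if it is central ($cz=zc$ for all $c\in C$, $z\in Z$) and there are Hilbert spaces $\mathcal H,\mathcal K$ with normal $*$-representations $\pi:C\to B(\mathcal H)$, $\sigma:C\to B(\mathcal K)$ and a linear isometry $\Phi:Z\to B(\mathcal K,\mathcal H)$ with $\Phi(azb)=\pi(a)\Phi(z)\sigma(b)$ for $a,b\in C$, $z\in Z$; such a $\Phi$ is called a normal embedding of $Z$. For $X,Y\in{\rm CNRM}_C$ let $X\otimes^\nu_C Y$ be the completion of the algebraic tensor product $X\otimes_C Y$ in the norm $\nu_C(w)=\sup\|\phi(w)\|$, where $\phi$ runs over all $C$-bilinear contractions from $X\times Y$ into normal representable $C$-bimodules, identified with the induced linear maps on $X\otimes_CY$. A norm closed central $C$-sub-bimodule $W$ of $B(\mathcal K,\mathcal H)$ is called strong if $\sum_{j\in\mathbb J}p_jz_j\in W$ (weak* convergent sum) for every bounded family $(z_j)_{j\in\mathbb J}$ in $W$ and every orthogonal family $(p_j)_{j\in\mathbb J}$ of projections in $C$. **Theorem.** Let $X,Y\in{\rm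 CNRM}_C$. Then $X\otimes^\nu_CY\in{\rm CNRM}_C$. For every normal embedding of $X\otimes^\nu_CY$ into a space $B(\mathcal K,\mathcal H)$ there is a smallest strong $C$-bimodule $X\widetilde\otimes^\nu Y\subseteq B(\mathcal K,\mathcal H)$ containing (the image of) $X\otimes^\nu_CY$, and every $w\in X\widetilde\otimes^\nu Y$ can be represented in the form $$w=\sum_{j\in\mathbb J}c_j\,x_j\otimes_Cy_j,\qquad x_j\in X,\ \|x_j\|\le1,\quad y_j\in Y,\ \|y_j\|\le1,\quad c_j\in C^+,$$ for some index set $\mathbb J$, where the sum $\sum_{j\in\mathbb J}c_j$ weak* converges in $C$ and the sum representing $w$ weak* converges in $B(\mathcal K,\mathcal H)$. Moreover, $\|w\|$ is equal to the infimum of $\big\|\sum_{j\in\mathbb J}c_j\big\|$ over all such representations of $w$. -/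

import Mathlib

open scoped TensorProduct IsMulCommutative

universe u

noncomputable section

namespace CNRM

section Operators

variable {K H : Type u}
  [NormedAddCommGroup K] [InnerProductSpace ℂ K]
  [NormedAddCommGroup H] [InnerProductSpace ℂ H]

/-- `∑ j, f j = T` in the weak* (ultraweak) topology of `B(K, H)`.  The weak* continuous
functionals are `S ↦ ∑ n, ⟪η n, S (ξ n)⟫` with `ξ`, `η` square summable sequences of vectors, and
convergence is that of the net of finite partial sums. -/
def HasWeakStarSum {J : Type u} (f : J → K →L[ℂ] H) (T : K →L[ℂ] H) : Prop :=
  ∀ (ξ : ℕ → K) (η : ℕ → H),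
    Summable (fun n => ‖ξ n‖ ^ 2) → Summable (fun n => ‖η n‖ ^ 2) →
      HasSum (fun j => ∑' n, inner ℂ (η n) (f j (ξ n))) (∑' n, inner ℂ (η n) (T (ξ n)))

end Operators

section Bimodules

variable {H₀ : Type u} [NormedAddCommGroup H₀] [InnerProductSpace ℂ H₀] [CompleteSpace H₀]

/-- A `*`-representation of a von Neumann algebra is normal if it preserves least upper bounds
of (bounded) increasing nets. -/
def IsNormal (C : VonNeumannAlgebra H₀) {H : Type u}
    [NormedAddCommGroup H] [InnerProductSpace ℂ H] [CompleteSpace H]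
    (π : C.toStarSubalgebra →⋆ₐ[ℂ] (H →L[ℂ] H)) : Prop :=
  ∀ (S : Set C.toStarSubalgebra) (s : C.toStarSubalgebra),
    S.Nonempty → DirectedOn (· ≤ ·) S → IsLUB S s → IsLUB (π '' S) (π s)

/-- An isometric embedding of a central `C`-bimodule `Z` (both actions are the given `•`)
into `B(K, H)` as a `C`-bimodule, where `H` and `K` are normal Hilbert `C`-modules. -/
structure NormalEmbedding (C : VonNeumannAlgebra H₀) (Z K H : Type u)
    [NormedAddCommGroup Z] [NormedSpace ℂ Z] [Module C.toStarSubalgebra Z]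
    [NormedAddCommGroup K] [InnerProductSpace ℂ K] [CompleteSpace K]
    [NormedAddCommGroup H] [InnerProductSpace ℂ H] [CompleteSpace H] where
  left : C.toStarSubalgebra →⋆ₐ[ℂ] (H →L[ℂ] H)
  right : C.toStarSubalgebra →⋆ₐ[ℂ] (K →L[ℂ] K)
  left_normal : IsNormal C left
  right_normal : IsNormal C right
  emb : Z →ₗᵢ[ℂ] (K →L[ℂ] H)
  emb_left : ∀ (c : C.toStarSubalgebra) (z : Z), emb (c • z) = left c ∘L emb z
  emb_right : ∀ (c : C.toStarSubalgebra) (z : Z), emb (c • z) = emb z ∘L right c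

/-- `Z` is a central normal representable (Banach) `C`-bimodule. -/
def IsCNRM (C : VonNeumannAlgebra H₀) (Z : Type u)
    [NormedAddCommGroup Z] [NormedSpace ℂ Z] [Module C.toStarSubalgebra Z] : Prop :=
  CompleteSpace Z ∧
    ∃ (K H : Type u)
      (_ : NormedAddCommGroup K) (_ : InnerProductSpace ℂ K) (_ : CompleteSpace K)
      (_ : NormedAddCommGroup H) (_ : InnerProductSpace ℂ H) (_ : CompleteSpace H),
      Nonempty (NormalEmbedding C Z K H)

/-- A subspace `W` of `B(K, H)`, where `H` and `K` are Hilbert `C`-modules through `π` and `σ`, is a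
strong central `C`-bimodule: it is a norm closed central sub-bimodule, and it contains the weak*
sum `∑ j, p j • z j` for every bounded family `z` in `W` and every orthogonal family of projections
`p` in `C`. -/
structure IsStrong {C : VonNeumannAlgebra H₀} {K H : Type u}
    [NormedAddCommGroup K] [InnerProductSpace ℂ K] [CompleteSpace K]
    [NormedAddCommGroup H] [InnerProductSpace ℂ H] [CompleteSpace H]
    (π : C.toStarSubalgebra →⋆ₐ[ℂ] (H →L[ℂ] H)) (σ : C.toStarSubalgebra →⋆ₐ[ℂ] (K →L[ℂ] K))
    (W : Submodule ℂ (K →L[ℂ] H)) : Prop where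
  isClosed : IsClosed (W : Set (K →L[ℂ] H))
  smul_mem : ∀ (c : C.toStarSubalgebra), ∀ T ∈ W, π c ∘L T ∈ W
  central : ∀ (c : C.toStarSubalgebra), ∀ T ∈ W, π c ∘L T = T ∘L σ c
  sum_mem : ∀ (J : Type u) (p : J → C.toStarSubalgebra) (z : J → K →L[ℂ] H),
    (∀ j, IsStarProjection (p j)) → (Pairwise fun i j => p i * p j = 0) →
    (∀ j, z j ∈ W) → (∃ M : ℝ, ∀ j, ‖z j‖ ≤ M) →
    ∀ T : K →L[ℂ] H, HasWeakStarSum (fun j => π (p j) ∘L z j) T → T ∈ W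

/-- The smallest strong bimodule in `B(K, H)` that contains the embedded bimodule `Z`. -/
def NormalEmbedding.strongHull {C : VonNeumannAlgebra H₀} {Z K H : Type u}
    [NormedAddCommGroup Z] [NormedSpace ℂ Z] [Module C.toStarSubalgebra Z]
    [NormedAddCommGroup K] [InnerProductSpace ℂ K] [CompleteSpace K]
    [NormedAddCommGroup H] [InnerProductSpace ℂ H] [CompleteSpace H]
    (E : NormalEmbedding C Z K H) : Submodule ℂ (K →L[ℂ] H) :=
  sInf {W | IsStrong E.left E.right W ∧ ∀ z, E.emb z ∈ W}

theorem isClosed_carrier (C : VonNeumannAlgebra H₀) :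
    IsClosed (C.toStarSubalgebra : Set (H₀ →L[ℂ] H₀)) := by
  have h := C.centralizer_centralizer
  rw [VonNeumannAlgebra.coe_toStarSubalgebra, ← h]
  exact Set.isClosed_centralizer _

theorem norm_rep_le {C : VonNeumannAlgebra H₀} {H : Type u}
    [NormedAddCommGroup H] [InnerProductSpace ℂ H] [CompleteSpace H]
    (π : C.toStarSubalgebra →⋆ₐ[ℂ] (H →L[ℂ] H)) (c : C.toStarSubalgebra) : ‖π c‖ ≤ ‖c‖ := by
  have := isClosed_carrier C
  let _ : CStarAlgebra C.toStarSubalgebra := StarSubalgebra.cstarAlgebra C.toStarSubalgebra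
  exact NonUnitalStarAlgHom.norm_apply_le π c

theorem IsCNRM.norm_smul_le {C : VonNeumannAlgebra H₀} {Z : Type u}
    [NormedAddCommGroup Z] [NormedSpace ℂ Z] [Module C.toStarSubalgebra Z]
    (hZ : IsCNRM C Z) (c : C.toStarSubalgebra) (z : Z) : ‖c • z‖ ≤ ‖c‖ * ‖z‖ := by
  obtain ⟨-, K, H, _, _, _, _, _, _, ⟨E⟩⟩ := hZ
  rw [← E.emb.norm_map, E.emb_left, ← E.emb.norm_map z]
  exact (ContinuousLinearMap.opNorm_comp_le _ _).trans
    (mul_le_mul_of_nonneg_right (norm_rep_le E.left c) (norm_nonneg _))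

theorem IsCNRM.algebraMap_smul {C : VonNeumannAlgebra H₀} {Z : Type u}
    [NormedAddCommGroup Z] [NormedSpace ℂ Z] [Module C.toStarSubalgebra Z]
    (hZ : IsCNRM C Z) (a : ℂ) (z : Z) : algebraMap ℂ C.toStarSubalgebra a • z = a • z := by
  obtain ⟨-, K, H, _, _, _, _, _, _, ⟨E⟩⟩ := hZ
  apply E.emb.injective
  rw [E.emb_left, AlgHomClass.commutes, map_smul]
  ext ξ
  simp [Algebra.algebraMap_eq_smul_one]

end Bimodules

section Tensor

variable {H₀ : Type u} [NormedAddCommGroup H₀] [InnerProductSpace ℂ H₀] [CompleteSpace H₀]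
  (C : VonNeumannAlgebra H₀) [IsMulCommutative C.toStarSubalgebra]
  (X Y : Type u)
  [NormedAddCommGroup X] [NormedSpace ℂ X] [Module C.toStarSubalgebra X]
  [IsScalarTower ℂ C.toStarSubalgebra X]
  [NormedAddCommGroup Y] [NormedSpace ℂ Y] [Module C.toStarSubalgebra Y]
  [IsScalarTower ℂ C.toStarSubalgebra Y]

/-- The algebraic tensor product `X ⊗_C Y`. -/
def AlgTensor : Type u := X ⊗[C.toStarSubalgebra] Y

instance : AddCommGroup (AlgTensor C X Y) :=
  inferInstanceAs (AddCommGroup (X ⊗[C.toStarSubalgebra] Y))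

instance : Module C.toStarSubalgebra (AlgTensor C X Y) :=
  inferInstanceAs (Module C.toStarSubalgebra (X ⊗[C.toStarSubalgebra] Y))

instance : Module ℂ (AlgTensor C X Y) :=
  inferInstanceAs (Module ℂ (X ⊗[C.toStarSubalgebra] Y))

instance : IsScalarTower ℂ C.toStarSubalgebra (AlgTensor C X Y) :=
  inferInstanceAs (IsScalarTower ℂ C.toStarSubalgebra (X ⊗[C.toStarSubalgebra] Y))

variable {X Y}

/-- All the numbers `‖φ(w)‖`, where `φ` is a `C`-bilinear contraction from `X × Y` into a central
normal representable `C`-bimodule `Z`.  (As `X` and `Y` are central, a `C`-bilinear map into any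
normal representable `C`-bimodule has its values in the central part of that bimodule.) -/
def nuSet (w : AlgTensor C X Y) : Set ℝ :=
  {r | ∃ (Z : Type u) (_ : NormedAddCommGroup Z) (_ : NormedSpace ℂ Z)
      (_ : Module C.toStarSubalgebra Z)
      (φ : X →ₗ[C.toStarSubalgebra] Y →ₗ[C.toStarSubalgebra] Z),
      IsCNRM C Z ∧ (∀ x y, ‖φ x y‖ ≤ ‖x‖ * ‖y‖) ∧ r = ‖TensorProduct.lift φ w‖}

/-- The norm `ν_C` on `X ⊗_C Y`. -/
def nu (w : AlgTensor C X Y) : ℝ := sSup (nuSet C w)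

theorem nuSet_nonneg (w : AlgTensor C X Y) : ∀ r ∈ nuSet C w, 0 ≤ r := by
  rintro r ⟨Z, _, _, _, φ, -, -, rfl⟩
  exact norm_nonneg _

theorem nu_nonneg (w : AlgTensor C X Y) : 0 ≤ nu C w := Real.sSup_nonneg (nuSet_nonneg C w)

theorem nuSet_bddAbove (w : AlgTensor C X Y) : BddAbove (nuSet C w) := by
  induction w using TensorProduct.induction_on with
  | zero =>
    refine ⟨0, ?_⟩
    rintro r ⟨Z, _, _, _, φ, -, -, rfl⟩
    exact le_of_eq ((congrArg norm (map_zero (TensorProduct.lift φ))).trans norm_zero)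
  | tmul x y =>
    refine ⟨‖x‖ * ‖y‖, ?_⟩
    rintro r ⟨Z, _, _, _, φ, -, h, rfl⟩
    rw [TensorProduct.lift.tmul]
    exact h x y
  | add a b ha hb =>
    obtain ⟨A, hA⟩ := ha
    obtain ⟨B, hB⟩ := hb
    refine ⟨A + B, ?_⟩
    rintro r ⟨Z, _, _, _, φ, hZ, h, rfl⟩
    rw [map_add]
    exact (norm_add_le _ _).trans
      (add_le_add (hA ⟨Z, _, _, _, φ, hZ, h, rfl⟩) (hB ⟨Z, _, _, _, φ, hZ, h, rfl⟩))

theorem nu_add_le (v w : AlgTensor C X Y) : nu C (v + w) ≤ nu C v + nu C w := by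
  refine Real.sSup_le ?_ (add_nonneg (nu_nonneg C v) (nu_nonneg C w))
  rintro r ⟨Z, _, _, _, φ, hZ, h, rfl⟩
  have e : TensorProduct.lift φ (v + w) = TensorProduct.lift φ v + TensorProduct.lift φ w :=
    map_add (TensorProduct.lift φ) v w
  rw [e]
  exact (norm_add_le _ _).trans
    (add_le_add (le_csSup (nuSet_bddAbove C v) ⟨Z, _, _, _, φ, hZ, h, rfl⟩)
      (le_csSup (nuSet_bddAbove C w) ⟨Z, _, _, _, φ, hZ, h, rfl⟩))

theorem nu_smul_le (c : C.toStarSubalgebra) (w : AlgTensor C X Y) :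
    nu C (c • w) ≤ ‖c‖ * nu C w := by
  refine Real.sSup_le ?_ (mul_nonneg (norm_nonneg c) (nu_nonneg C w))
  rintro r ⟨Z, _, _, _, φ, hZ, h, rfl⟩
  have e : TensorProduct.lift φ (c • w) = c • TensorProduct.lift φ w :=
    map_smul (TensorProduct.lift φ) c w
  rw [e]
  exact (hZ.norm_smul_le c _).trans (mul_le_mul_of_nonneg_left
    (le_csSup (nuSet_bddAbove C w) ⟨Z, _, _, _, φ, hZ, h, rfl⟩) (norm_nonneg c))

theorem nu_complex_smul_le (a : ℂ) (w : AlgTensor C X Y) : nu C (a • w) ≤ ‖a‖ * nu C w := by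
  refine Real.sSup_le ?_ (mul_nonneg (norm_nonneg a) (nu_nonneg C w))
  rintro r ⟨Z, _, _, _, φ, hZ, h, rfl⟩
  have e : TensorProduct.lift φ (a • w) = a • TensorProduct.lift φ w := by
    rw [← IsScalarTower.algebraMap_smul C.toStarSubalgebra a w]
    exact (map_smul (TensorProduct.lift φ) _ w).trans (hZ.algebraMap_smul a _)
  rw [e, norm_smul]
  exact mul_le_mul_of_nonneg_left
    (le_csSup (nuSet_bddAbove C w) ⟨Z, _, _, _, φ, hZ, h, rfl⟩) (norm_nonneg a)

theorem nu_zero : nu C (0 : AlgTensor C X Y) = 0 := by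
  refine le_antisymm ?_ (nu_nonneg C _)
  simpa using nu_complex_smul_le C 0 (0 : AlgTensor C X Y)

theorem nu_neg (w : AlgTensor C X Y) : nu C (-w) = nu C w := by
  have h : ∀ v : AlgTensor C X Y, nu C (-v) ≤ nu C v := fun v => by
    simpa using nu_complex_smul_le C (-1) v
  refine le_antisymm (h w) ?_
  simpa using h (-w)

variable (X Y)

instance : SeminormedAddCommGroup (AlgTensor C X Y) :=
  AddGroupSeminorm.toSeminormedAddCommGroup
    { toFun := nu C
      map_zero' := nu_zero C
      add_le' := nu_add_le C
      neg' := nu_neg C }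

instance : NormedSpace ℂ (AlgTensor C X Y) where
  norm_smul_le := nu_complex_smul_le C

instance : UniformContinuousConstSMul C.toStarSubalgebra (AlgTensor C X Y) where
  uniformContinuous_const_smul c :=
    (AddMonoidHomClass.lipschitz_of_bound
      (DistribSMul.toAddMonoidHom (AlgTensor C X Y) c) ‖c‖ (nu_smul_le C c)).uniformContinuous

/-- The normal projective tensor product: the completion of `X ⊗_C Y` in the norm `ν_C`. -/
abbrev NuTensor : Type u := UniformSpace.Completion (AlgTensor C X Y)

variable {X Y}

/-- The elementary tensor `x ⊗_C y` in the normal projective tensor product. -/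
def nuTmul (x : X) (y : Y) : NuTensor C X Y :=
  ((show AlgTensor C X Y from x ⊗ₜ[C.toStarSubalgebra] y : AlgTensor C X Y) : NuTensor C X Y)

/-- `w = ∑ j, c j • (x j ⊗ y j)` (weak* convergent in the `B(K, H)` in which the normal projective
tensor product is embedded), where `x j`, `y j` are in the closed unit balls, `c j` are positive
elements of `C`, and `∑ j, c j = s` (weak* convergent). -/
structure IsRepresentation {K H : Type u}
    [NormedAddCommGroup K] [InnerProductSpace ℂ K] [CompleteSpace K]
    [NormedAddCommGroup H] [InnerProductSpace ℂ H] [CompleteSpace H]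
    (E : NormalEmbedding C (NuTensor C X Y) K H) (w : K →L[ℂ] H) {J : Type u}
    (c : J → C.toStarSubalgebra) (x : J → X) (y : J → Y) (s : C.toStarSubalgebra) : Prop where
  nonneg : ∀ j, 0 ≤ c j
  norm_left_le : ∀ j, ‖x j‖ ≤ 1
  norm_right_le : ∀ j, ‖y j‖ ≤ 1
  hasSum_coeff : HasWeakStarSum (fun j => (c j : H₀ →L[ℂ] H₀)) (s : H₀ →L[ℂ] H₀)
  hasSum : HasWeakStarSum (fun j => E.emb (c j • nuTmul C (x j) (y j))) w

end Tensor

end CNRM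

end

open CNRM

/-! Upper bounds on norms come from centrality. If `c = r²` is positive in `C` and `z` lies in the
unit ball, then `c z = r z r`, so `|⟨η, c z ξ⟩| ≤ (⟨η, c η⟩ + ⟨ξ, c ξ⟩) / 2`. Normality of the two
representations lets this be summed: if `∑ c_j = s` then `∑ c_j z_j` converges weak* to an operator
of norm at most `‖s‖` (`NormalEmbedding.norm_inner_smul_le`, `Dominated`).

The converse is the heart of the matter. For a vector `ξ` of the space on which `C` acts, `vecNorm ξ
v` is the infimum of `⟨ξ, s ξ⟩` over the finite representations of `v` with coefficient sum `s`, and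
the claim is `vecNorm ξ v ≤ ν(v) ‖ξ‖²` (`vecNorm_le_nu`). By Hahn–Banach some functional `θ ≤
vecNorm ξ` attains the value at `v`. The form `(aξ, bξ) ↦ θ(b*a • x ⊗ y)` is bounded by `‖x‖ ‖y‖
‖aξ‖ ‖bξ‖`, because `b*a = c u` with `u` a contraction and `c` close to `(t a*a + t⁻¹ b*b) / 2`
(`exists_factor`). It is therefore given by an operator commuting with `C`. These operators make up
a `C`-bilinear contraction into the commutant of `C`, which is one of the maps over which `ν` is a
supremum.

The vector estimate becomes an operator estimate by a spectral cut: if `ν(v) < r`, every nonzero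
projection has a nonzero subprojection `p` and a finite representation of `v` with `p s ≤ r p`
(`exists_finRep_local`).

It remains to globalise. The strong hull lies in the strong bimodule `localHull` of central
operators that are locally approximable by algebraic tensors. For such `w`, Zorn's lemma gives a
partition `(p_j)` on whose members `w` is `δ`-close to tensors with finite representations
satisfying `s_j ≤ r p_j`, where `r` is close to `‖w‖`. The glued sum `w₀` has a representation with
coefficient sum at most `r`, and `‖w - w₀‖ ≤ δ`. The remainder is again in `localHull`, and
iteration with geometrically small errors represents `w` itself at cost `‖w‖ + ε`.

That the tensor product is normal representable is independent of this: a direct sum of nearly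
norming representations is isometric on algebraic tensors and extends to the completion. -/

namespace CNRM

open scoped ComplexOrder
open Filter Topology

set_option linter.unusedSectionVars false

/-! ### Weak limits of bounded nets of operators -/

section Weak

variable {K H : Type*}
  [NormedAddCommGroup K] [InnerProductSpace ℂ K]
  [NormedAddCommGroup H] [InnerProductSpace ℂ H] [CompleteSpace H]

/-- A bounded net of operators whose matrix coefficients converge has a weak limit. -/
theorem exists_clm_of_tendsto {ι : Type*} {l : Filter ι} [l.NeBot] (A : ι → K →L[ℂ] H) {M : ℝ}
    (hM0 : 0 ≤ M) (hM : ∀ᶠ i in l, ‖A i‖ ≤ M)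
    (h : ∀ ξ η, ∃ z, Tendsto (fun i => inner ℂ η (A i ξ)) l (𝓝 z)) :
    ∃ T : K →L[ℂ] H, ‖T‖ ≤ M ∧
      ∀ ξ η, Tendsto (fun i => inner ℂ η (A i ξ)) l (𝓝 (inner ℂ η (T ξ))) := by
  choose B hB using h
  have bound : ∀ ξ η, ‖B ξ η‖ ≤ M * ‖ξ‖ * ‖η‖ := fun ξ η => by
    refine le_of_tendsto (hB ξ η).norm ?_
    filter_upwards [hM] with i hi
    calc ‖inner ℂ η (A i ξ)‖ ≤ ‖η‖ * ‖A i ξ‖ := norm_inner_le_norm _ _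
      _ ≤ ‖η‖ * (M * ‖ξ‖) := by
        gcongr
        exact (A i).le_of_opNorm_le hi ξ
      _ = M * ‖ξ‖ * ‖η‖ := by ring
  have key : ∀ ξ, ∃ v : H, (∀ η, inner ℂ η v = B ξ η) ∧ ‖v‖ ≤ M * ‖ξ‖ := fun ξ => by
    -- The limit `B ξ` is conjugate linear in `η`, so the Riesz theorem is applied to its conjugate.
    let f : H →ₗ[ℂ] ℂ :=
      { toFun := fun η => starRingEnd ℂ (B ξ η)
        map_add' := fun a b => by
          rw [← map_add]
          congr 1
          refine tendsto_nhds_unique (hB ξ (a + b)) ?_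
          simpa only [inner_add_left] using (hB ξ a).add (hB ξ b)
        map_smul' := fun c a => by
          have : B ξ (c • a) = starRingEnd ℂ c * B ξ a := by
            refine tendsto_nhds_unique (hB ξ (c • a)) ?_
            simpa only [inner_smul_left] using (hB ξ a).const_mul _
          simp [this] }
    let F : H →L[ℂ] ℂ := f.mkContinuous (M * ‖ξ‖) fun η => by
      simpa [f] using bound ξ η
    refine ⟨(InnerProductSpace.toDual ℂ H).symm F, fun η => ?_, ?_⟩
    · rw [← inner_conj_symm, InnerProductSpace.toDual_symm_apply]
      simp [F, f]
    · rw [LinearIsometryEquiv.norm_map]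
      exact f.mkContinuous_norm_le (by positivity) _
  choose T hT hTn using key
  let T' : K →ₗ[ℂ] H :=
    { toFun := T
      map_add' := fun a b => by
        refine ext_inner_left ℂ fun η => ?_
        rw [inner_add_right, hT, hT, hT]
        refine tendsto_nhds_unique (hB (a + b) η) ?_
        simpa only [map_add, inner_add_right] using (hB a η).add (hB b η)
      map_smul' := fun c a => by
        refine ext_inner_left ℂ fun η => ?_
        rw [RingHom.id_apply, inner_smul_right, hT, hT]
        refine tendsto_nhds_unique (hB (c • a) η) ?_
        simpa only [map_smul, inner_smul_right] using (hB a η).const_mul _ }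
  refine ⟨T'.mkContinuous M hTn, T'.mkContinuous_norm_le hM0 _, fun ξ η => ?_⟩
  have : inner ℂ η (T'.mkContinuous M hTn ξ) = B ξ η := hT ξ η
  rw [this]
  exact hB ξ η

theorem op_le_iff {a b : H →L[ℂ] H} : a ≤ b ↔ ∀ ξ, inner ℂ ξ (a ξ) ≤ inner ℂ ξ (b ξ) := by
  rw [ContinuousLinearMap.le_def]
  constructor
  · intro h ξ
    have := h.inner_nonneg_right ξ
    rwa [sub_apply, inner_sub_right, sub_nonneg] at this
  · intro h
    rw [ContinuousLinearMap.isPositive_iff_complex]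
    intro ξ
    have h1 : (0 : ℂ) ≤ inner ℂ ((b - a) ξ) ξ := by
      have := sub_nonneg.2 (h ξ)
      rw [← inner_sub_right, ← sub_apply] at this
      rw [← inner_conj_symm]
      exact star_nonneg_iff.2 this
    rw [Complex.le_def] at h1
    refine ⟨?_, h1.1⟩
    apply Complex.ext <;> simp
    exact h1.2

theorem op_nonneg_iff {a : H →L[ℂ] H} : 0 ≤ a ↔ ∀ ξ, 0 ≤ inner ℂ ξ (a ξ) := by
  simp [op_le_iff]

/-- An increasing net of operators that converges weakly on the diagonal has the limit as its least
upper bound. -/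
theorem isLUB_of_tendsto {ι : Type*} [Preorder ι] [IsDirectedOrder ι] [Nonempty ι]
    {f : ι → H →L[ℂ] H} (hf : Monotone f) {T : H →L[ℂ] H}
    (h : ∀ ξ, Tendsto (fun i => inner ℂ ξ (f i ξ)) atTop (𝓝 (inner ℂ ξ (T ξ)))) :
    IsLUB (Set.range f) T := by
  constructor
  · rintro _ ⟨i, rfl⟩
    refine op_le_iff.2 fun ξ => ge_of_tendsto (h ξ) ?_
    filter_upwards [eventually_ge_atTop i] with j hj
    exact op_le_iff.1 (hf hj) ξ
  · intro b hb
    refine op_le_iff.2 fun ξ => le_of_tendsto (h ξ) (Eventually.of_forall fun i => ?_)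
    exact op_le_iff.1 (hb ⟨i, rfl⟩) ξ

/-- A bounded increasing net of operators converges weakly. -/
theorem exists_tendsto_of_monotone {ι : Type*} [Preorder ι] [IsDirectedOrder ι] [Nonempty ι]
    {f : ι → H →L[ℂ] H} (hf : Monotone f) {b : H →L[ℂ] H} (hb : ∀ i, f i ≤ b) :
    ∃ T : H →L[ℂ] H,
      ∀ ξ η, Tendsto (fun i => inner ℂ η (f i ξ)) atTop (𝓝 (inner ℂ η (T ξ))) := by
  obtain ⟨i₀⟩ := ‹Nonempty ι›
  -- The decreasing positive net `b - f i` is used instead of `f i`: its diagonal coefficients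
  -- decrease and are bounded below by `0`, and positivity also bounds its norms from some index on.
  have hdiag : ∀ ξ, ∃ z : ℂ, Tendsto (fun i => inner ℂ ξ ((b - f i) ξ)) atTop (𝓝 z) := fun ξ => by
    have hpos : ∀ i, 0 ≤ inner ℂ ξ ((b - f i) ξ) := fun i =>
      op_nonneg_iff.1 (sub_nonneg.2 (hb i)) ξ
    have hanti : Antitone fun i => (inner ℂ ξ ((b - f i) ξ)).re := fun i j hij =>
      (Complex.le_def.1 (op_le_iff.1 (sub_le_sub_left (hf hij) b) ξ)).1
    have ht := tendsto_atTop_ciInf hanti ⟨0, by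
      rintro _ ⟨i, rfl⟩
      exact (Complex.le_def.1 (hpos i)).1⟩
    refine ⟨((⨅ i, (inner ℂ ξ ((b - f i) ξ)).re : ℝ) : ℂ), ?_⟩
    refine ((Complex.continuous_ofReal.tendsto _).comp ht).congr fun i => ?_
    apply Complex.ext
    · simp
    · have := (Complex.le_def.1 (hpos i)).2
      simpa using this
  have hoff : ∀ ξ η, ∃ z : ℂ, Tendsto (fun i => inner ℂ η ((b - f i) ξ)) atTop (𝓝 z) :=
      fun ξ η => by
    choose q hq using hdiag
    have hq' : ∀ ξ, Tendsto (fun i => inner ℂ ((b - f i) ξ) ξ) atTop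
        (𝓝 (starRingEnd ℂ (q ξ))) := fun ξ => by
      refine ((Complex.continuous_conj.tendsto _).comp (hq ξ)).congr fun i => ?_
      simp [inner_conj_symm]
    -- Polarization recovers the off-diagonal coefficients from the diagonal ones. It is stated with
    -- the operator in the left slot, hence the conjugations.
    have ht := ((((hq' (η + ξ)).sub (hq' (η - ξ))).add ((hq' (η + Complex.I • ξ)).const_mul
      Complex.I)).sub ((hq' (η - Complex.I • ξ)).const_mul Complex.I)).div_const 4
    refine ⟨_, ((Complex.continuous_conj.tendsto _).comp ht).congr fun i => ?_⟩
    have := inner_map_polarization ((b - f i : H →L[ℂ] H) : H →ₗ[ℂ] H) η ξ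
    simp only [ContinuousLinearMap.coe_coe] at this
    rw [Function.comp_apply, ← this, inner_conj_symm]
  have hM : ∀ᶠ i in atTop, ‖b - f i‖ ≤ ‖b - f i₀‖ := by
    filter_upwards [eventually_ge_atTop i₀] with i hi
    exact CStarAlgebra.norm_le_norm_of_nonneg_of_le (sub_nonneg.2 (hb i))
      (sub_le_sub_left (hf hi) b)
  obtain ⟨T, -, hT⟩ := exists_clm_of_tendsto (fun i => b - f i) (norm_nonneg _) hM hoff
  refine ⟨b - T, fun ξ η => ?_⟩
  have := (hT ξ η).const_sub (inner ℂ η (b ξ))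
  simpa [inner_sub_right] using this

theorem commute_of_tendsto {ι : Type*} {l : Filter ι} [l.NeBot] {f : ι → H →L[ℂ] H}
    {T R : H →L[ℂ] H}
    (h : ∀ ξ η, Tendsto (fun i => inner ℂ η (f i ξ)) l (𝓝 (inner ℂ η (T ξ))))
    (hR : ∀ i, R * f i = f i * R) : R * T = T * R := by
  refine ContinuousLinearMap.ext fun ξ => ext_inner_left ℂ fun η => ?_
  have h1 := h ξ (ContinuousLinearMap.adjoint R η)
  simp only [ContinuousLinearMap.adjoint_inner_left] at h1
  refine tendsto_nhds_unique h1 ((h (R ξ) η).congr fun i => ?_)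
  exact congrArg (fun A : H →L[ℂ] H => inner ℂ η (A ξ)) (hR i).symm

end Weak

/-! ### Monotone nets in a von Neumann algebra and normal representations -/

section Normal

variable {H₀ : Type u} [NormedAddCommGroup H₀] [InnerProductSpace ℂ H₀] [CompleteSpace H₀]
  {C : VonNeumannAlgebra H₀}

/-- The double commutant theorem in the form in which weak limits, square roots, positive parts and
inverses are shown to stay in `C`. -/
theorem mem_of_commute {T : H₀ →L[ℂ] H₀}
    (h : ∀ R : H₀ →L[ℂ] H₀, (∀ c : C.toStarSubalgebra, R * c = c * R) → R * T = T * R) :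
    T ∈ C.toStarSubalgebra := by
  rw [VonNeumannAlgebra.mem_carrier, ← C.centralizer_centralizer]
  intro R hR
  exact h R fun c => (hR c c.2).symm

/-- A bounded increasing net in a von Neumann algebra converges weakly to its least upper bound. -/
theorem exists_isLUB_of_monotone {ι : Type*} [Preorder ι] [IsDirectedOrder ι] [Nonempty ι]
    {f : ι → C.toStarSubalgebra} (hf : Monotone f) {b : C.toStarSubalgebra} (hb : ∀ i, f i ≤ b) :
    ∃ s : C.toStarSubalgebra, IsLUB (Set.range f) s ∧
      IsLUB (Set.range fun i => (f i : H₀ →L[ℂ] H₀)) s ∧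
      ∀ ξ η, Tendsto (fun i => inner ℂ η ((f i : H₀ →L[ℂ] H₀) ξ)) atTop
        (𝓝 (inner ℂ η ((s : H₀ →L[ℂ] H₀) ξ))) := by
  obtain ⟨T, hT⟩ := exists_tendsto_of_monotone (f := fun i => (f i : H₀ →L[ℂ] H₀))
    (fun i j hij => hf hij) (b := b) hb
  have hmem : T ∈ C.toStarSubalgebra :=
    mem_of_commute fun R hR => commute_of_tendsto hT fun i => hR (f i)
  have hlub := isLUB_of_tendsto (f := fun i => (f i : H₀ →L[ℂ] H₀))
    (fun i j hij => hf hij) (T := T) fun ξ => hT ξ ξ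
  refine ⟨⟨T, hmem⟩, ⟨?_, ?_⟩, hlub, hT⟩
  · rintro _ ⟨i, rfl⟩
    exact hlub.1 ⟨i, rfl⟩
  · intro c hc
    refine hlub.2 ?_
    rintro _ ⟨i, rfl⟩
    exact hc ⟨i, rfl⟩

theorem directedOn_range {ι α : Type*} [Preorder ι] [IsDirectedOrder ι] [Preorder α]
    {f : ι → α} (hf : Monotone f) : DirectedOn (· ≤ ·) (Set.range f) := by
  rintro _ ⟨i, rfl⟩ _ ⟨j, rfl⟩
  obtain ⟨k, hi, hj⟩ := exists_ge_ge i j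
  exact ⟨f k, ⟨k, rfl⟩, hf hi, hf hj⟩

section Rep

variable {H : Type u} [NormedAddCommGroup H] [InnerProductSpace ℂ H] [CompleteSpace H]
  {π : C.toStarSubalgebra →⋆ₐ[ℂ] (H →L[ℂ] H)}

theorem sqrt_mem {c : H₀ →L[ℂ] H₀} (hc : c ∈ C.toStarSubalgebra) :
    CFC.sqrt c ∈ C.toStarSubalgebra := by
  refine mem_of_commute fun R hR => ?_
  have h1 : Commute c R := (hR ⟨c, hc⟩).symm
  exact (h1.cfcₙ_nnreal NNReal.sqrt).symm

/-- Positive elements of a von Neumann algebra are squares of self-adjoint elements. -/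
theorem exists_sq_eq {c : C.toStarSubalgebra} (hc : 0 ≤ c) :
    ∃ r : C.toStarSubalgebra, star r = r ∧ r * r = c := by
  refine ⟨⟨CFC.sqrt (c : H₀ →L[ℂ] H₀), sqrt_mem c.2⟩, ?_, ?_⟩
  · exact Subtype.ext (CFC.sqrt_nonneg (c : H₀ →L[ℂ] H₀)).isSelfAdjoint.star_eq
  · exact Subtype.ext (CFC.sqrt_mul_sqrt_self (c : H₀ →L[ℂ] H₀) hc)

theorem star_mul_self_nonneg' (a : C.toStarSubalgebra) : 0 ≤ star a * a :=
  star_mul_self_nonneg (a : H₀ →L[ℂ] H₀)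

theorem rep_nonneg (π : C.toStarSubalgebra →⋆ₐ[ℂ] (H →L[ℂ] H)) {c : C.toStarSubalgebra}
    (hc : 0 ≤ c) : 0 ≤ π c := by
  obtain ⟨r, hr, rfl⟩ := exists_sq_eq hc
  rw [← hr, hr, map_mul]
  nth_rewrite 1 [← hr]
  rw [map_star]
  exact star_mul_self_nonneg _

theorem rep_mono (π : C.toStarSubalgebra →⋆ₐ[ℂ] (H →L[ℂ] H)) : Monotone π := fun a b hab => by
  have h : (0 : C.toStarSubalgebra) ≤ b - a :=
    show (0 : H₀ →L[ℂ] H₀) ≤ (b : H₀ →L[ℂ] H₀) - a from sub_nonneg.2 hab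
  have := rep_nonneg π h
  rwa [map_sub, sub_nonneg] at this

/-- The image net is increasing and bounded, so it has a weak limit. That limit is its least upper
bound, which normality identifies as `π s`. -/
theorem IsNormal.tendsto (hπ : IsNormal C π) {ι : Type*} [Preorder ι] [IsDirectedOrder ι]
    [Nonempty ι] {f : ι → C.toStarSubalgebra} (hf : Monotone f) {s : C.toStarSubalgebra}
    (hs : IsLUB (Set.range f) s) (ξ η : H) :
    Tendsto (fun i => inner ℂ η (π (f i) ξ)) atTop (𝓝 (inner ℂ η (π s ξ))) := by
  have h := hπ _ _ (Set.range_nonempty f) (directedOn_range hf) hs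
  rw [← Set.range_comp] at h
  obtain ⟨T, hT⟩ := exists_tendsto_of_monotone (f := π ∘ f) ((rep_mono π).comp hf)
    (b := π s) fun i => h.1 ⟨i, rfl⟩
  have := isLUB_of_tendsto ((rep_mono π).comp hf) fun ξ => hT ξ ξ
  rw [← this.unique h]
  exact hT ξ η

theorem isNormal_of_tendsto
    (h : ∀ (S : Set C.toStarSubalgebra) (s : C.toStarSubalgebra), S.Nonempty →
      DirectedOn (· ≤ ·) S → IsLUB S s → ∀ ξ,
        Tendsto (fun i : S => inner ℂ ξ (π i ξ)) atTop (𝓝 (inner ℂ ξ (π s ξ)))) :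
    IsNormal C π := by
  intro S s hne hdir hs
  have := hne.to_subtype
  have : IsDirectedOrder S := ⟨fun a b => by
    obtain ⟨c, hc, h1, h2⟩ := hdir a a.2 b b.2
    exact ⟨⟨c, hc⟩, h1, h2⟩⟩
  have := isLUB_of_tendsto (f := fun i : S => π i) (fun i j hij => rep_mono π hij)
    (h S s hne hdir hs)
  rwa [Set.image_eq_range]

theorem isNormal_subtype (C : VonNeumannAlgebra H₀) : IsNormal C C.toStarSubalgebra.subtype := by
  refine isNormal_of_tendsto fun S s hne hdir hs ξ => ?_
  have := hne.to_subtype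
  have : IsDirectedOrder S := ⟨fun a b => by
    obtain ⟨c, hc, h1, h2⟩ := hdir a a.2 b b.2
    exact ⟨⟨c, hc⟩, h1, h2⟩⟩
  obtain ⟨t, ht, -, hlim⟩ := exists_isLUB_of_monotone (f := fun i : S => (i : C.toStarSubalgebra))
    (fun i j hij => hij) (b := s) fun i => hs.1 i.2
  rw [Subtype.range_coe] at ht
  rw [hs.unique ht]
  exact hlim ξ ξ

end Rep

end Normal

/-! ### Weak* convergent sums and domination by positive families -/

section WeakSums

theorem hasSum_iff_tendsto {J α : Type*} [AddCommMonoid α] [TopologicalSpace α] {f : J → α}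
    {a : α} : HasSum f a ↔ Tendsto (fun F : Finset J => ∑ j ∈ F, f j) atTop (𝓝 a) := by
  rw [HasSum, SummationFilter.unconditional_filter]

variable {K H : Type u}
  [NormedAddCommGroup K] [InnerProductSpace ℂ K] [CompleteSpace K]
  [NormedAddCommGroup H] [InnerProductSpace ℂ H] [CompleteSpace H]

theorem re_inner_le (s : H →L[ℂ] H) (ξ : H) : (inner ℂ ξ (s ξ)).re ≤ ‖s‖ * ‖ξ‖ ^ 2 :=
  calc (inner ℂ ξ (s ξ)).re ≤ ‖inner ℂ ξ (s ξ)‖ := Complex.re_le_norm _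
    _ ≤ ‖ξ‖ * ‖s ξ‖ := norm_inner_le_norm _ _
    _ ≤ ‖ξ‖ * (‖s‖ * ‖ξ‖) := by gcongr; exact s.le_opNorm ξ
    _ = ‖s‖ * ‖ξ‖ ^ 2 := by ring

theorem re_inner_nonneg {a : H →L[ℂ] H} (ha : 0 ≤ a) (ξ : H) : 0 ≤ (inner ℂ ξ (a ξ)).re :=
  (Complex.le_def.1 (op_nonneg_iff.1 ha ξ)).1

theorem opNorm_le_of_quadratic {T : K →L[ℂ] H} {M : ℝ} (hM : 0 ≤ M)
    (h : ∀ ξ η, ‖inner ℂ η (T ξ)‖ ≤ M * (‖η‖ ^ 2 + ‖ξ‖ ^ 2) / 2) : ‖T‖ ≤ M := by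
  refine ContinuousLinearMap.opNorm_le_of_unit_norm hM fun ξ hξ => ?_
  by_cases h0 : T ξ = 0
  · simpa [h0] using hM
  have hpos : 0 < ‖T ξ‖ := norm_pos_iff.2 h0
  -- Tested on the unit vector in the direction of `T ξ`, the quadratic bound reads `‖T ξ‖ ≤ M (1 +
  -- 1) / 2`.
  have := h ξ (((‖T ξ‖⁻¹ : ℝ) : ℂ) • T ξ)
  rw [inner_smul_left, inner_self_eq_norm_sq_to_K, norm_mul, norm_smul] at this
  simp only [Complex.conj_ofReal, Complex.norm_real, norm_inv, norm_norm, norm_pow, hξ,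
    Complex.coe_algebraMap] at this
  rw [inv_mul_cancel₀ hpos.ne', sq, inv_mul_cancel_left₀ hpos.ne'] at this
  linarith

theorem HasWeakStarSum.weak {J : Type u} {f : J → K →L[ℂ] H} {T : K →L[ℂ] H}
    (h : HasWeakStarSum f T) (ξ : K) (η : H) :
    HasSum (fun j => inner ℂ η (f j ξ)) (inner ℂ η (T ξ)) := by
  have key : ∀ S : K →L[ℂ] H, ∑' n : ℕ, inner ℂ (if n = 0 then η else 0)
      (S (if n = 0 then ξ else 0)) = inner ℂ η (S ξ) := fun S => by
    rw [tsum_eq_single 0]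
    · simp
    · intro n hn
      simp [hn]
  have := h (fun n => if n = 0 then ξ else 0) (fun n => if n = 0 then η else 0)
    (summable_of_ne_finset_zero (s := {0}) fun n hn => by simp at hn; simp [hn])
    (summable_of_ne_finset_zero (s := {0}) fun n hn => by simp at hn; simp [hn])
  simpa only [key] using this

theorem HasWeakStarSum.diag {J : Type u} {f : J → H →L[ℂ] H} {T : H →L[ℂ] H}
    (h : HasWeakStarSum f T) (ξ : H) :
    HasSum (fun j => (inner ℂ ξ (f j ξ)).re) (inner ℂ ξ (T ξ)).re :=
  Complex.hasSum_re (h.weak ξ ξ)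

theorem summable_inner {ξ : ℕ → K} {η : ℕ → H} (hξ : Summable fun n => ‖ξ n‖ ^ 2)
    (hη : Summable fun n => ‖η n‖ ^ 2) (S : K →L[ℂ] H) :
    Summable fun n => inner ℂ (η n) (S (ξ n)) := by
  refine Summable.of_norm_bounded ((hη.add hξ).mul_left ‖S‖) fun n => ?_
  calc ‖inner ℂ (η n) (S (ξ n))‖ ≤ ‖η n‖ * ‖S (ξ n)‖ := norm_inner_le_norm _ _
    _ ≤ ‖η n‖ * (‖S‖ * ‖ξ n‖) := by gcongr; exact S.le_opNorm _
    _ = ‖S‖ * (‖η n‖ * ‖ξ n‖) := by ring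
    _ ≤ ‖S‖ * (‖η n‖ ^ 2 + ‖ξ n‖ ^ 2) := by
      gcongr
      nlinarith [sq_nonneg (‖η n‖ - ‖ξ n‖), sq_nonneg ‖η n‖, sq_nonneg ‖ξ n‖]

/-- Norm convergent sums converge weak*. -/
theorem hasWeakStarSum_of_hasSum {J : Type u} {f : J → K →L[ℂ] H} {T : K →L[ℂ] H}
    (h : HasSum f T) : HasWeakStarSum f T := by
  intro ξ η hξ hη
  let F : (K →L[ℂ] H) →ₗ[ℂ] ℂ :=
    { toFun := fun S => ∑' n, inner ℂ (η n) (S (ξ n))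
      map_add' := fun S S' => by
        simp only [add_apply, inner_add_right]
        exact (summable_inner hξ hη S).tsum_add (summable_inner hξ hη S')
      map_smul' := fun c S => by
        simp only [smul_apply, inner_smul_right, RingHom.id_apply, smul_eq_mul]
        exact tsum_mul_left }
  let F' : (K →L[ℂ] H) →L[ℂ] ℂ := F.mkContinuous (∑' n, (‖η n‖ ^ 2 + ‖ξ n‖ ^ 2)) fun S => by
    rw [mul_comm, ← tsum_mul_left]
    refine tsum_of_norm_bounded ((hη.add hξ).mul_left ‖S‖).hasSum fun n => ?_
    calc ‖inner ℂ (η n) (S (ξ n))‖ ≤ ‖η n‖ * ‖S (ξ n)‖ := norm_inner_le_norm _ _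
      _ ≤ ‖η n‖ * (‖S‖ * ‖ξ n‖) := by gcongr; exact S.le_opNorm _
      _ = ‖S‖ * (‖η n‖ * ‖ξ n‖) := by ring
      _ ≤ ‖S‖ * (‖η n‖ ^ 2 + ‖ξ n‖ ^ 2) := by
        gcongr
        nlinarith [sq_nonneg (‖η n‖ - ‖ξ n‖), sq_nonneg ‖η n‖, sq_nonneg ‖ξ n‖]
  exact F'.hasSum h

/-- All terms are nonnegative, so it suffices to sum over `j` first. This gives `⟨ξ n, s (ξ n)⟩ ≤
‖s‖ ‖ξ n‖²`, which is summable in `n`. -/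
theorem summable_prod_of_diag {J : Type u} {a : J → H →L[ℂ] H} {s : H →L[ℂ] H}
    (ha : ∀ j, 0 ≤ a j)
    (hs : ∀ ξ, HasSum (fun j => (inner ℂ ξ (a j ξ)).re) (inner ℂ ξ (s ξ)).re)
    {ξ : ℕ → H} (hξ : Summable fun n => ‖ξ n‖ ^ 2) :
    Summable fun p : J × ℕ => (inner ℂ (ξ p.2) (a p.1 (ξ p.2))).re := by
  have : Summable fun p : ℕ × J => (inner ℂ (ξ p.1) (a p.2 (ξ p.1))).re := by
    rw [summable_prod_of_nonneg fun p => re_inner_nonneg (ha _) _]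
    refine ⟨fun n => (hs (ξ n)).summable, ?_⟩
    simp only [(hs _).tsum_eq]
    exact Summable.of_nonneg_of_le (fun n => (hs (ξ n)).nonneg fun j => re_inner_nonneg (ha j) _)
      (fun n => re_inner_le s (ξ n)) (hξ.mul_left ‖s‖)
  exact this.prod_symm

/-- The family `A` is dominated by the families `a` and `b`, which sum up to `s` and `t`. -/
structure Dominated {J : Type u} (A : J → K →L[ℂ] H) (a : J → H →L[ℂ] H) (s : H →L[ℂ] H)
    (b : J → K →L[ℂ] K) (t : K →L[ℂ] K) : Prop where
  left_nonneg : ∀ j, 0 ≤ a j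
  right_nonneg : ∀ j, 0 ≤ b j
  hasSum_left : ∀ ξ, HasSum (fun j => (inner ℂ ξ (a j ξ)).re) (inner ℂ ξ (s ξ)).re
  hasSum_right : ∀ ξ, HasSum (fun j => (inner ℂ ξ (b j ξ)).re) (inner ℂ ξ (t ξ)).re
  le : ∀ j ξ η, ‖inner ℂ η (A j ξ)‖ ≤ ((inner ℂ η (a j η)).re + (inner ℂ ξ (b j ξ)).re) / 2

namespace Dominated

variable {J : Type u} {A : J → K →L[ℂ] H} {a : J → H →L[ℂ] H} {s : H →L[ℂ] H}
    {b : J → K →L[ℂ] K} {t : K →L[ℂ] K}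

theorem summable_prod (h : Dominated A a s b t) {ξ : ℕ → K} {η : ℕ → H}
    (hξ : Summable fun n => ‖ξ n‖ ^ 2) (hη : Summable fun n => ‖η n‖ ^ 2) :
    Summable fun p : J × ℕ => inner ℂ (η p.2) (A p.1 (ξ p.2)) :=
  Summable.of_norm_bounded (((summable_prod_of_diag h.left_nonneg h.hasSum_left hη).add
    (summable_prod_of_diag h.right_nonneg h.hasSum_right hξ)).div_const 2) fun _ => h.le _ _ _

theorem summable_weakStar (h : Dominated A a s b t) {ξ : ℕ → K} {η : ℕ → H}
    (hξ : Summable fun n => ‖ξ n‖ ^ 2) (hη : Summable fun n => ‖η n‖ ^ 2) :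
    Summable fun j => ∑' n, inner ℂ (η n) (A j (ξ n)) :=
  (h.summable_prod hξ hη).prod

/-- Domination makes the double series over `J × ℕ` absolutely summable, so the two summations may
be exchanged and weak convergence improves to weak* convergence. -/
theorem hasWeakStarSum (h : Dominated A a s b t) {T : K →L[ℂ] H}
    (hT : ∀ ξ η, HasSum (fun j => inner ℂ η (A j ξ)) (inner ℂ η (T ξ))) : HasWeakStarSum A T := by
  intro ξ η hξ hη
  have hF := h.summable_prod hξ hη
  have h1 := hF.hasSum.prod_fiberwise fun j => (hF.prod_factor j).hasSum
  convert h1 using 1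
  have h2 := hF.prod_symm.tsum_prod
  simp only [Prod.swap, (hT _ _).tsum_eq] at h2
  rw [← h2]
  exact (Equiv.prodComm ℕ J).tsum_eq fun p : J × ℕ => inner ℂ (η p.2) (A p.1 (ξ p.2))

theorem norm_sum_le (h : Dominated A a s b t) {M : ℝ} (hs : ‖s‖ ≤ M) (ht : ‖t‖ ≤ M)
    (F : Finset J) : ‖∑ j ∈ F, A j‖ ≤ M := by
  refine opNorm_le_of_quadratic ((norm_nonneg _).trans hs) fun ξ η => ?_
  have hl : ∑ j ∈ F, (inner ℂ η (a j η)).re ≤ M * ‖η‖ ^ 2 :=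
    (sum_le_hasSum F (fun j _ => re_inner_nonneg (h.left_nonneg j) η) (h.hasSum_left η)).trans
      ((re_inner_le s η).trans (by gcongr))
  have hr : ∑ j ∈ F, (inner ℂ ξ (b j ξ)).re ≤ M * ‖ξ‖ ^ 2 :=
    (sum_le_hasSum F (fun j _ => re_inner_nonneg (h.right_nonneg j) ξ) (h.hasSum_right ξ)).trans
      ((re_inner_le t ξ).trans (by gcongr))
  have := norm_sum_le_of_le F fun j _ => h.le j ξ η
  rw [← Finset.sum_div, Finset.sum_add_distrib] at this
  rw [sum_apply, inner_sum]
  linarith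

/-- A dominated family has a weak* sum. -/
theorem exists_hasWeakStarSum (h : Dominated A a s b t) {M : ℝ} (hs : ‖s‖ ≤ M) (ht : ‖t‖ ≤ M) :
    ∃ T : K →L[ℂ] H, ‖T‖ ≤ M ∧ HasWeakStarSum A T := by
  have hsum : ∀ ξ η, Summable fun j => inner ℂ η (A j ξ) := fun ξ η =>
    Summable.of_norm_bounded (((h.hasSum_left η).summable.add
      (h.hasSum_right ξ).summable).div_const 2) fun j => h.le j ξ η
  obtain ⟨T, hT, hlim⟩ := exists_clm_of_tendsto (l := atTop) (fun F : Finset J => ∑ j ∈ F, A j)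
    ((norm_nonneg _).trans hs) (Eventually.of_forall (h.norm_sum_le hs ht)) fun ξ η =>
      ⟨∑' j, inner ℂ η (A j ξ), by
        simpa only [sum_apply, inner_sum] using hasSum_iff_tendsto.1 (hsum ξ η).hasSum⟩
  refine ⟨T, hT, h.hasWeakStarSum fun ξ η => ?_⟩
  simpa only [hasSum_iff_tendsto, sum_apply, inner_sum] using hlim ξ η

theorem norm_le (h : Dominated A a s b t) {M : ℝ} (hs : ‖s‖ ≤ M) (ht : ‖t‖ ≤ M)
    {T : K →L[ℂ] H} (hT : HasWeakStarSum A T) : ‖T‖ ≤ M := by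
  obtain ⟨T', hT', h'⟩ := h.exists_hasWeakStarSum hs ht
  have : T = T' := ContinuousLinearMap.ext fun ξ => ext_inner_left ℂ fun η =>
    (hT.weak ξ η).unique (h'.weak ξ η)
  rwa [this]

end Dominated

theorem HasWeakStarSum.comp_left {J : Type u} {f : J → K →L[ℂ] H} {T : K →L[ℂ] H}
    (h : HasWeakStarSum f T) (R : H →L[ℂ] H) (ξ : K) (η : H) :
    HasSum (fun j => inner ℂ η ((R ∘L f j) ξ)) (inner ℂ η ((R ∘L T) ξ)) := by
  simpa only [ContinuousLinearMap.adjoint_inner_left, ContinuousLinearMap.comp_apply] using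
    h.weak ξ (ContinuousLinearMap.adjoint R η)

end WeakSums

/-! ### Sums of positive elements of `C` and their action on embedded bimodules -/

section PositiveFamilies

variable {H₀ : Type u} [NormedAddCommGroup H₀] [InnerProductSpace ℂ H₀] [CompleteSpace H₀]
  {C : VonNeumannAlgebra H₀}
  {H : Type u} [NormedAddCommGroup H] [InnerProductSpace ℂ H] [CompleteSpace H]
  {π : C.toStarSubalgebra →⋆ₐ[ℂ] (H →L[ℂ] H)}

theorem norm_inner_le_of_nonneg {a : H →L[ℂ] H} (ha : 0 ≤ a) (ξ η : H) :
    ‖inner ℂ η (a ξ)‖ ≤ ((inner ℂ η (a η)).re + (inner ℂ ξ (a ξ)).re) / 2 := by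
  have hr := (CFC.sqrt_nonneg a).isSelfAdjoint
  have hrr := CFC.sqrt_mul_sqrt_self a ha
  set r := CFC.sqrt a
  have key : ∀ ξ η, inner ℂ η (a ξ) = inner ℂ (r η) (r ξ) := fun ξ η => by
    rw [← hrr, mul_apply_eq_comp, ← ContinuousLinearMap.adjoint_inner_left]
    have : ContinuousLinearMap.adjoint r = r := hr.star_eq
    rw [this]
  have hsq : ∀ ξ, (inner ℂ ξ (a ξ)).re = ‖r ξ‖ ^ 2 := fun ξ => by
    rw [key]
    exact inner_self_eq_norm_sq (𝕜 := ℂ) (r ξ)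
  rw [hsq, hsq, key]
  have := norm_inner_le_norm (𝕜 := ℂ) (r η) (r ξ)
  nlinarith [sq_nonneg (‖r η‖ - ‖r ξ‖)]

theorem dominated_self {J : Type u} {a : J → H →L[ℂ] H} {s : H →L[ℂ] H} (ha : ∀ j, 0 ≤ a j)
    (hs : ∀ ξ, HasSum (fun j => (inner ℂ ξ (a j ξ)).re) (inner ℂ ξ (s ξ)).re) :
    Dominated a a s a s :=
  ⟨ha, ha, hs, hs, fun j => norm_inner_le_of_nonneg (ha j)⟩

theorem monotone_sum {J : Type u} {c : J → C.toStarSubalgebra} (hc : ∀ j, 0 ≤ c j) :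
    Monotone fun F : Finset J => ∑ j ∈ F, c j := fun F G hFG => by
  change ((∑ j ∈ F, c j : C.toStarSubalgebra) : H₀ →L[ℂ] H₀) ≤ (∑ j ∈ G, c j : C.toStarSubalgebra)
  rw [AddSubmonoidClass.coe_finsetSum, AddSubmonoidClass.coe_finsetSum]
  exact Finset.sum_le_sum_of_subset_of_nonneg hFG fun j _ _ => hc j

theorem isLUB_of_hasSum {J : Type u} {c : J → C.toStarSubalgebra} (hc : ∀ j, 0 ≤ c j)
    {s : C.toStarSubalgebra}
    (hs : ∀ ξ, HasSum (fun j => inner ℂ ξ ((c j : H₀ →L[ℂ] H₀) ξ))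
      (inner ℂ ξ ((s : H₀ →L[ℂ] H₀) ξ))) :
    IsLUB (Set.range fun F : Finset J => ∑ j ∈ F, c j) s := by
  have h := isLUB_of_tendsto
    (f := fun F : Finset J => ((∑ j ∈ F, c j : C.toStarSubalgebra) : H₀ →L[ℂ] H₀))
    (fun F G hFG => monotone_sum hc hFG) (T := (s : H₀ →L[ℂ] H₀)) fun ξ => by
      have := hasSum_iff_tendsto.1 (hs ξ)
      simpa only [AddSubmonoidClass.coe_finsetSum, sum_apply, inner_sum] using this
  constructor
  · rintro _ ⟨F, rfl⟩
    exact h.1 ⟨F, rfl⟩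
  · intro b hb
    refine h.2 ?_
    rintro _ ⟨F, rfl⟩
    exact hb ⟨F, rfl⟩

/-- Normal representations preserve weak sums of positive elements. -/
theorem IsNormal.hasSum (hπ : IsNormal C π) {J : Type u} {c : J → C.toStarSubalgebra}
    (hc : ∀ j, 0 ≤ c j) {s : C.toStarSubalgebra}
    (hs : IsLUB (Set.range fun F : Finset J => ∑ j ∈ F, c j) s) (ξ η : H) :
    HasSum (fun j => inner ℂ η (π (c j) ξ)) (inner ℂ η (π s ξ)) := by
  have := hπ.tendsto (monotone_sum hc) hs ξ η
  simpa only [hasSum_iff_tendsto, map_sum, sum_apply, inner_sum] using this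

theorem IsNormal.hasSum_diag (hπ : IsNormal C π) {J : Type u} {c : J → C.toStarSubalgebra}
    (hc : ∀ j, 0 ≤ c j) {s : C.toStarSubalgebra}
    (hs : IsLUB (Set.range fun F : Finset J => ∑ j ∈ F, c j) s) (ξ : H) :
    HasSum (fun j => (inner ℂ ξ (π (c j) ξ)).re) (inner ℂ ξ (π s ξ)).re :=
  Complex.hasSum_re (hπ.hasSum hc hs ξ ξ)

theorem hasWeakStarSum_of_isLUB {J : Type u} {c : J → C.toStarSubalgebra}
    (hc : ∀ j, 0 ≤ c j) {s : C.toStarSubalgebra}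
    (hs : IsLUB (Set.range fun F : Finset J => ∑ j ∈ F, c j) s) :
    HasWeakStarSum (fun j => (c j : H₀ →L[ℂ] H₀)) (s : H₀ →L[ℂ] H₀) :=
  (dominated_self (fun j => hc j) fun ξ =>
    (isNormal_subtype C).hasSum_diag hc hs ξ).hasWeakStarSum fun ξ η =>
      (isNormal_subtype C).hasSum hc hs ξ η

variable {Z K : Type u} [NormedAddCommGroup Z] [NormedSpace ℂ Z] [Module C.toStarSubalgebra Z]
  [NormedAddCommGroup K] [InnerProductSpace ℂ K] [CompleteSpace K]

theorem rep_mul_self_inner (π : C.toStarSubalgebra →⋆ₐ[ℂ] (H →L[ℂ] H)) {r : C.toStarSubalgebra}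
    (hr : star r = r) (ξ : H) : (inner ℂ ξ (π (r * r) ξ)).re = ‖π r ξ‖ ^ 2 := by
  nth_rewrite 1 [← hr]
  rw [map_mul, map_star, mul_apply_eq_comp, ContinuousLinearMap.star_eq_adjoint,
    ContinuousLinearMap.adjoint_inner_right]
  exact inner_self_eq_norm_sq (𝕜 := ℂ) (π r ξ)

/-- With `c = r * r`, centrality moves one factor `r` to each side of `z`. The coefficient is then
`⟨r η, z (r ξ)⟩`, and Cauchy–Schwarz with the arithmetic-geometric mean inequality finishes. Every
upper bound on the norm of a represented element rests on this. -/
theorem NormalEmbedding.norm_inner_smul_le (E : NormalEmbedding C Z K H) {c : C.toStarSubalgebra}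
    (hc : 0 ≤ c) {z : Z} (hz : ‖z‖ ≤ 1) (ξ : K) (η : H) :
    ‖inner ℂ η (E.emb (c • z) ξ)‖ ≤
      ((inner ℂ η (E.left c η)).re + (inner ℂ ξ (E.right c ξ)).re) / 2 := by
  obtain ⟨r, hr, rfl⟩ := exists_sq_eq hc
  rw [rep_mul_self_inner _ hr, rep_mul_self_inner _ hr, mul_smul, E.emb_left, E.emb_right]
  have h1 : inner ℂ η ((E.left r ∘L E.emb z ∘L E.right r) ξ) =
      inner ℂ (E.left r η) (E.emb z (E.right r ξ)) := by
    conv_lhs => rw [← hr]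
    rw [map_star, ContinuousLinearMap.star_eq_adjoint, ContinuousLinearMap.comp_apply,
      ContinuousLinearMap.adjoint_inner_right, hr]
    rfl
  rw [h1]
  have h2 : ‖E.emb z (E.right r ξ)‖ ≤ ‖E.right r ξ‖ := by
    have := (E.emb z).le_of_opNorm_le ((E.emb.norm_map z).le.trans hz) (E.right r ξ)
    simpa using this
  have h3 := (norm_inner_le_norm (𝕜 := ℂ) (E.left r η) (E.emb z (E.right r ξ))).trans
    (mul_le_mul_of_nonneg_left h2 (norm_nonneg _))
  nlinarith [sq_nonneg (‖E.left r η‖ - ‖E.right r ξ‖)]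

theorem NormalEmbedding.dominated (E : NormalEmbedding C Z K H) {J : Type u}
    {c : J → C.toStarSubalgebra} (hc : ∀ j, 0 ≤ c j) {s : C.toStarSubalgebra}
    (hs : IsLUB (Set.range fun F : Finset J => ∑ j ∈ F, c j) s) {z : J → Z} (hz : ∀ j, ‖z j‖ ≤ 1) :
    Dominated (fun j => E.emb (c j • z j)) (fun j => E.left (c j)) (E.left s)
      (fun j => E.right (c j)) (E.right s) where
  left_nonneg j := rep_nonneg _ (hc j)
  right_nonneg j := rep_nonneg _ (hc j)
  hasSum_left ξ := E.left_normal.hasSum_diag hc hs ξ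
  hasSum_right ξ := E.right_normal.hasSum_diag hc hs ξ
  le j ξ η := E.norm_inner_smul_le (hc j) (hz j) ξ η

end PositiveFamilies

/-! ### Projections of `C`: spectral cuts, partitions and gluing -/

section Projections

variable {H₀ : Type u} [NormedAddCommGroup H₀] [InnerProductSpace ℂ H₀] [CompleteSpace H₀]
  {C : VonNeumannAlgebra H₀}

theorem coe_isStarProjection {p : C.toStarSubalgebra} (hp : IsStarProjection p) :
    IsStarProjection (p : H₀ →L[ℂ] H₀) := hp.map C.toStarSubalgebra.subtype

theorem proj_nonneg {p : C.toStarSubalgebra} (hp : IsStarProjection p) : 0 ≤ p :=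
  (coe_isStarProjection hp).nonneg

/-- The range projection of an element of a von Neumann algebra. -/
theorem exists_range_projection (a : C.toStarSubalgebra) :
    ∃ p : C.toStarSubalgebra, IsStarProjection p ∧ p * a = a ∧
      ∀ b : C.toStarSubalgebra, b * a = 0 → b * p = 0 := by
  let A : H₀ →L[ℂ] H₀ := a
  let U : Submodule ℂ H₀ := (LinearMap.range (A : H₀ →ₗ[ℂ] H₀)).topologicalClosure
  have hU : IsStarProjection U.starProjection := isStarProjection_starProjection
  -- The range of `a` is invariant under everything that commutes with `a`, in particular under the
  -- commutant of `C`, and so is its closure.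
  have hmem : U.starProjection ∈ C.toStarSubalgebra := by
    refine (VonNeumannAlgebra.IsStarProjection.mem_iff hU C).2 fun y hy => ?_
    rw [Submodule.range_starProjection, Module.End.mem_invtSubmodule]
    have hya : ∀ ξ, y (A ξ) = A (y ξ) := fun ξ =>
      congrArg (fun T : H₀ →L[ℂ] H₀ => T ξ) (VonNeumannAlgebra.mem_commutant_iff.1 hy a a.2).symm
    intro ξ hξ
    have : Set.MapsTo y (LinearMap.range (A : H₀ →ₗ[ℂ] H₀)) (LinearMap.range (A : H₀ →ₗ[ℂ] H₀)) := by
      rintro _ ⟨ζ, rfl⟩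
      exact ⟨y ζ, (hya ζ).symm⟩
    exact this.closure y.continuous hξ
  refine ⟨⟨_, hmem⟩, ⟨Subtype.ext hU.1, Subtype.ext hU.2⟩, ?_, fun b hb => ?_⟩
  · refine Subtype.ext (ContinuousLinearMap.ext fun ξ => ?_)
    exact Submodule.starProjection_eq_self_iff.2
      (Submodule.le_topologicalClosure _ (LinearMap.mem_range_self (A : H₀ →ₗ[ℂ] H₀) ξ))
  · refine Subtype.ext (ContinuousLinearMap.ext fun ξ => ?_)
    have hle : U ≤ LinearMap.ker ((b : H₀ →L[ℂ] H₀) : H₀ →ₗ[ℂ] H₀) := by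
      refine Submodule.topologicalClosure_minimal _ ?_
        (ContinuousLinearMap.isClosed_ker (b : H₀ →L[ℂ] H₀))
      rintro _ ⟨ζ, rfl⟩
      exact congrArg (fun T : C.toStarSubalgebra => (T : H₀ →L[ℂ] H₀) ζ) hb
    have h2 : U.starProjection ξ ∈ U := by
      rw [Submodule.starProjection_apply]
      exact Submodule.coe_mem _
    exact hle h2

theorem posPart_mem {c : H₀ →L[ℂ] H₀} (hc : c ∈ C.toStarSubalgebra) : c⁺ ∈ C.toStarSubalgebra := by
  refine mem_of_commute fun R hR => ?_
  have h1 : Commute c R := (hR ⟨c, hc⟩).symm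
  rw [CFC.posPart_def]
  exact (h1.cfcₙ_real _).symm

theorem rep_proj_inner {H : Type u} [NormedAddCommGroup H] [InnerProductSpace ℂ H] [CompleteSpace H]
    (π : C.toStarSubalgebra →⋆ₐ[ℂ] (H →L[ℂ] H)) {p : C.toStarSubalgebra} (hp : IsStarProjection p)
    (ξ : H) : (inner ℂ ξ (π p ξ)).re = ‖π p ξ‖ ^ 2 := by
  rw [← rep_mul_self_inner π hp.2, hp.1]

variable [IsMulCommutative C.toStarSubalgebra]

theorem proj_mul {p q : C.toStarSubalgebra} (hp : IsStarProjection p) (hq : IsStarProjection q) :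
    IsStarProjection (p * q) := hp.mul hq (mul_comm p q)

theorem nonneg_mul_proj {p c : C.toStarSubalgebra} (hp : IsStarProjection p) (hc : 0 ≤ c) :
    0 ≤ p * c := by
  have h : (0 : H₀ →L[ℂ] H₀) ≤ star (p : H₀ →L[ℂ] H₀) * c * p := 
    star_left_conjugate_nonneg (show (0 : H₀ →L[ℂ] H₀) ≤ c from hc) _
  have e : star p * c * p = p * c := by
    rw [hp.2.star_eq, mul_comm, ← mul_assoc, hp.1]
  rw [← e]
  exact h

/-- If `s` is smaller than `r` at some vector of the range of `q`, then `s ≤ r` on a nonzero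
subprojection of `q`. -/
theorem exists_projection_le {s q : C.toStarSubalgebra} (hs : star s = s) (hq : IsStarProjection q)
    {r : ℝ} {ξ : H₀} (hξ : (q : H₀ →L[ℂ] H₀) ξ = ξ)
    (h : (inner ℂ ξ ((s : H₀ →L[ℂ] H₀) ξ)).re < r * ‖ξ‖ ^ 2) :
    ∃ p : C.toStarSubalgebra, IsStarProjection p ∧ p ≠ 0 ∧ p * q = p ∧ p * s ≤ (r : ℂ) • p := by
  let d : C.toStarSubalgebra := (r : ℂ) • 1 - s
  have hd : IsSelfAdjoint d := by
    rw [isSelfAdjoint_iff, star_sub, star_smul, hs, star_one]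
    simp [d]
  have hd' : IsSelfAdjoint (d : H₀ →L[ℂ] H₀) := congrArg Subtype.val hd
  let d₁ : C.toStarSubalgebra := ⟨(d : H₀ →L[ℂ] H₀)⁺, posPart_mem d.2⟩
  let d₂ : C.toStarSubalgebra := d₁ - d
  have hd₂ : (d₂ : H₀ →L[ℂ] H₀) = (d : H₀ →L[ℂ] H₀)⁻ := by
    have := CFC.posPart_sub_negPart (d : H₀ →L[ℂ] H₀) hd'
    change (d : H₀ →L[ℂ] H₀)⁺ - (d : H₀ →L[ℂ] H₀) = _
    nth_rewrite 2 [← this]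
    abel
  have h12 : d₂ * d₁ = 0 := by
    rw [mul_comm]
    apply Subtype.ext
    change (d : H₀ →L[ℂ] H₀)⁺ * (d₂ : H₀ →L[ℂ] H₀) = 0
    rw [hd₂, CFC.posPart_mul_negPart]
  have hd₁0 : 0 ≤ d₁ := CFC.posPart_nonneg (d : H₀ →L[ℂ] H₀)
  have hd₂0 : 0 ≤ d₂ := by
    change (0 : H₀ →L[ℂ] H₀) ≤ (d₂ : H₀ →L[ℂ] H₀)
    rw [hd₂]
    exact CFC.negPart_nonneg _
  -- With `d = r - s`, the projection sought is the support of `q d⁺`. It lies under `q` and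
  -- annihilates `d⁻`, so `p (r - s) = p d⁺ ≥ 0`.
  obtain ⟨p, hp, hpa, hpb⟩ := exists_range_projection (q * d₁)
  have hpd₂ : p * d₂ = 0 := by
    rw [mul_comm]
    refine hpb _ ?_
    rw [mul_left_comm, h12, mul_zero]
  have hpq : p * q = p := by
    have := hpb (1 - q) (by rw [← mul_assoc, sub_mul, one_mul, hq.1, sub_self, zero_mul])
    rw [sub_mul, one_mul, sub_eq_zero] at this
    rw [mul_comm]
    exact this.symm
  refine ⟨p, hp, ?_, hpq, ?_⟩
  -- If `q d⁺ = 0`, then `q d = -q d⁻`, so `⟨ξ, d ξ⟩ ≤ 0` for the given `ξ` in the range of `q`,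
  -- contrary to `h`.
  · rintro rfl
    have hq1 : q * d₁ = 0 := by rw [← hpa, zero_mul]
    have hqd : q * d = - (q * d₂) := by
      have : d = d₁ - d₂ := by simp [d₂]
      rw [this, mul_sub, hq1, zero_sub]
    have hqs : ∀ c : C.toStarSubalgebra, inner ℂ ξ (((q * c : C.toStarSubalgebra) : H₀ →L[ℂ] H₀) ξ)
        = inner ℂ ξ ((c : H₀ →L[ℂ] H₀) ξ) := fun c => by
      change inner ℂ ξ ((q : H₀ →L[ℂ] H₀) ((c : H₀ →L[ℂ] H₀) ξ)) = _
      have : ContinuousLinearMap.adjoint (q : H₀ →L[ℂ] H₀) = q := (coe_isStarProjection hq).2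
      rw [← ContinuousLinearMap.adjoint_inner_left, this, hξ]
    have h1 := hqs d
    rw [hqd] at h1
    have h2 : inner ℂ ξ (((-(q * d₂) : C.toStarSubalgebra) : H₀ →L[ℂ] H₀) ξ) =
        - inner ℂ ξ ((d₂ : H₀ →L[ℂ] H₀) ξ) := by
      rw [← hqs d₂, ← inner_neg_right]
      rfl
    have h3 : inner ℂ ξ ((d : H₀ →L[ℂ] H₀) ξ) =
        r * inner ℂ ξ ξ - inner ℂ ξ ((s : H₀ →L[ℂ] H₀) ξ) := by
      rw [← inner_smul_right, ← inner_sub_right]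
      rfl
    have h4 := re_inner_nonneg (a := (d₂ : H₀ →L[ℂ] H₀)) hd₂0 ξ
    rw [h2, h3] at h1
    have h5 := congrArg Complex.re h1
    have h6 : (inner ℂ ξ ξ).re = ‖ξ‖ ^ 2 := inner_self_eq_norm_sq (𝕜 := ℂ) ξ
    rw [Complex.neg_re, Complex.sub_re, Complex.re_ofReal_mul, h6] at h5
    linarith
  · have h1 : (r : ℂ) • p - p * s = p * d₁ := by
      have e1 : p * d = p * d₁ := by
        have : d = d₁ - d₂ := by simp [d₂]
        rw [this, mul_sub, hpd₂, sub_zero]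
      rw [← e1, mul_sub, mul_smul_comm, mul_one]
    have h2 : 0 ≤ (r : ℂ) • p - p * s := by
      rw [h1]
      exact nonneg_mul_proj hp hd₁0
    exact sub_nonneg.1 (show (0 : H₀ →L[ℂ] H₀) ≤ (((r : ℂ) • p : C.toStarSubalgebra) : H₀ →L[ℂ] H₀) -
      ((p * s : C.toStarSubalgebra) : H₀ →L[ℂ] H₀) from h2)

/-- A maximal orthogonal family of projections in `C`. -/
structure IsPartition {J : Type u} (p : J → C.toStarSubalgebra) : Prop where
  proj : ∀ j, IsStarProjection (p j)
  orth : Pairwise fun i j => p i * p j = 0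
  max : ∀ q, IsStarProjection q → (∀ j, q * p j = 0) → q = 0

/-- Exhaustion: a property of projections that holds for some nonzero subprojection of every nonzero
projection holds for all members of some partition. -/
theorem exists_partition (P : C.toStarSubalgebra → Prop)
    (h : ∀ q, IsStarProjection q → q ≠ 0 → ∃ p, IsStarProjection p ∧ p ≠ 0 ∧ p * q = p ∧ P p) :
    ∃ (J : Type u) (p : J → C.toStarSubalgebra), IsPartition p ∧ ∀ j, P (p j) := by
  let 𝒮 : Set (Set C.toStarSubalgebra) :=
    {S | (∀ p ∈ S, IsStarProjection p ∧ P p) ∧ S.Pairwise fun a b => a * b = 0}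
  obtain ⟨S, hS⟩ := zorn_subset 𝒮 fun c hc hchain => by
    refine ⟨⋃₀ c, ⟨?_, ?_⟩, fun s hs => Set.subset_sUnion_of_mem hs⟩
    · rintro p ⟨s, hs, hp⟩
      exact (hc hs).1 p hp
    · exact (Set.pairwise_sUnion hchain.directedOn).2 fun s hs => (hc hs).2
  refine ⟨S, Subtype.val, ⟨fun j => (hS.prop.1 j j.2).1, fun i j hij => hS.prop.2 i.2 j.2
    fun e => hij (Subtype.ext e), fun q hq hqS => ?_⟩, fun j => (hS.prop.1 j j.2).2⟩
  by_contra hq0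
  obtain ⟨p, hp, hp0, hpq, hPp⟩ := h q hq hq0
  have hpS : ∀ e ∈ S, p * e = 0 := fun e he => by
    rw [← hpq, mul_assoc, hqS ⟨e, he⟩, mul_zero]
  -- As a subprojection of `q`, `p` is orthogonal to all of `S`. Maximality puts it into `S`, so it
  -- is orthogonal to itself and vanishes.
  have hins : insert p S ∈ 𝒮 := by
    refine ⟨?_, ?_⟩
    · rintro e (rfl | he)
      · exact ⟨hp, hPp⟩
      · exact hS.prop.1 e he
    · refine hS.prop.2.insert fun e he _ => ⟨hpS e he, ?_⟩
      rw [mul_comm]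
      exact hpS e he
  have hmem : p ∈ S := hS.le_of_ge hins (Set.subset_insert p S) (Set.mem_insert p S)
  exact hp0 (hp.1.symm.trans (hpS p hmem))

namespace IsPartition

variable {J : Type u} {p : J → C.toStarSubalgebra}

theorem sum_mul (hp : IsPartition p) {F : Finset J} {j : J} (hj : j ∈ F) :
    (∑ i ∈ F, p i) * p j = p j := by
  rw [Finset.sum_mul, Finset.sum_eq_single j]
  · exact (hp.proj j).1
  · exact fun i _ hij => hp.orth hij
  · exact fun h => absurd hj h

theorem sum_proj (hp : IsPartition p) (F : Finset J) : IsStarProjection (∑ i ∈ F, p i) := by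
  constructor
  · rw [IsIdempotentElem, Finset.mul_sum]
    exact Finset.sum_congr rfl fun j hj => hp.sum_mul hj
  · rw [isSelfAdjoint_iff, star_sum]
    exact Finset.sum_congr rfl fun j _ => (hp.proj j).2

/-- The projections of a partition sum up to `1`. -/
theorem isLUB (hp : IsPartition p) : IsLUB (Set.range fun F : Finset J => ∑ j ∈ F, p j) 1 := by
  obtain ⟨s, hs, hs', hlim⟩ := exists_isLUB_of_monotone (monotone_sum fun j => proj_nonneg (hp.proj j))
    (b := 1) fun F => sub_nonneg.1 (show (0 : H₀ →L[ℂ] H₀) ≤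
      ((1 : C.toStarSubalgebra) : H₀ →L[ℂ] H₀) - ((∑ j ∈ F, p j : C.toStarSubalgebra) : H₀ →L[ℂ] H₀)
      from proj_nonneg (hp.sum_proj F).one_sub)
  -- Finite partial sums containing `j` fix `p j`, and this passes to the limit. Hence `s` fixes
  -- every partial sum, so `s` is a projection and `1 - s` is orthogonal to all `p j`; maximality
  -- then gives `s = 1`.
  have hsp : ∀ j, s * p j = p j := fun j => by
    refine Subtype.ext (ContinuousLinearMap.ext fun ξ => ext_inner_left ℂ fun η => ?_)
    refine tendsto_nhds_unique (hlim ((p j : H₀ →L[ℂ] H₀) ξ) η) (tendsto_const_nhds.congr' ?_)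
    filter_upwards [eventually_ge_atTop {j}] with F hF
    exact congrArg (fun T : C.toStarSubalgebra => inner ℂ η ((T : H₀ →L[ℂ] H₀) ξ))
      (hp.sum_mul (hF (Finset.mem_singleton_self j))).symm
  have hs0' : 0 ≤ s := by simpa using hs.1 ⟨∅, rfl⟩
  have hs0 : (0 : H₀ →L[ℂ] H₀) ≤ s := hs0'
  have hsa : ContinuousLinearMap.adjoint (s : H₀ →L[ℂ] H₀) = s := hs0.isSelfAdjoint
  have hss : s * s = s := by
    refine Subtype.ext (ContinuousLinearMap.ext fun ξ => ext_inner_left ℂ fun η => ?_)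
    have h1 := hlim ξ (ContinuousLinearMap.adjoint (s : H₀ →L[ℂ] H₀) η)
    rw [ContinuousLinearMap.adjoint_inner_left] at h1
    refine tendsto_nhds_unique h1 ((hlim ξ η).congr fun F => ?_)
    rw [ContinuousLinearMap.adjoint_inner_left]
    have : s * ∑ j ∈ F, p j = ∑ j ∈ F, p j := by
      rw [Finset.mul_sum]
      exact Finset.sum_congr rfl fun j _ => hsp j
    exact congrArg (fun T : C.toStarSubalgebra => inner ℂ η ((T : H₀ →L[ℂ] H₀) ξ)) this.symm
  have hsproj : IsStarProjection s := ⟨hss, Subtype.ext hsa⟩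
  have := hp.max (1 - s) hsproj.one_sub fun j => by rw [_root_.sub_mul, hsp, one_mul, sub_self]
  rw [sub_eq_zero] at this
  rwa [this]

theorem hasSum_norm_sq (hp : IsPartition p) {H : Type u} [NormedAddCommGroup H]
    [InnerProductSpace ℂ H] [CompleteSpace H] {π : C.toStarSubalgebra →⋆ₐ[ℂ] (H →L[ℂ] H)}
    (hπ : IsNormal C π) (ξ : H) : HasSum (fun j => ‖π (p j) ξ‖ ^ 2) (‖ξ‖ ^ 2) := by
  have := hπ.hasSum_diag (fun j => proj_nonneg (hp.proj j)) hp.isLUB ξ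
  simp only [rep_proj_inner π (hp.proj _), map_one] at this
  have h6 : (inner ℂ ξ ξ).re = ‖ξ‖ ^ 2 := inner_self_eq_norm_sq (𝕜 := ℂ) ξ
  rwa [one_apply_eq_self, h6] at this

/-- A central `T` is block diagonal for the partition: `p j T = p j T p j`. Thus `‖p j T ξ‖ ≤ ε ‖p j
ξ‖`, and the squares sum up by Parseval on both sides. -/
theorem norm_le (hp : IsPartition p) {K H : Type u} [NormedAddCommGroup H]
    [InnerProductSpace ℂ H] [CompleteSpace H] [NormedAddCommGroup K]
    [InnerProductSpace ℂ K] [CompleteSpace K] {π : C.toStarSubalgebra →⋆ₐ[ℂ] (H →L[ℂ] H)}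
    {σ : C.toStarSubalgebra →⋆ₐ[ℂ] (K →L[ℂ] K)}
    (hπ : IsNormal C π) (hσ : IsNormal C σ) {T : K →L[ℂ] H} (hT : ∀ c, π c ∘L T = T ∘L σ c)
    {ε : ℝ} (hε : 0 ≤ ε) (h : ∀ j, ‖π (p j) ∘L T‖ ≤ ε) : ‖T‖ ≤ ε := by
  refine T.opNorm_le_bound hε fun ξ => ?_
  refine le_of_sq_le_sq ?_ (by positivity)
  rw [mul_pow]
  refine hasSum_le (fun j => ?_) (hp.hasSum_norm_sq hπ (T ξ))
    ((hp.hasSum_norm_sq hσ ξ).mul_left (ε ^ 2))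
  rw [← mul_pow]
  gcongr
  have e : π (p j) (T ξ) = (π (p j) ∘L T) (σ (p j) ξ) := by
    have h1 : (π (p j) ∘L T) (σ (p j) ξ) = (π (p j) ∘L (T ∘L σ (p j))) ξ := rfl
    rw [h1, ← hT]
    have h2 : (π (p j) ∘L (π (p j) ∘L T)) ξ = (π (p j) * π (p j)) (T ξ) := rfl
    rw [h2, ← map_mul, (hp.proj j).1]
  rw [e]
  exact ContinuousLinearMap.le_of_opNorm_le _ (h j) _

end IsPartition

end Projections

/-! ### Hahn–Banach, weighted means, and operators from bounded forms -/

section Forms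

/-- The Hahn–Banach theorem for a complex seminorm: the hypotheses make `N` the seminorm of a
seminormed space, where a norming functional of norm at most `1` exists. -/
theorem exists_linear_le {V : Type*} [AddCommGroup V] [Module ℂ V] {N : V → ℝ} (h0 : N 0 = 0)
    (hadd : ∀ v w, N (v + w) ≤ N v + N w) (hsmul : ∀ (a : ℂ) v, N (a • v) ≤ ‖a‖ * N v) (w : V) :
    ∃ θ : V →ₗ[ℂ] ℂ, (∀ v, ‖θ v‖ ≤ N v) ∧ θ w = N w := by
  have hneg : ∀ v, N (-v) ≤ N v := fun v => by simpa using hsmul (-1) v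
  let : SeminormedAddCommGroup V := AddGroupSeminorm.toSeminormedAddCommGroup
    { toFun := N
      map_zero' := h0
      add_le' := hadd
      neg' := fun v => le_antisymm (hneg v) (by simpa using hneg (-v)) }
  let : NormedSpace ℂ V := { norm_smul_le := hsmul }
  obtain ⟨g, hg, hgw⟩ := exists_dual_vector'' ℂ w
  exact ⟨g, fun v => (g.le_of_opNorm_le hg v).trans (one_mul _).le, hgw⟩

/-- The right side is minimal at `t = β / α`. Adding `δ` to both numbers allows either of them to
vanish, and `δ` tends to `0` at the end. -/
theorem le_mul_of_forall_weighted {x α β : ℝ} (hα : 0 ≤ α) (hβ : 0 ≤ β)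
    (h : ∀ t > 0, x ≤ (t * α ^ 2 + t⁻¹ * β ^ 2) / 2) : x ≤ α * β := by
  have key : ∀ δ > 0, x ≤ α * β + δ * ((α + β) / 2) := fun δ hδ => by
    have h1 := h ((β + δ) / (α + δ)) (by positivity)
    rw [inv_div] at h1
    have h2 : (β + δ) / (α + δ) * α ^ 2 ≤ (β + δ) * α := by
      rw [div_mul_eq_mul_div, div_le_iff₀ (by positivity)]
      nlinarith [mul_nonneg (mul_nonneg (add_nonneg hβ hδ.le) hα) hδ.le]
    have h3 : (α + δ) / (β + δ) * β ^ 2 ≤ (α + δ) * β := by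
      rw [div_mul_eq_mul_div, div_le_iff₀ (by positivity)]
      nlinarith [mul_nonneg (mul_nonneg (add_nonneg hα hδ.le) hβ) hδ.le]
    linarith
  have hlim : Tendsto (fun δ : ℝ => α * β + δ * ((α + β) / 2)) (𝓝[>] 0) (𝓝 (α * β)) := by
    have : Tendsto (fun δ : ℝ => α * β + δ * ((α + β) / 2)) (𝓝 0)
        (𝓝 (α * β + 0 * ((α + β) / 2))) := (Continuous.tendsto (by fun_prop) 0)
    rw [zero_mul, add_zero] at this
    exact this.mono_left nhdsWithin_le_nhds
  exact ge_of_tendsto hlim (eventually_mem_nhdsWithin.mono fun δ hδ => key δ hδ)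

variable {H : Type*} [NormedAddCommGroup H] [InnerProductSpace ℂ H] [CompleteSpace H]

/-- The orthogonal projection onto the closure of the range of `j`. -/
noncomputable def rangeProj {M : Type*} [AddCommGroup M] [Module ℂ M] (j : M →ₗ[ℂ] H) :
    H →L[ℂ] H :=
  (LinearMap.range j).topologicalClosure.starProjection

section

variable {M : Type*} [AddCommGroup M] [Module ℂ M] (j : M →ₗ[ℂ] H)

theorem isStarProjection_rangeProj : IsStarProjection (rangeProj j) :=
  isStarProjection_starProjection

variable {j}

/-- An operator on the closure of the range of `j` is determined by its matrix coefficients. -/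
theorem eq_of_coeff_eq {T S : H →L[ℂ] H} (hT : rangeProj j * T = T) (hT' : T * rangeProj j = T)
    (hS : rangeProj j * S = S) (hS' : S * rangeProj j = S)
    (h : ∀ a b, inner ℂ (j b) (T (j a)) = inner ℂ (j b) (S (j a))) : T = S := by
  set U := (LinearMap.range j).topologicalClosure with hU
  have hP : ∀ ξ, rangeProj j ξ ∈ U := fun ξ => by
    rw [rangeProj, Submodule.starProjection_apply]
    exact Submodule.coe_mem _
  have h1 : ∀ a, T (j a) = S (j a) := fun a => by
    have hmem : T (j a) - S (j a) ∈ U := by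
      have : T (j a) - S (j a) = rangeProj j (T (j a) - S (j a)) := by
        rw [map_sub]
        exact congrArg₂ (fun A B : H →L[ℂ] H => A (j a) - B (j a)) hT.symm hS.symm
      rw [this]
      exact hP _
    have horth : ∀ ζ ∈ U, inner ℂ ζ (T (j a) - S (j a)) = 0 := by
      intro ζ hζ
      refine closure_minimal (t := {ζ | inner ℂ ζ (T (j a) - S (j a)) = 0}) ?_
        (isClosed_eq (by fun_prop) continuous_const) hζ
      rintro _ ⟨b, rfl⟩
      rw [Set.mem_ofPred_eq, inner_sub_right, h, sub_self]
    exact sub_eq_zero.1 (inner_self_eq_zero.1 (horth _ hmem))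
  have h2 : ∀ ζ ∈ U, T ζ = S ζ := fun ζ hζ => by
    refine closure_minimal (t := {ζ | T ζ = S ζ}) ?_ (isClosed_eq (by fun_prop) (by fun_prop)) hζ
    rintro _ ⟨b, rfl⟩
    exact h1 b
  rw [← hT', ← hS']
  exact ContinuousLinearMap.ext fun ξ => h2 _ (hP ξ)

/-- A sesquilinear form on `M` that is bounded in terms of `j` is given by an operator. -/
theorem exists_op_of_form {B : M → M → ℂ}
    (add_left : ∀ a a' b, B (a + a') b = B a b + B a' b)
    (smul_left : ∀ (k : ℂ) a b, B (k • a) b = k * B a b)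
    (add_right : ∀ a b b', B a (b + b') = B a b + B a b')
    (smul_right : ∀ (k : ℂ) a b, B a (k • b) = starRingEnd ℂ k * B a b)
    {m : ℝ} (hm : 0 ≤ m) (hB : ∀ a b, ‖B a b‖ ≤ m * ‖j a‖ * ‖j b‖) :
    ∃ T : H →L[ℂ] H, ‖T‖ ≤ m ∧ rangeProj j * T = T ∧ T * rangeProj j = T ∧
      ∀ a b, inner ℂ (j b) (T (j a)) = B a b := by
  let U := (LinearMap.range j).topologicalClosure
  have hU : IsClosed (U : Set H) := Submodule.isClosed_topologicalClosure _
  have : CompleteSpace U := hU.completeSpace_coe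
  let e : M →ₗ[ℂ] U := j.codRestrict U fun a =>
    Submodule.le_topologicalClosure _ (LinearMap.mem_range_self j a)
  have he : DenseRange e := by
    intro z
    rw [closure_subtype]
    have : (Subtype.val '' Set.range e) = (LinearMap.range j : Set H) := by
      ext ζ
      constructor
      · rintro ⟨_, ⟨a, rfl⟩, rfl⟩
        exact ⟨a, rfl⟩
      · rintro ⟨a, rfl⟩
        exact ⟨_, ⟨a, rfl⟩, rfl⟩
    rw [this]
    exact z.2
  have hne : ∀ a, ‖e a‖ = ‖j a‖ := fun a => rfl
  -- `B` is a form on `M`, not on the range of `j`; the bound `hB` is what makes it depend only on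
  -- `j b` and extend to the closure. The Riesz theorem then represents it by a vector.
  have key : ∀ a, ∃ v : U, (∀ b, inner ℂ (e b) v = B a b) ∧ ‖v‖ ≤ m * ‖e a‖ := fun a => by
    let f : M →ₗ[ℂ] ℂ :=
      { toFun := fun b => starRingEnd ℂ (B a b)
        map_add' := fun b b' => by rw [add_right, map_add]
        map_smul' := fun k b => by rw [smul_right]; simp }
    have hf : ∀ b, ‖f b‖ ≤ (m * ‖e a‖) * ‖e b‖ := fun b => by
      have : ‖f b‖ = ‖B a b‖ := by simp [f]
      rw [this]
      exact hB a b
    refine ⟨(InnerProductSpace.toDual ℂ U).symm (f.extendOfNorm e), fun b => ?_, ?_⟩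
    · rw [← inner_conj_symm, InnerProductSpace.toDual_symm_apply,
        LinearMap.extendOfNorm_eq he ⟨_, hf⟩]
      simp [f]
    · rw [LinearIsometryEquiv.norm_map]
      exact LinearMap.opNorm_extendOfNorm_le he (by positivity) hf
  choose v hv hvn using key
  have huniq : ∀ x y : U, (∀ b, inner ℂ (e b) x = inner ℂ (e b) y) → x = y := fun x y h =>
    he.eq_of_inner_right ℂ h
  let L : M →ₗ[ℂ] U :=
    { toFun := v
      map_add' := fun a a' => huniq _ _ fun b => by
        rw [inner_add_right, hv, hv, hv, add_left]
      map_smul' := fun k a => huniq _ _ fun b => by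
        rw [RingHom.id_apply, inner_smul_right, hv, hv, smul_left] }
  let T₀ : U →L[ℂ] U := L.extendOfNorm e
  have hT₀ : ∀ a, T₀ (e a) = v a := LinearMap.extendOfNorm_eq he ⟨m, hvn⟩
  have hT₀n : ‖T₀‖ ≤ m := LinearMap.opNorm_extendOfNorm_le he hm hvn
  have hproj : ∀ ξ, rangeProj j ξ = U.orthogonalProjectionOnto ξ := fun ξ => rfl
  -- The operator on `U` is extended by `0` on the orthogonal complement, which yields the two
  -- identities with `rangeProj j`.
  refine ⟨U.subtypeL ∘L T₀ ∘L U.orthogonalProjectionOnto, ?_, ?_, ?_, fun a b => ?_⟩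
  · refine ContinuousLinearMap.opNorm_le_bound _ hm fun ξ => ?_
    change ‖T₀ (U.orthogonalProjectionOnto ξ)‖ ≤ _
    refine (T₀.le_of_opNorm_le hT₀n _).trans ?_
    gcongr
    exact U.norm_orthogonalProjectionOnto_apply_le ξ
  · refine ContinuousLinearMap.ext fun ξ => ?_
    exact Submodule.starProjection_eq_self_iff.2 (Submodule.coe_mem _)
  · refine ContinuousLinearMap.ext fun ξ => ?_
    change ((T₀ (U.orthogonalProjectionOnto (rangeProj j ξ)) : U) : H) = T₀ (U.orthogonalProjectionOnto ξ)
    rw [hproj, Submodule.orthogonalProjectionOnto_mem_subspace_eq_self]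
  · change inner ℂ (j b) ((T₀ (U.orthogonalProjectionOnto ((e a : U) : H)) : U) : H) = _
    rw [Submodule.orthogonalProjectionOnto_mem_subspace_eq_self, hT₀, ← hv]
    rfl

end

end Forms

/-! ### Factorization of `b* a` in an abelian algebra -/

section Factor

variable {H₀ : Type u} [NormedAddCommGroup H₀] [InnerProductSpace ℂ H₀] [CompleteSpace H₀]
  {C : VonNeumannAlgebra H₀} [IsMulCommutative C.toStarSubalgebra]

theorem nonneg_add' {a b : C.toStarSubalgebra} (ha : 0 ≤ a) (hb : 0 ≤ b) : 0 ≤ a + b :=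
  add_nonneg (show (0 : H₀ →L[ℂ] H₀) ≤ a from ha) (show (0 : H₀ →L[ℂ] H₀) ≤ b from hb)

theorem nonneg_smul {a : C.toStarSubalgebra} (ha : 0 ≤ a) {t : ℝ} (ht : 0 ≤ t) :
    0 ≤ (t : ℂ) • a := by
  refine op_nonneg_iff.2 fun ξ => ?_
  have := op_nonneg_iff.1 (show (0 : H₀ →L[ℂ] H₀) ≤ a from ha) ξ
  change 0 ≤ inner ℂ ξ ((t : ℂ) • ((a : H₀ →L[ℂ] H₀) ξ))
  rw [inner_smul_right]
  exact mul_nonneg (by exact_mod_cast ht) this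

theorem one_nonneg' : (0 : C.toStarSubalgebra) ≤ 1 :=
  show (0 : H₀ →L[ℂ] H₀) ≤ 1 from zero_le_one

theorem inner_star_mul_self (a : C.toStarSubalgebra) (ξ : H₀) :
    inner ℂ ξ (((star a * a : C.toStarSubalgebra) : H₀ →L[ℂ] H₀) ξ) =
      ((‖(a : H₀ →L[ℂ] H₀) ξ‖ ^ 2 : ℝ) : ℂ) := by
  change inner ℂ ξ (ContinuousLinearMap.adjoint (a : H₀ →L[ℂ] H₀) ((a : H₀ →L[ℂ] H₀) ξ)) = _
  rw [ContinuousLinearMap.adjoint_inner_right, inner_self_eq_norm_sq_to_K]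
  simp

/-- `b* a` factors through `(t a* a + t⁻¹ b* b) / 2 + δ` with a contractive quotient. -/
theorem exists_factor (a b : C.toStarSubalgebra) {t δ : ℝ} (ht : 0 < t) (hδ : 0 < δ) :
    ∃ c u : C.toStarSubalgebra, 0 ≤ c ∧ ‖u‖ ≤ 1 ∧ star b * a = c * u ∧
      ∀ ξ, (inner ℂ ξ ((c : H₀ →L[ℂ] H₀) ξ)).re =
        (t * ‖(a : H₀ →L[ℂ] H₀) ξ‖ ^ 2 + t⁻¹ * ‖(b : H₀ →L[ℂ] H₀) ξ‖ ^ 2) / 2 + δ * ‖ξ‖ ^ 2 := by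
  have hA := star_mul_self_nonneg' a
  have hB := star_mul_self_nonneg' b
  have hAs : star (star a * a) = star a * a := by rw [star_mul, star_star]
  have hBs : star (star b * b) = star b * b := by rw [star_mul, star_star]
  let d : C.toStarSubalgebra := ((t / 2 : ℝ) : ℂ) • (star a * a) + ((t⁻¹ / 2 : ℝ) : ℂ) • (star b * b)
  have hd0 : 0 ≤ d := nonneg_add' (nonneg_smul hA (by positivity)) (nonneg_smul hB (by positivity))
  let c : C.toStarSubalgebra := d + (δ : ℂ) • 1
  have hc0 : 0 ≤ c := nonneg_add' hd0 (nonneg_smul one_nonneg' hδ.le)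
  have hcs : star c = c := by
    simp only [c, d, star_add, star_smul, hAs, hBs, star_one]
    simp
  have hcin : ∀ ξ, inner ℂ ξ ((c : H₀ →L[ℂ] H₀) ξ) =
      ((((t * ‖(a : H₀ →L[ℂ] H₀) ξ‖ ^ 2 + t⁻¹ * ‖(b : H₀ →L[ℂ] H₀) ξ‖ ^ 2) / 2 + δ * ‖ξ‖ ^ 2 : ℝ))
        : ℂ) := fun ξ => by
    have h1 : inner ℂ ξ ((c : H₀ →L[ℂ] H₀) ξ) =
        ((t / 2 : ℝ) : ℂ) * inner ℂ ξ (((star a * a : C.toStarSubalgebra) : H₀ →L[ℂ] H₀) ξ) +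
        ((t⁻¹ / 2 : ℝ) : ℂ) * inner ℂ ξ (((star b * b : C.toStarSubalgebra) : H₀ →L[ℂ] H₀) ξ) +
        (δ : ℂ) * inner ℂ ξ ξ := by
      rw [← inner_smul_right, ← inner_smul_right, ← inner_smul_right, ← inner_add_right,
        ← inner_add_right]
      rfl
    rw [h1, inner_star_mul_self, inner_star_mul_self, inner_self_eq_norm_sq_to_K]
    push_cast
    simp only [Complex.coe_algebraMap]
    ring
  have hunit : IsUnit (c : H₀ →L[ℂ] H₀) := by
    refine ContinuousLinearMap.isUnit_of_forall_le_norm_inner_map _ (c := ⟨δ, hδ.le⟩)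
      (by exact_mod_cast hδ) fun ξ => ?_
    rw [← inner_conj_symm, hcin, Complex.conj_ofReal, Complex.norm_real, Real.norm_eq_abs,
      abs_of_nonneg (by positivity)]
    have h1 : 0 ≤ (t * ‖(a : H₀ →L[ℂ] H₀) ξ‖ ^ 2 + t⁻¹ * ‖(b : H₀ →L[ℂ] H₀) ξ‖ ^ 2) / 2 := by
      positivity
    change ‖ξ‖ ^ 2 * δ ≤ _
    linarith
  obtain ⟨v, hv⟩ := hunit
  have hvmem : ((v⁻¹ : (H₀ →L[ℂ] H₀)ˣ) : H₀ →L[ℂ] H₀) ∈ C.toStarSubalgebra :=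
    mem_of_commute fun R hR => by
      have : Commute R (v : H₀ →L[ℂ] H₀) := by
        rw [hv]
        exact hR c
      exact this.units_inv_right
  let ci : C.toStarSubalgebra := ⟨_, hvmem⟩
  have hcci : c * ci = 1 := Subtype.ext (by
    change (c : H₀ →L[ℂ] H₀) * ((v⁻¹ : (H₀ →L[ℂ] H₀)ˣ) : H₀ →L[ℂ] H₀) = 1
    rw [← hv, Units.mul_inv])
  refine ⟨c, star b * a * ci, hc0, ?_, ?_, fun ξ => ?_⟩
  -- By commutativity, `d² - f² = (a*a)(b*b)` for `f = (t a*a - t⁻¹ b*b) / 2`. With `c = d + δ` the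
  -- difference equals `f² + 2δ d + δ²`, which is positive. Hence `‖b*a ζ'‖ ≤ ‖c ζ'‖`, so `b*a c⁻¹`
  -- is a contraction.
  · have hpos : 0 ≤ c * c - (star a * a) * (star b * b) := by
      let f : C.toStarSubalgebra :=
        ((t / 2 : ℝ) : ℂ) • (star a * a) - ((t⁻¹ / 2 : ℝ) : ℂ) • (star b * b)
      have hfs : star f = f := by
        simp only [f, star_sub, star_smul, hAs, hBs]
        simp
      have e : c * c - (star a * a) * (star b * b) =
          star f * f + (((2 * δ : ℝ) : ℂ) • d + ((δ ^ 2 : ℝ) : ℂ) • 1) := by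
        rw [hfs]
        have h4 : (((t / 2 : ℝ) : ℂ) * ((t⁻¹ / 2 : ℝ) : ℂ)) = 1 / 4 := by
          rw [← Complex.ofReal_mul]
          have : t / 2 * (t⁻¹ / 2) = 1 / 4 := by field_simp; norm_num
          rw [this]
          norm_num
        have h5 : (star a * a) * (star b * b) =
            (4 * (((t / 2 : ℝ) : ℂ) * ((t⁻¹ / 2 : ℝ) : ℂ))) • ((star a * a) * (star b * b)) := by
          rw [h4]
          norm_num
        rw [h5]
        simp only [c, d, f]
        generalize star a * a = A
        generalize star b * b = B
        generalize ((t / 2 : ℝ) : ℂ) = τ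
        generalize ((t⁻¹ / 2 : ℝ) : ℂ) = τ'
        push_cast
        generalize (δ : ℂ) = δ'
        simp only [Algebra.smul_def, map_mul, map_pow, map_ofNat]
        ring
      rw [e]
      exact nonneg_add' (star_mul_self_nonneg' f)
        (nonneg_add' (nonneg_smul hd0 (by positivity)) (nonneg_smul one_nonneg' (by positivity)))
    refine ContinuousLinearMap.opNorm_le_bound _ zero_le_one fun ζ => ?_
    let ζ' := (ci : H₀ →L[ℂ] H₀) ζ
    have hζ : (c : H₀ →L[ℂ] H₀) ζ' = ζ :=
      congrArg (fun T : C.toStarSubalgebra => (T : H₀ →L[ℂ] H₀) ζ) hcci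
    have h1 := (Complex.le_def.1 (op_nonneg_iff.1 (show (0 : H₀ →L[ℂ] H₀) ≤
      ((c * c - (star a * a) * (star b * b) : C.toStarSubalgebra) : H₀ →L[ℂ] H₀) from hpos) ζ')).1
    have h2 : inner ℂ ζ' (((c * c - (star a * a) * (star b * b) : C.toStarSubalgebra) :
        H₀ →L[ℂ] H₀) ζ') = ((‖(c : H₀ →L[ℂ] H₀) ζ'‖ ^ 2 : ℝ) : ℂ) -
          ((‖((star b * a : C.toStarSubalgebra) : H₀ →L[ℂ] H₀) ζ'‖ ^ 2 : ℝ) : ℂ) := by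
      have e : c * c - (star a * a) * (star b * b) =
          star c * c - star (star b * a) * (star b * a) := by
        rw [hcs, star_mul, star_star]
        ring
      rw [e, ← inner_star_mul_self, ← inner_star_mul_self, ← inner_sub_right]
      rfl
    rw [h2, ← Complex.ofReal_sub, Complex.ofReal_re, hζ, Complex.zero_re, sub_nonneg] at h1
    rw [one_mul]
    exact le_of_sq_le_sq h1 (norm_nonneg _)
  · rw [mul_left_comm, hcci, mul_one]
  · rw [hcin, Complex.ofReal_re]

end Factor

/-! ### Finite representations of algebraic tensors and the seminorms `vecNorm ξ` -/

section FiniteRepresentations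

variable {H₀ : Type u} [NormedAddCommGroup H₀] [InnerProductSpace ℂ H₀] [CompleteSpace H₀]
  (C : VonNeumannAlgebra H₀) [IsMulCommutative C.toStarSubalgebra]
  {X Y : Type u}
  [NormedAddCommGroup X] [NormedSpace ℂ X] [Module C.toStarSubalgebra X]
  [IsScalarTower ℂ C.toStarSubalgebra X]
  [NormedAddCommGroup Y] [NormedSpace ℂ Y] [Module C.toStarSubalgebra Y]
  [IsScalarTower ℂ C.toStarSubalgebra Y]

/-- The elementary tensor `x ⊗_C y` in the algebraic tensor product. -/
noncomputable def algTmul (x : X) (y : Y) : AlgTensor C X Y := x ⊗ₜ[C.toStarSubalgebra] y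

theorem nuTmul_eq_coe (x : X) (y : Y) : nuTmul C x y = (algTmul C x y : NuTensor C X Y) := rfl

theorem algTmul_add_left (x x' : X) (y : Y) :
    algTmul C (x + x') y = algTmul C x y + algTmul C x' y := TensorProduct.add_tmul x x' y

theorem algTmul_add_right (x : X) (y y' : Y) :
    algTmul C x (y + y') = algTmul C x y + algTmul C x y' := TensorProduct.tmul_add x y y'

theorem algTmul_smul_left (c : C.toStarSubalgebra) (x : X) (y : Y) :
    algTmul C (c • x) y = c • algTmul C x y := (TensorProduct.smul_tmul' c x y).symm

theorem algTmul_smul_right (c : C.toStarSubalgebra) (x : X) (y : Y) :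
    algTmul C x (c • y) = c • algTmul C x y := TensorProduct.tmul_smul c x y

theorem algTmul_complex_smul_left (a : ℂ) (x : X) (y : Y) :
    algTmul C (a • x) y = a • algTmul C x y := (TensorProduct.smul_tmul' a x y).symm

theorem algTmul_complex_smul_right (a : ℂ) (x : X) (y : Y) :
    algTmul C x (a • y) = a • algTmul C x y := by
  rw [← IsScalarTower.algebraMap_smul C.toStarSubalgebra a y, algTmul_smul_right,
    IsScalarTower.algebraMap_smul]

theorem algTensor_induction {p : AlgTensor C X Y → Prop} (zero : p 0)
    (tmul : ∀ x y, p (algTmul C x y)) (add : ∀ v w, p v → p w → p (v + w)) (v : AlgTensor C X Y) :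
    p v := TensorProduct.induction_on v zero tmul add

/-- `v = ∑ c i • (x i ⊗ y i)` is a finite sum with `x i`, `y i` in the unit balls, `c i ≥ 0`
and `∑ c i = s`. -/
def FinRep (v : AlgTensor C X Y) (s : C.toStarSubalgebra) : Prop :=
  ∃ (ι : Type u) (_ : Fintype ι) (c : ι → C.toStarSubalgebra) (x : ι → X) (y : ι → Y),
    (∀ i, 0 ≤ c i) ∧ (∀ i, ‖x i‖ ≤ 1) ∧ (∀ i, ‖y i‖ ≤ 1) ∧ s = ∑ i, c i ∧
      v = ∑ i, c i • algTmul C (x i) (y i)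

variable {C}

namespace FinRep

theorem nonneg {v : AlgTensor C X Y} {s : C.toStarSubalgebra} (h : FinRep C v s) : 0 ≤ s := by
  obtain ⟨ι, _, c, x, y, hc, -, -, rfl, -⟩ := h
  simpa using monotone_sum hc (Finset.empty_subset Finset.univ)

theorem zero : FinRep C (0 : AlgTensor C X Y) 0 :=
  ⟨PEmpty, inferInstance, PEmpty.elim, PEmpty.elim, PEmpty.elim, by simp⟩

theorem single {c : C.toStarSubalgebra} (hc : 0 ≤ c) {x : X} (hx : ‖x‖ ≤ 1) {y : Y}
    (hy : ‖y‖ ≤ 1) : FinRep C (c • algTmul C x y) c :=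
  ⟨PUnit, inferInstance, fun _ => c, fun _ => x, fun _ => y, fun _ => hc, fun _ => hx, fun _ => hy,
    by simp, by simp⟩

theorem add {v w : AlgTensor C X Y} {s t : C.toStarSubalgebra} (hv : FinRep C v s)
    (hw : FinRep C w t) : FinRep C (v + w) (s + t) := by
  obtain ⟨ι, _, c, x, y, hc, hx, hy, rfl, rfl⟩ := hv
  obtain ⟨ι', _, c', x', y', hc', hx', hy', rfl, rfl⟩ := hw
  refine ⟨ι ⊕ ι', inferInstance, Sum.elim c c', Sum.elim x x', Sum.elim y y', ?_, ?_, ?_, ?_, ?_⟩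
  · rintro (i | i)
    exacts [hc i, hc' i]
  · rintro (i | i)
    exacts [hx i, hx' i]
  · rintro (i | i)
    exacts [hy i, hy' i]
  · simp
  · simp

theorem smul {v : AlgTensor C X Y} {s : C.toStarSubalgebra} (hv : FinRep C v s) (a : ℂ) :
    FinRep C (a • v) ((‖a‖ : ℂ) • s) := by
  obtain ⟨ι, _, c, x, y, hc, hx, hy, rfl, rfl⟩ := hv
  -- The modulus of `a` scales the positive coefficients, and its phase is absorbed by the vectors
  -- `x i`.
  obtain ⟨k, hk, hak⟩ : ∃ k : ℂ, ‖k‖ ≤ 1 ∧ a = ‖a‖ * k := by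
    by_cases h : a = 0
    · exact ⟨0, by simp, by simp [h]⟩
    · have : (‖a‖ : ℂ) ≠ 0 := by simpa using h
      exact ⟨a / ‖a‖, by simp [h], by field_simp⟩
  refine ⟨ι, inferInstance, fun i => (‖a‖ : ℂ) • c i, fun i => k • x i, y,
    fun i => nonneg_smul (hc i) (norm_nonneg a), fun i => ?_, hy, ?_, ?_⟩
  · rw [norm_smul]
    exact mul_le_one₀ hk (norm_nonneg _) (hx i)
  · rw [Finset.smul_sum]
  · rw [Finset.smul_sum]
    refine Finset.sum_congr rfl fun i _ => ?_
    rw [algTmul_complex_smul_left, smul_assoc]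
    conv_lhs => rw [hak]
    rw [mul_smul, smul_comm k (c i)]

theorem proj_smul {v : AlgTensor C X Y} {s p : C.toStarSubalgebra} (hv : FinRep C v s)
    (hp : IsStarProjection p) : FinRep C (p • v) (p * s) := by
  obtain ⟨ι, _, c, x, y, hc, hx, hy, rfl, rfl⟩ := hv
  refine ⟨ι, inferInstance, fun i => p * c i, x, y, fun i => nonneg_mul_proj hp (hc i), hx, hy,
    ?_, ?_⟩
  · rw [Finset.mul_sum]
  · rw [Finset.smul_sum]
    exact Finset.sum_congr rfl fun i _ => (mul_smul _ _ _).symm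

theorem smul_tmul {c : C.toStarSubalgebra} (hc : 0 ≤ c) (x : X) (y : Y) :
    FinRep C (c • algTmul C x y) (((‖x‖ * ‖y‖ : ℝ) : ℂ) • c) := by
  have key : ∀ {E : Type u} [NormedAddCommGroup E] [NormedSpace ℂ E] (z : E),
      ∃ z' : E, ‖z'‖ ≤ 1 ∧ z = (‖z‖ : ℂ) • z' := fun z => by
    by_cases h : z = 0
    · exact ⟨0, by simp, by simp [h]⟩
    · have h' : ‖z‖ ≠ 0 := norm_ne_zero_iff.2 h
      refine ⟨(‖z‖ : ℂ)⁻¹ • z, ?_, ?_⟩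
      · rw [norm_smul]
        simp [h']
      · rw [smul_inv_smul₀]
        exact_mod_cast h'
  obtain ⟨x', hx', hxx⟩ := key x
  obtain ⟨y', hy', hyy⟩ := key y
  have := (single hc hx' hy').smul ((‖x‖ * ‖y‖ : ℝ) : ℂ)
  rw [Complex.norm_real, Real.norm_eq_abs, abs_of_nonneg (by positivity)] at this
  convert this using 1
  conv_lhs => rw [hxx, hyy]
  rw [algTmul_complex_smul_left, algTmul_complex_smul_right, smul_smul, smul_comm c]
  push_cast
  rfl

theorem exists_finRep (v : AlgTensor C X Y) : ∃ s, FinRep C v s := by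
  induction v using algTensor_induction with
  | zero => exact ⟨0, zero⟩
  | tmul x y =>
    have := smul_tmul (one_nonneg' (C := C)) x y
    rw [one_smul] at this
    exact ⟨_, this⟩
  | add v w hv hw =>
    obtain ⟨s, hs⟩ := hv
    obtain ⟨t, ht⟩ := hw
    exact ⟨_, hs.add ht⟩

end FinRep

/-- The infimum of `⟪ξ, s ξ⟫` over all finite representations of `v`. -/
noncomputable def vecNorm (ξ : H₀) (v : AlgTensor C X Y) : ℝ :=
  sInf {t | ∃ s : C.toStarSubalgebra, FinRep C v s ∧ t = (inner ℂ ξ ((s : H₀ →L[ℂ] H₀) ξ)).re}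

section VecNorm

variable (ξ : H₀)

theorem vecNorm_le {v : AlgTensor C X Y} {s : C.toStarSubalgebra} (h : FinRep C v s) :
    vecNorm ξ v ≤ (inner ℂ ξ ((s : H₀ →L[ℂ] H₀) ξ)).re := by
  refine csInf_le ⟨0, ?_⟩ ⟨s, h, rfl⟩
  rintro _ ⟨s, hs, rfl⟩
  exact re_inner_nonneg (a := (s : H₀ →L[ℂ] H₀)) hs.nonneg ξ

theorem exists_lt_of_vecNorm_lt {v : AlgTensor C X Y} {r : ℝ} (h : vecNorm ξ v < r) :
    ∃ s : C.toStarSubalgebra, FinRep C v s ∧ (inner ℂ ξ ((s : H₀ →L[ℂ] H₀) ξ)).re < r := by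
  obtain ⟨s₀, hs₀⟩ := FinRep.exists_finRep v
  have hne : {t | ∃ s : C.toStarSubalgebra, FinRep C v s ∧
      t = (inner ℂ ξ ((s : H₀ →L[ℂ] H₀) ξ)).re}.Nonempty := ⟨_, s₀, hs₀, rfl⟩
  obtain ⟨_, ⟨s, hs, rfl⟩, h⟩ := exists_lt_of_csInf_lt hne h
  exact ⟨s, hs, h⟩

theorem vecNorm_nonneg (v : AlgTensor C X Y) : 0 ≤ vecNorm ξ v := by
  refine Real.sInf_nonneg ?_
  rintro _ ⟨s, hs, rfl⟩
  exact re_inner_nonneg (a := (s : H₀ →L[ℂ] H₀)) hs.nonneg ξ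

theorem vecNorm_zero : vecNorm ξ (0 : AlgTensor C X Y) = 0 :=
  le_antisymm ((vecNorm_le ξ FinRep.zero).trans (by simp)) (vecNorm_nonneg ξ _)

theorem vecNorm_add_le (v w : AlgTensor C X Y) :
    vecNorm ξ (v + w) ≤ vecNorm ξ v + vecNorm ξ w := by
  refine le_of_forall_pos_le_add fun ε hε => ?_
  obtain ⟨s, hs, hs'⟩ := exists_lt_of_vecNorm_lt ξ (lt_add_of_pos_right (vecNorm ξ v) (half_pos hε))
  obtain ⟨t, ht, ht'⟩ := exists_lt_of_vecNorm_lt ξ (lt_add_of_pos_right (vecNorm ξ w) (half_pos hε))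
  refine (vecNorm_le ξ (hs.add ht)).trans ?_
  change (inner ℂ ξ ((s : H₀ →L[ℂ] H₀) ξ + (t : H₀ →L[ℂ] H₀) ξ)).re ≤ _
  rw [inner_add_right, Complex.add_re]
  linarith

theorem re_inner_smul (s : C.toStarSubalgebra) (r : ℝ) :
    (inner ℂ ξ ((((r : ℂ) • s : C.toStarSubalgebra) : H₀ →L[ℂ] H₀) ξ)).re =
      r * (inner ℂ ξ ((s : H₀ →L[ℂ] H₀) ξ)).re := by
  rw [← Complex.re_ofReal_mul, ← inner_smul_right]
  rfl

theorem vecNorm_smul_le (a : ℂ) (v : AlgTensor C X Y) :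
    vecNorm ξ (a • v) ≤ ‖a‖ * vecNorm ξ v := by
  refine le_of_forall_pos_le_add fun ε hε => ?_
  obtain ⟨s, hs, hs'⟩ := exists_lt_of_vecNorm_lt ξ
    (lt_add_of_pos_right (vecNorm ξ v) (show 0 < ε / (‖a‖ + 1) by positivity))
  refine (vecNorm_le ξ (hs.smul a)).trans ?_
  rw [re_inner_smul]
  have h1 : ‖a‖ * (ε / (‖a‖ + 1)) ≤ ε := by
    rw [mul_div_assoc', div_le_iff₀ (by positivity)]
    nlinarith [norm_nonneg a]
  nlinarith [norm_nonneg a]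

/-- Writing `b* a = c u` and moving the contraction `u` onto `x` represents the tensor with
coefficient sum `‖u x‖ ‖y‖ c`. Letting `δ → 0` and optimizing `t` turns the weighted mean of squares
into a product. This makes the form in `exists_bilinear_of_functional` bounded. -/
theorem vecNorm_star_mul_le (hX : IsCNRM C X) (a b : C.toStarSubalgebra) (x : X) (y : Y) :
    vecNorm ξ ((star b * a) • algTmul C x y) ≤
      (‖x‖ * ‖y‖) * ‖(a : H₀ →L[ℂ] H₀) ξ‖ * ‖(b : H₀ →L[ℂ] H₀) ξ‖ := by
  have key : ∀ t > 0, ∀ δ > 0, vecNorm ξ ((star b * a) • algTmul C x y) ≤ (‖x‖ * ‖y‖) *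
      ((t * ‖(a : H₀ →L[ℂ] H₀) ξ‖ ^ 2 + t⁻¹ * ‖(b : H₀ →L[ℂ] H₀) ξ‖ ^ 2) / 2 + δ * ‖ξ‖ ^ 2) := by
    intro t ht δ hδ
    obtain ⟨c, u, hc, hu, hcu, hin⟩ := exists_factor a b ht hδ
    rw [hcu, mul_smul, ← algTmul_smul_left]
    refine (vecNorm_le ξ (FinRep.smul_tmul hc (u • x) y)).trans ?_
    rw [re_inner_smul, hin]
    gcongr
    calc ‖u • x‖ ≤ ‖u‖ * ‖x‖ := hX.norm_smul_le u x
      _ ≤ 1 * ‖x‖ := by gcongr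
      _ = ‖x‖ := one_mul _
  have key' : ∀ t > 0, vecNorm ξ ((star b * a) • algTmul C x y) ≤ (‖x‖ * ‖y‖) *
      ((t * ‖(a : H₀ →L[ℂ] H₀) ξ‖ ^ 2 + t⁻¹ * ‖(b : H₀ →L[ℂ] H₀) ξ‖ ^ 2) / 2) := fun t ht => by
    set m := (t * ‖(a : H₀ →L[ℂ] H₀) ξ‖ ^ 2 + t⁻¹ * ‖(b : H₀ →L[ℂ] H₀) ξ‖ ^ 2) / 2
    have hlim : Tendsto (fun δ : ℝ => (‖x‖ * ‖y‖) * (m + δ * ‖ξ‖ ^ 2)) (𝓝[>] 0)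
        (𝓝 ((‖x‖ * ‖y‖) * m)) := by
      have : Tendsto (fun δ : ℝ => (‖x‖ * ‖y‖) * (m + δ * ‖ξ‖ ^ 2)) (𝓝 0)
          (𝓝 ((‖x‖ * ‖y‖) * (m + 0 * ‖ξ‖ ^ 2))) := Continuous.tendsto (by fun_prop) 0
      rw [zero_mul, add_zero] at this
      exact this.mono_left nhdsWithin_le_nhds
    exact ge_of_tendsto hlim (eventually_mem_nhdsWithin.mono fun δ hδ => key t ht δ hδ)
  rw [mul_assoc]
  have hm : 0 ≤ ‖x‖ * ‖y‖ := by positivity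
  -- The factor `‖x‖ ‖y‖ = k²` is shared equally between the two vector norms, so that the weighted
  -- mean inequality applies.
  set k := √(‖x‖ * ‖y‖)
  have hk : k ^ 2 = ‖x‖ * ‖y‖ := Real.sq_sqrt hm
  have hk0 : 0 ≤ k := Real.sqrt_nonneg _
  have := le_mul_of_forall_weighted (x := vecNorm ξ ((star b * a) • algTmul C x y))
    (mul_nonneg hk0 (norm_nonneg ((a : H₀ →L[ℂ] H₀) ξ)))
    (mul_nonneg hk0 (norm_nonneg ((b : H₀ →L[ℂ] H₀) ξ))) fun t ht => (key' t ht).trans (by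
      rw [mul_pow, mul_pow, hk]
      apply le_of_eq
      ring)
  calc _ ≤ _ := this
    _ = k ^ 2 * (‖(a : H₀ →L[ℂ] H₀) ξ‖ * ‖(b : H₀ →L[ℂ] H₀) ξ‖) := by ring
    _ = _ := by rw [hk]

end VecNorm

end FiniteRepresentations

/-! ### Duality: functionals below `vecNorm ξ` come from maps into the commutant -/

section Commutant

variable {H₀ : Type u} [NormedAddCommGroup H₀] [InnerProductSpace ℂ H₀] [CompleteSpace H₀]
  (C : VonNeumannAlgebra H₀) [IsMulCommutative C.toStarSubalgebra]

/-- The inclusion of an abelian von Neumann algebra into its commutant. -/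
noncomputable def toCommutant : C.toStarSubalgebra →+* C.commutant.toStarSubalgebra where
  toFun c := ⟨c, VonNeumannAlgebra.mem_commutant_iff.2 fun g hg =>
    congrArg Subtype.val (mul_comm (⟨g, hg⟩ : C.toStarSubalgebra) c)⟩
  map_one' := rfl
  map_mul' _ _ := rfl
  map_zero' := rfl
  map_add' _ _ := rfl

/-- The commutant of `C` as a `C`-module. -/
@[reducible] noncomputable def commutantModule :
    Module C.toStarSubalgebra C.commutant.toStarSubalgebra :=
  Module.compHom _ (toCommutant C)

/-- The inclusion of the commutant into `B(H₀)` is itself a normal embedding, so bilinear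
contractions into it are admissible in the definition of `ν`. -/
theorem isCNRM_commutant :
    @IsCNRM H₀ _ _ _ C C.commutant.toStarSubalgebra _ _ (commutantModule C) := by
  let _ := commutantModule C
  refine ⟨(isClosed_carrier C.commutant).completeSpace_coe, H₀, H₀, _, _, _, _, _, _, ⟨{
    left := C.toStarSubalgebra.subtype
    right := C.toStarSubalgebra.subtype
    left_normal := isNormal_subtype C
    right_normal := isNormal_subtype C
    emb :=
      { toFun := fun z => z
        map_add' := fun _ _ => rfl
        map_smul' := fun _ _ => rfl
        norm_map' := fun _ => rfl }
    emb_left := fun _ _ => rfl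
    emb_right := fun c z => VonNeumannAlgebra.mem_commutant_iff.1 z.2 c c.2 }⟩⟩

variable {C}

/-- The orbit map `a ↦ a ξ`. -/
noncomputable def orbitMap (C : VonNeumannAlgebra H₀) (ξ : H₀) : C.toStarSubalgebra →ₗ[ℂ] H₀ where
  toFun a := (a : H₀ →L[ℂ] H₀) ξ
  map_add' _ _ := rfl
  map_smul' _ _ := rfl

theorem orbitMap_apply (ξ : H₀) (a : C.toStarSubalgebra) :
    orbitMap C ξ a = (a : H₀ →L[ℂ] H₀) ξ := rfl

/-- The orbit `C ξ` is invariant under `C`, so the projection onto its closure lies in the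
commutant. -/
theorem rangeProj_commute (ξ : H₀) (c : C.toStarSubalgebra) :
    rangeProj (orbitMap C ξ) * (c : H₀ →L[ℂ] H₀) = c * rangeProj (orbitMap C ξ) := by
  set j := orbitMap C ξ
  have hmem : rangeProj j ∈ C.commutant := by
    refine (VonNeumannAlgebra.IsStarProjection.mem_iff (isStarProjection_rangeProj j) _).2
      fun y hy => ?_
    rw [VonNeumannAlgebra.commutant_commutant] at hy
    rw [rangeProj, Submodule.range_starProjection, Module.End.mem_invtSubmodule]
    intro ζ hζ
    have : Set.MapsTo y (LinearMap.range j) (LinearMap.range j) := by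
      rintro _ ⟨a, rfl⟩
      exact ⟨⟨y, hy⟩ * a, rfl⟩
    exact this.closure y.continuous hζ
  exact (VonNeumannAlgebra.mem_commutant_iff.1 hmem c c.2).symm

variable {X Y : Type u}
  [NormedAddCommGroup X] [NormedSpace ℂ X] [Module C.toStarSubalgebra X]
  [IsScalarTower ℂ C.toStarSubalgebra X]
  [NormedAddCommGroup Y] [NormedSpace ℂ Y] [Module C.toStarSubalgebra Y]
  [IsScalarTower ℂ C.toStarSubalgebra Y]

set_option maxHeartbeats 1000000 in
/-- A functional on `X ⊗_C Y` that is dominated by `vecNorm ξ` is a vector functional of a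
`C`-bilinear map into the commutant of `C`. -/
theorem exists_bilinear_of_functional (hX : IsCNRM C X) (ξ : H₀) {θ : AlgTensor C X Y →ₗ[ℂ] ℂ}
    (hθ : ∀ v, ‖θ v‖ ≤ vecNorm ξ v) :
    ∃ T : X → Y → H₀ →L[ℂ] H₀, (∀ x y, ‖T x y‖ ≤ ‖x‖ * ‖y‖) ∧
      (∀ x y, inner ℂ ξ (T x y ξ) = θ (algTmul C x y)) ∧
      (∀ (c : C.toStarSubalgebra) x y, (c : H₀ →L[ℂ] H₀) * T x y = T x y * (c : H₀ →L[ℂ] H₀)) ∧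
      (∀ x x' y, T (x + x') y = T x y + T x' y) ∧ (∀ x y y', T x (y + y') = T x y + T x y') ∧
      (∀ (c : C.toStarSubalgebra) x y, T (c • x) y = (c : H₀ →L[ℂ] H₀) * T x y) ∧
      ∀ (c : C.toStarSubalgebra) x y, T x (c • y) = (c : H₀ →L[ℂ] H₀) * T x y := by
  obtain ⟨j, hj⟩ : ∃ j, j = orbitMap C ξ := ⟨_, rfl⟩
  have hja : ∀ a, j a = (a : H₀ →L[ℂ] H₀) ξ := fun a => by rw [hj, orbitMap_apply]
  have hPc : ∀ c : C.toStarSubalgebra, rangeProj j * (c : H₀ →L[ℂ] H₀) = c * rangeProj j := by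
    rw [hj]
    exact rangeProj_commute ξ
  have hex : ∀ (x : X) (y : Y), ∃ T : H₀ →L[ℂ] H₀, ‖T‖ ≤ ‖x‖ * ‖y‖ ∧ rangeProj j * T = T ∧
      T * rangeProj j = T ∧ ∀ a b, inner ℂ (j b) (T (j a)) = θ ((star b * a) • algTmul C x y) :=
    fun x y => exists_op_of_form (B := fun a b => θ ((star b * a) • algTmul C x y))
      (fun a a' b => by rw [mul_add, add_smul, map_add])
      (fun k a b => by rw [mul_smul_comm, smul_assoc, map_smul, smul_eq_mul])
      (fun a b b' => by rw [star_add, add_mul, add_smul, map_add])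
      (fun k a b => by rw [star_smul, smul_mul_assoc, smul_assoc, map_smul]; rfl)
      (by positivity) fun a b => by
        rw [hja, hja]
        exact (hθ _).trans (vecNorm_star_mul_le ξ hX a b x y)
  choose T hTn hPT hTP hT using hex
  -- Each `T x y` is determined by its coefficients on the orbit `C ξ`, so additivity and
  -- `C`-linearity reduce to identities for `θ`.
  have huniq : ∀ x y (S : H₀ →L[ℂ] H₀), rangeProj j * S = S → S * rangeProj j = S →
      (∀ a b, inner ℂ (j b) (S (j a)) = θ ((star b * a) • algTmul C x y)) → T x y = S :=
    fun x y S h1 h2 h3 => eq_of_coeff_eq (hPT x y) (hTP x y) h1 h2 fun a b => by rw [hT, h3]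
  have hjs : ∀ (c a b : C.toStarSubalgebra) (S : H₀ →L[ℂ] H₀),
      inner ℂ (j b) (((c : H₀ →L[ℂ] H₀) * S) (j a)) = inner ℂ (j (star c * b)) (S (j a)) :=
    fun c a b S => by
      rw [hja b, hja (star c * b)]
      exact (ContinuousLinearMap.adjoint_inner_left (c : H₀ →L[ℂ] H₀) _ _).symm
  have hPcT : ∀ (c : C.toStarSubalgebra) x y, rangeProj j * ((c : H₀ →L[ℂ] H₀) * T x y) =
      (c : H₀ →L[ℂ] H₀) * T x y := fun c x y => by
    rw [← mul_assoc, hPc, mul_assoc, hPT]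
  have hcTP : ∀ (c : C.toStarSubalgebra) x y, ((c : H₀ →L[ℂ] H₀) * T x y) * rangeProj j =
      (c : H₀ →L[ℂ] H₀) * T x y := fun c x y => by
    rw [mul_assoc, hTP]
  have hcoef : ∀ (c : C.toStarSubalgebra) x y a b,
      inner ℂ (j b) (((c : H₀ →L[ℂ] H₀) * T x y) (j a)) =
        θ ((star b * a) • c • algTmul C x y) := fun c x y a b => by
    have e : star (star c * b) * a = star b * a * c := by
      rw [star_mul, star_star, mul_right_comm]
    rw [hjs, hT, e, mul_smul]
  have hcomm : ∀ (c : C.toStarSubalgebra) x y,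
      (c : H₀ →L[ℂ] H₀) * T x y = T x y * (c : H₀ →L[ℂ] H₀) := fun c x y =>
    eq_of_coeff_eq (j := j) (hPcT c x y) (hcTP c x y) (by rw [← mul_assoc, hPT])
      (by rw [mul_assoc, ← hPc, ← mul_assoc, hTP]) fun a b => by
        have h1 : (T x y * (c : H₀ →L[ℂ] H₀)) (j a) = T x y (j (c * a)) := by
          rw [hja, hja]
          rfl
        have e : star b * (c * a) = star b * a * c := by rw [mul_assoc, mul_comm c a]
        rw [hcoef, h1, hT, e, smul_smul]
  refine ⟨T, hTn, fun x y => ?_, hcomm, fun x x' y => ?_, fun x y y' => ?_, fun c x y => ?_,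
    fun c x y => ?_⟩
  -- Taking `a = b = 1` recovers `θ` as the vector functional at `ξ`.
  · have h1 := hT x y 1 1
    rw [star_one, one_mul, one_smul, hja] at h1
    exact h1
  · exact huniq _ _ (T x y + T x' y) (by rw [mul_add, hPT, hPT]) (by rw [add_mul, hTP, hTP])
      fun a b => by
        rw [add_apply, inner_add_right, hT, hT, algTmul_add_left, smul_add, map_add]
  · exact huniq _ _ (T x y + T x y') (by rw [mul_add, hPT, hPT]) (by rw [add_mul, hTP, hTP])
      fun a b => by
        rw [add_apply, inner_add_right, hT, hT, algTmul_add_right, smul_add, map_add]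
  · exact huniq _ _ _ (hPcT c x y) (hcTP c x y) fun a b => by rw [hcoef, algTmul_smul_left]
  · exact huniq _ _ _ (hPcT c x y) (hcTP c x y) fun a b => by rw [hcoef, algTmul_smul_right]

/-- A Hahn–Banach functional `θ` norming `w` for `vecNorm ξ` has the form `⟨ξ, φ(·) ξ⟩` with `φ` a
bilinear contraction into the commutant. Hence `vecNorm ξ w = |⟨ξ, φ(w) ξ⟩| ≤ ‖φ(w)‖ ‖ξ‖²`, and `ν`
dominates `‖φ(w)‖`. -/
theorem vecNorm_le_nu (hX : IsCNRM C X) (ξ : H₀) (w : AlgTensor C X Y) :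
    vecNorm ξ w ≤ nu C w * ‖ξ‖ ^ 2 := by
  obtain ⟨θ, hθ, hθw⟩ := exists_linear_le (vecNorm_zero ξ) (vecNorm_add_le ξ)
    (vecNorm_smul_le ξ) w
  obtain ⟨T, hTn, hT, hcomm, hadd, hadd', hsmul, hsmul'⟩ := exists_bilinear_of_functional hX ξ hθ
  let _ := commutantModule C
  let φ : X →ₗ[C.toStarSubalgebra] Y →ₗ[C.toStarSubalgebra] C.commutant.toStarSubalgebra :=
    LinearMap.mk₂ C.toStarSubalgebra
      (fun x y => ⟨T x y, VonNeumannAlgebra.mem_commutant_iff.2 fun g hg => hcomm ⟨g, hg⟩ x y⟩)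
      (fun x x' y => Subtype.ext (hadd x x' y)) (fun c x y => Subtype.ext (hsmul c x y))
      (fun x y y' => Subtype.ext (hadd' x y y')) (fun c x y => Subtype.ext (hsmul' c x y))
  have hφ : ∀ v : AlgTensor C X Y,
      inner ℂ ξ (((TensorProduct.lift φ v : C.commutant.toStarSubalgebra) : H₀ →L[ℂ] H₀) ξ) =
        θ v := fun v => by
    induction v using algTensor_induction with
    | zero =>
      have : TensorProduct.lift φ (0 : AlgTensor C X Y) = 0 := map_zero (TensorProduct.lift φ)
      rw [this, map_zero]
      exact inner_zero_right ξ
    | tmul x y =>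
      rw [← hT]
      have h2 : TensorProduct.lift φ (algTmul C x y) = φ x y := TensorProduct.lift.tmul x y
      rw [h2]
      rfl
    | add v w hv hw =>
      have : TensorProduct.lift φ (v + w) = TensorProduct.lift φ v + TensorProduct.lift φ w :=
        map_add (TensorProduct.lift φ) v w
      rw [this, map_add, ← hv, ← hw, ← inner_add_right]
      rfl
  have hle : ‖TensorProduct.lift φ w‖ ≤ nu C w :=
    le_csSup (nuSet_bddAbove C w) ⟨C.commutant.toStarSubalgebra, inferInstance, inferInstance,
      commutantModule C, φ, isCNRM_commutant C, fun x y => hTn x y, rfl⟩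
  have h1 : vecNorm ξ w = ‖θ w‖ := by
    rw [hθw, Complex.norm_real, Real.norm_eq_abs, abs_of_nonneg (vecNorm_nonneg ξ w)]
  rw [h1, ← hφ]
  set S := ((TensorProduct.lift φ w : C.commutant.toStarSubalgebra) : H₀ →L[ℂ] H₀)
  calc ‖inner ℂ ξ (S ξ)‖ ≤ ‖ξ‖ * ‖S ξ‖ := norm_inner_le_norm _ _
    _ ≤ ‖ξ‖ * (‖S‖ * ‖ξ‖) := by gcongr; exact S.le_opNorm ξ
    _ = ‖S‖ * ‖ξ‖ ^ 2 := by ring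
    _ ≤ nu C w * ‖ξ‖ ^ 2 := by
      gcongr
      exact hle

/-- On a nonzero subprojection of any nonzero projection, `v` has a finite representation of
norm at most `r > ν(v)`. -/
theorem exists_finRep_local (hX : IsCNRM C X) {v : AlgTensor C X Y} {r : ℝ} (hr : nu C v < r)
    {q : C.toStarSubalgebra} (hq : IsStarProjection q) (hq0 : q ≠ 0) :
    ∃ p s : C.toStarSubalgebra, IsStarProjection p ∧ p ≠ 0 ∧ p * q = p ∧ FinRep C v s ∧
      p * s ≤ (r : ℂ) • p := by
  obtain ⟨ζ, hζ⟩ : ∃ ζ, (q : H₀ →L[ℂ] H₀) ζ ≠ 0 := by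
    by_contra! h
    exact hq0 (Subtype.ext (ContinuousLinearMap.ext h))
  let ξ := (q : H₀ →L[ℂ] H₀) ζ
  have hξ : (q : H₀ →L[ℂ] H₀) ξ = ξ :=
    congrArg (fun T : C.toStarSubalgebra => (T : H₀ →L[ℂ] H₀) ζ) hq.1
  have hξ0 : 0 < ‖ξ‖ := norm_pos_iff.2 hζ
  have h1 : vecNorm ξ v < r * ‖ξ‖ ^ 2 :=
    (vecNorm_le_nu hX ξ v).trans_lt (by gcongr)
  obtain ⟨s, hs, hs'⟩ := exists_lt_of_vecNorm_lt ξ h1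
  have hss : star s = s := Subtype.ext
    (IsSelfAdjoint.of_nonneg (show (0 : H₀ →L[ℂ] H₀) ≤ s from hs.nonneg))
  obtain ⟨p, hp, hp0, hpq, hps⟩ := exists_projection_le hss hq hξ hs'
  exact ⟨p, s, hp, hp0, hpq, hs, hps⟩

end Commutant

/-! ### Strong bimodules and the local hull -/

section StrongHull

variable {H₀ : Type u} [NormedAddCommGroup H₀] [InnerProductSpace ℂ H₀] [CompleteSpace H₀]
  {C : VonNeumannAlgebra H₀}
  {K H : Type u}
  [NormedAddCommGroup K] [InnerProductSpace ℂ K] [CompleteSpace K]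
  [NormedAddCommGroup H] [InnerProductSpace ℂ H] [CompleteSpace H]
  {π : C.toStarSubalgebra →⋆ₐ[ℂ] (H →L[ℂ] H)} {σ : C.toStarSubalgebra →⋆ₐ[ℂ] (K →L[ℂ] K)}

theorem IsStrong.sInf {𝒲 : Set (Submodule ℂ (K →L[ℂ] H))} (hne : 𝒲.Nonempty)
    (h : ∀ W ∈ 𝒲, IsStrong π σ W) : IsStrong π σ (sInf 𝒲) where
  isClosed := by
    rw [Submodule.coe_sInf]
    exact isClosed_biInter fun W hW => (h W hW).isClosed
  smul_mem c T hT := by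
    rw [Submodule.mem_sInf] at hT ⊢
    exact fun W hW => (h W hW).smul_mem c T (hT W hW)
  central c T hT := by
    obtain ⟨W, hW⟩ := hne
    exact (h W hW).central c T (Submodule.mem_sInf.1 hT W hW)
  sum_mem J p z hp horth hz hM T hT := by
    rw [Submodule.mem_sInf]
    exact fun W hW => (h W hW).sum_mem J p z hp horth
      (fun j => Submodule.mem_sInf.1 (hz j) W hW) hM T hT

theorem norm_rep_proj_le (π : C.toStarSubalgebra →⋆ₐ[ℂ] (H →L[ℂ] H)) {p : C.toStarSubalgebra}
    (hp : IsStarProjection p) : ‖π p‖ ≤ 1 := (hp.map π).norm_le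

theorem norm_rep_proj_comp_le (π : C.toStarSubalgebra →⋆ₐ[ℂ] (H →L[ℂ] H)) {p q : C.toStarSubalgebra}
    (hp : IsStarProjection p) (hpq : p * q = p) (T : K →L[ℂ] H) :
    ‖π p ∘L T‖ ≤ ‖π q ∘L T‖ := by
  have : π p ∘L T = π p ∘L (π q ∘L T) := by
    rw [← ContinuousLinearMap.comp_assoc]
    change π p ∘L T = (π p * π q) ∘L T
    rw [← map_mul, hpq]
  rw [this]
  refine (ContinuousLinearMap.opNorm_comp_le _ _).trans ?_
  exact mul_le_of_le_one_left (norm_nonneg _) (norm_rep_proj_le π hp)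

theorem norm_rep_proj_comp_le_self (π : C.toStarSubalgebra →⋆ₐ[ℂ] (H →L[ℂ] H))
    {p : C.toStarSubalgebra} (hp : IsStarProjection p) (T : K →L[ℂ] H) : ‖π p ∘L T‖ ≤ ‖T‖ :=
  (ContinuousLinearMap.opNorm_comp_le _ _).trans
    (mul_le_of_le_one_left (norm_nonneg _) (norm_rep_proj_le π hp))

/-- Multiplying an orthogonal sum by one of its projections gives the corresponding term. -/
theorem rep_comp_of_hasWeakStarSum {J : Type u} {p : J → C.toStarSubalgebra} {z : J → K →L[ℂ] H}
    (hp : ∀ j, IsStarProjection (p j)) (horth : Pairwise fun i j => p i * p j = 0)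
    {T : K →L[ℂ] H} (hT : HasWeakStarSum (fun j => π (p j) ∘L z j) T) (j : J) :
    π (p j) ∘L T = π (p j) ∘L z j := by
  refine ContinuousLinearMap.ext fun ξ => ext_inner_left ℂ fun η => ?_
  refine (hT.comp_left (π (p j)) ξ η).unique ?_
  have key : ∀ i, (π (p j) ∘L (π (p i) ∘L z i)) ξ = π (p j * p i) (z i ξ) := fun i => by
    rw [map_mul]
    rfl
  simp only [key]
  convert hasSum_single j fun i hij => ?_ using 1
  · rw [(hp j).1]
    rfl
  · rw [horth hij.symm, map_zero]
    exact inner_zero_right η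

theorem rep_comp_eq_zero_of_hasWeakStarSum {J : Type u} {p : J → C.toStarSubalgebra}
    {z : J → K →L[ℂ] H} {q : C.toStarSubalgebra} (hq : ∀ j, q * p j = 0)
    {T : K →L[ℂ] H} (hT : HasWeakStarSum (fun j => π (p j) ∘L z j) T) : π q ∘L T = 0 := by
  refine ContinuousLinearMap.ext fun ξ => ext_inner_left ℂ fun η => ?_
  refine (hT.comp_left (π q) ξ η).unique ?_
  have key : ∀ i, (π q ∘L (π (p i) ∘L z i)) ξ = π (q * p i) (z i ξ) := fun i => by
    rw [map_mul]
    rfl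
  simp only [key, hq, map_zero, zero_apply, inner_zero_right]
  exact hasSum_zero

variable [IsMulCommutative C.toStarSubalgebra]
  {Z : Type u} [NormedAddCommGroup Z] [NormedSpace ℂ Z] [Module C.toStarSubalgebra Z]

theorem rep_comm (π : C.toStarSubalgebra →⋆ₐ[ℂ] (H →L[ℂ] H)) (c d : C.toStarSubalgebra)
    (T : K →L[ℂ] H) : π c ∘L (π d ∘L T) = π d ∘L (π c ∘L T) := by
  change (π c * π d) ∘L T = (π d * π c) ∘L T
  rw [← map_mul, ← map_mul, mul_comm]

/-- The central operators that on some nonzero subprojection of each nonzero projection can be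
approximated by elements of the embedded set `D`. -/
def localHull (E : NormalEmbedding C Z K H) (D : Submodule ℂ Z) :
    Submodule ℂ (K →L[ℂ] H) where
  carrier := {w | (∀ c, E.left c ∘L w = w ∘L E.right c) ∧
    ∀ ε > 0, ∀ q : C.toStarSubalgebra, IsStarProjection q → q ≠ 0 →
      ∃ p : C.toStarSubalgebra, IsStarProjection p ∧ p ≠ 0 ∧ p * q = p ∧
        ∃ z ∈ D, ‖E.left p ∘L (w - E.emb z)‖ ≤ ε}
  zero_mem' := ⟨fun c => by simp, fun ε hε q hq hq0 =>
    ⟨q, hq, hq0, hq.1, 0, D.zero_mem, by simpa using hε.le⟩⟩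
  add_mem' := by
    rintro w w' ⟨hw, h⟩ ⟨hw', h'⟩
    refine ⟨fun c => by rw [ContinuousLinearMap.comp_add, ContinuousLinearMap.add_comp, hw, hw'],
      fun ε hε q hq hq0 => ?_⟩
    obtain ⟨p, hp, hp0, hpq, z, hz, hpz⟩ := h (ε / 2) (half_pos hε) q hq hq0
    -- The second approximation is sought below `p`, so that the first one remains valid on `p'`.
    obtain ⟨p', hp', hp0', hpp, z', hz', hpz'⟩ := h' (ε / 2) (half_pos hε) p hp hp0
    refine ⟨p', hp', hp0', by rw [← hpp, mul_assoc, hpq], z + z', D.add_mem hz hz', ?_⟩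
    have e : E.left p' ∘L (w + w' - E.emb (z + z')) =
        E.left p' ∘L (w - E.emb z) + E.left p' ∘L (w' - E.emb z') := by
      rw [← ContinuousLinearMap.comp_add, map_add]
      congr 1
      abel
    rw [e]
    calc _ ≤ _ := norm_add_le _ _
      _ ≤ ε / 2 + ε / 2 := add_le_add ((norm_rep_proj_comp_le _ hp' hpp _).trans hpz) hpz'
      _ = ε := add_halves ε
  smul_mem' := by
    rintro k w ⟨hw, h⟩
    refine ⟨fun c => by rw [ContinuousLinearMap.comp_smul, ContinuousLinearMap.smul_comp, hw],
      fun ε hε q hq hq0 => ?_⟩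
    obtain ⟨p, hp, hp0, hpq, z, hz, hpz⟩ := h (ε / (‖k‖ + 1)) (by positivity) q hq hq0
    refine ⟨p, hp, hp0, hpq, k • z, D.smul_mem k hz, ?_⟩
    rw [map_smul, ← smul_sub, ContinuousLinearMap.comp_smul, norm_smul]
    calc ‖k‖ * _ ≤ (‖k‖ + 1) * (ε / (‖k‖ + 1)) := by gcongr; linarith
      _ = ε := by field_simp

variable {E : NormalEmbedding C Z K H} {D : Submodule ℂ Z}

theorem emb_mem_localHull (hdense : Dense (D : Set Z)) (z : Z) :
    E.emb z ∈ localHull E D := by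
  refine ⟨fun c => by rw [← E.emb_left, E.emb_right], fun ε hε q hq hq0 => ?_⟩
  obtain ⟨z', hz', hzz⟩ := Metric.dense_iff.1 hdense z ε hε
  refine ⟨q, hq, hq0, hq.1, z', hzz, (norm_rep_proj_comp_le_self _ hq _).trans ?_⟩
  rw [← map_sub, E.emb.norm_map, ← dist_eq_norm, dist_comm]
  exact (Metric.mem_ball.1 hz').le

/-- Local approximability survives orthogonal gluing, since the glued operator agrees with one of
its pieces on a small projection. `D = ⊤` serves to show that a strong bimodule exists; `D =
algRange C X Y` serves to represent elements. -/
theorem isStrong_localHull (hD : ∀ (c : C.toStarSubalgebra), ∀ z ∈ D, c • z ∈ D) :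
    IsStrong E.left E.right (localHull E D) where
  isClosed := by
    refine isClosed_of_closure_subset fun w hw => ⟨fun c => ?_, fun ε hε q hq hq0 => ?_⟩
    · exact closure_minimal (t := {w | E.left c ∘L w = w ∘L E.right c}) (fun w hw => hw.1 c)
        (isClosed_eq (by fun_prop) (by fun_prop)) hw
    · obtain ⟨w', hw', hd⟩ := Metric.mem_closure_iff.1 hw (ε / 2) (half_pos hε)
      obtain ⟨p, hp, hp0, hpq, z, hz, hpz⟩ := hw'.2 (ε / 2) (half_pos hε) q hq hq0
      refine ⟨p, hp, hp0, hpq, z, hz, ?_⟩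
      have e : E.left p ∘L (w - E.emb z) = E.left p ∘L (w - w') + E.left p ∘L (w' - E.emb z) := by
        rw [← ContinuousLinearMap.comp_add, sub_add_sub_cancel]
      rw [e]
      rw [dist_eq_norm] at hd
      calc _ ≤ _ := norm_add_le _ _
        _ ≤ ε / 2 + ε / 2 := add_le_add ((norm_rep_proj_comp_le_self _ hp _).trans hd.le) hpz
        _ = ε := add_halves ε
  smul_mem c w hw := by
    refine ⟨fun d => ?_, fun ε hε q hq hq0 => ?_⟩
    · rw [rep_comm, hw.1 d, ContinuousLinearMap.comp_assoc]
    · obtain ⟨p, hp, hp0, hpq, z, hz, hpz⟩ := hw.2 (ε / (‖c‖ + 1)) (by positivity) q hq hq0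
      refine ⟨p, hp, hp0, hpq, c • z, hD c z hz, ?_⟩
      rw [E.emb_left, ← ContinuousLinearMap.comp_sub, rep_comm]
      calc _ ≤ ‖E.left c‖ * _ := ContinuousLinearMap.opNorm_comp_le _ _
        _ ≤ (‖c‖ + 1) * (ε / (‖c‖ + 1)) := by
          gcongr
          exact (norm_rep_le _ c).trans (by linarith)
        _ = ε := by field_simp
  central c w hw := hw.1 c
  sum_mem J p z hp horth hz hM T hT := by
    refine ⟨fun c => ?_, fun ε hε q hq hq0 => ?_⟩
    · refine ContinuousLinearMap.ext fun ξ => ext_inner_left ℂ fun η => ?_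
      refine (hT.comp_left (E.left c) ξ η).unique ?_
      have := hT.weak (E.right c ξ) η
      refine this.congr_fun ?_
      intro j
      rw [rep_comm, (hz j).1 c]
      rfl
    -- If `q` meets some `p j`, an approximation of `z j` below `q * p j` also approximates `T`. If
    -- `q` meets none, then `q T = 0` and `0` approximates it.
    · by_cases h : ∃ j, q * p j ≠ 0
      · obtain ⟨j, hj⟩ := h
        obtain ⟨e, he, he0, heq, v, hv, hev⟩ :=
          (hz j).2 ε hε (q * p j) (proj_mul hq (hp j)) hj
        have hep : e * p j = e := by
          rw [← heq, mul_assoc, mul_assoc, (hp j).1]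
        have heq' : e * q = e := by
          rw [← heq, mul_comm q, mul_assoc, mul_assoc, hq.1]
        refine ⟨e, he, he0, heq', v, hv, ?_⟩
        have key : E.left e ∘L T = E.left e ∘L z j := by
          have h1 : E.left e = E.left e * E.left (p j) := by rw [← map_mul, hep]
          rw [h1]
          exact congrArg (fun S => E.left e ∘L S) (rep_comp_of_hasWeakStarSum hp horth hT j)
        rwa [ContinuousLinearMap.comp_sub, key, ← ContinuousLinearMap.comp_sub]
      · push Not at h
        refine ⟨q, hq, hq0, hq.1, 0, D.zero_mem, ?_⟩
        rw [map_zero, sub_zero, rep_comp_eq_zero_of_hasWeakStarSum h hT, norm_zero]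
        exact hε.le

/-- Strongness passes to intersections of nonempty families. Since it includes centrality, the whole
`B(K, H)` need not be strong, and the local hull supplies a member of the family. -/
theorem isLeast_strongHull {Z : Type u} [NormedAddCommGroup Z] [NormedSpace ℂ Z]
    [Module C.toStarSubalgebra Z] (E : NormalEmbedding C Z K H) :
    IsLeast {W | IsStrong E.left E.right W ∧ ∀ z, E.emb z ∈ W} E.strongHull := by
  have hne : {W | IsStrong E.left E.right W ∧ ∀ z, E.emb z ∈ W}.Nonempty :=
    ⟨localHull E ⊤, isStrong_localHull fun _ _ _ => trivial, emb_mem_localHull (by simp)⟩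
  exact ⟨⟨IsStrong.sInf hne fun W hW => hW.1, fun z => Submodule.mem_sInf.2 fun W hW => hW.2 z⟩,
    fun W hW => sInf_le hW⟩

end StrongHull

/-! ### Successive approximation and regrouping of sums -/

section Series

variable {V S : Type*} [NormedAddCommGroup V] [CompleteSpace V] [NormedAddCommGroup S]
  [CompleteSpace S]

/-- If the elements of `W` can be approximated by elements `v ∈ W` that are related to elements of
`S` of almost the same norm, then they are sums of such elements. -/
theorem exists_series_of_approx {W : AddSubgroup V} {R : V → S → Prop}
    (hR : ∀ v s, R v s → ‖v‖ ≤ ‖s‖)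
    (step : ∀ δ > 0, ∀ u ∈ W, ∃ v ∈ W, ∃ s, R v s ∧ ‖s‖ ≤ ‖u‖ + δ ∧ ‖u - v‖ ≤ δ)
    {w : V} (hw : w ∈ W) {ε : ℝ} (hε : 0 < ε) :
    ∃ (v : ℕ → V) (s : ℕ → S) (s₀ : S), (∀ n, R (v n) (s n)) ∧ HasSum v w ∧ HasSum s s₀ ∧
      ‖s₀‖ ≤ ‖w‖ + ε := by
  -- The errors add up to `ε / 2`. They are paid twice, once in the norms of the remainders and once
  -- in the excess of the `s n`, for a total of `ε`.
  let e : ℕ → ℝ := fun n => ε / 4 * (1 / 2) ^ n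
  have he0 : ∀ n, 0 < e n := fun n => by positivity
  have he : HasSum e (ε / 2) := by
    have := hasSum_geometric_two.mul_left (ε / 4)
    rwa [show ε / 4 * 2 = ε / 2 by ring] at this
  have step : ∀ (n : ℕ) (u : W), ∃ (v : W) (s : S), R v s ∧ ‖s‖ ≤ ‖(u : V)‖ + e n ∧
      ‖(u : V) - v‖ ≤ e n := fun n u => by
    obtain ⟨v, hmem, s, h1, h2, h3⟩ := step (e n) (he0 n) u u.2
    exact ⟨⟨v, hmem⟩, s, h1, h2, h3⟩
  choose f g hfg hgn hfn using step
  let u : ℕ → W := fun n => Nat.rec (motive := fun _ => W) ⟨w, hw⟩ (fun n v => v - f n v) n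
  have hus' : ∀ n, u (n + 1) = u n - f n (u n) := fun _ => rfl
  have hus : ∀ n, (u (n + 1) : V) = (u n : V) - (f n (u n) : V) := fun n => by
    rw [hus', AddSubgroup.coe_sub]
  -- `d` bounds the remainders: `‖w‖` at the start, then `e n` at index `n + 1`.
  let d : ℕ → ℝ := fun n => Nat.casesOn n ‖w‖ e
  have hd : HasSum d (‖w‖ + ε / 2) := HasSum.zero_add (f := d) he
  have hud : ∀ n, ‖(u n : V)‖ ≤ d n := fun n => by
    cases n with
    | zero => exact le_rfl
    | succ n =>
      rw [hus]
      exact hfn n (u n)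
  have hgb : ∀ n, ‖g n (u n)‖ ≤ d n + e n := fun n =>
    (hgn n (u n)).trans (by gcongr; exact hud n)
  have hde : HasSum (fun n => d n + e n) (‖w‖ + ε) := by
    have := hd.add he
    rwa [add_assoc, add_halves] at this
  have hsum : Summable fun n => g n (u n) := Summable.of_norm_bounded hde.summable hgb
  have hfsum : Summable fun n => (f n (u n) : V) :=
    Summable.of_norm_bounded hde.summable fun n => (hR _ _ (hfg n (u n))).trans (hgb n)
  have htend : Tendsto (fun n => (u n : V)) atTop (𝓝 0) :=
    squeeze_zero_norm hud hd.summable.tendsto_atTop_zero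
  have hpart : ∀ n, ∑ i ∈ Finset.range n, (f i (u i) : V) = w - u n := fun n => by
    induction n with
    | zero => simp [u]
    | succ n ih =>
      rw [Finset.sum_range_succ, ih, hus]
      abel
  have hfw : HasSum (fun n => (f n (u n) : V)) w := by
    rw [hfsum.hasSum_iff_tendsto_nat]
    simp only [hpart]
    simpa using htend.const_sub w
  exact ⟨_, _, _, fun n => hfg n (u n), hfw, hsum.hasSum, tsum_of_norm_bounded hde hgb⟩

end Series

/-- Positivity makes the sum over the disjoint union summable, so it may be computed block by block
on each vector. -/
theorem isLUB_sigma {H₀ : Type u} [NormedAddCommGroup H₀] [InnerProductSpace ℂ H₀]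
    [CompleteSpace H₀] {C : VonNeumannAlgebra H₀} {I : Type u} {J : I → Type u}
    {c : ∀ i, J i → C.toStarSubalgebra} (hc : ∀ i j, 0 ≤ c i j) {s : I → C.toStarSubalgebra}
    (h : ∀ i, HasWeakStarSum (fun j => (c i j : H₀ →L[ℂ] H₀)) (s i : H₀ →L[ℂ] H₀))
    {s₀ : C.toStarSubalgebra}
    (hs : HasWeakStarSum (fun i => (s i : H₀ →L[ℂ] H₀)) (s₀ : H₀ →L[ℂ] H₀)) :
    IsLUB (Set.range fun F : Finset (Σ i, J i) => ∑ p ∈ F, c p.1 p.2) s₀ := by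
  have hc' : ∀ p : Σ i, J i, (0 : H₀ →L[ℂ] H₀) ≤ c p.1 p.2 := fun p => hc p.1 p.2
  have hsum : ∀ ξ : H₀, Summable fun p : Σ i, J i =>
      inner ℂ ξ ((c p.1 p.2 : H₀ →L[ℂ] H₀) ξ) := fun ξ => by
    have hre : ∀ p : Σ i, J i, inner ℂ ξ ((c p.1 p.2 : H₀ →L[ℂ] H₀) ξ) =
        (((inner ℂ ξ ((c p.1 p.2 : H₀ →L[ℂ] H₀) ξ)).re : ℝ) : ℂ) := fun p => by
      have := (Complex.le_def.1 (op_nonneg_iff.1 (hc' p) ξ)).2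
      apply Complex.ext
      · simp
      · simpa using this.symm
    have h1 : Summable fun p : Σ i, J i => (inner ℂ ξ ((c p.1 p.2 : H₀ →L[ℂ] H₀) ξ)).re := by
      rw [summable_sigma_of_nonneg fun p => re_inner_nonneg (hc' p) ξ]
      refine ⟨fun i => ((h i).diag ξ).summable, ?_⟩
      simp only [((h _).diag ξ).tsum_eq]
      exact (hs.diag ξ).summable
    rw [funext hre]
    exact Complex.summable_ofReal.2 h1
  exact isLUB_of_hasSum (c := fun p : Σ i, J i => c p.1 p.2) hc'
    fun ξ => HasSum.sigma_of_hasSum (hs.weak ξ ξ) (fun i => (h i).weak ξ ξ) (hsum ξ)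

/-! ### Representations of elements of the strong hull -/

section Representations

variable {H₀ : Type u} [NormedAddCommGroup H₀] [InnerProductSpace ℂ H₀] [CompleteSpace H₀]
  {C : VonNeumannAlgebra H₀} [IsMulCommutative C.toStarSubalgebra]
  {X Y : Type u}
  [NormedAddCommGroup X] [NormedSpace ℂ X] [Module C.toStarSubalgebra X]
  [IsScalarTower ℂ C.toStarSubalgebra X]
  [NormedAddCommGroup Y] [NormedSpace ℂ Y] [Module C.toStarSubalgebra Y]
  [IsScalarTower ℂ C.toStarSubalgebra Y]
  {K H : Type u}
  [NormedAddCommGroup K] [InnerProductSpace ℂ K] [CompleteSpace K]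
  [NormedAddCommGroup H] [InnerProductSpace ℂ H] [CompleteSpace H]
  {E : NormalEmbedding C (NuTensor C X Y) K H}

theorem norm_coe_algTensor (v : AlgTensor C X Y) : ‖(v : NuTensor C X Y)‖ = nu C v :=
  UniformSpace.Completion.norm_coe v

theorem norm_nuTmul_le {x : X} {y : Y} (hx : ‖x‖ ≤ 1) (hy : ‖y‖ ≤ 1) : ‖nuTmul C x y‖ ≤ 1 := by
  rw [nuTmul_eq_coe, norm_coe_algTensor]
  refine Real.sSup_le ?_ zero_le_one
  rintro r ⟨Z, _, _, _, φ, -, h, rfl⟩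
  have e : TensorProduct.lift φ (algTmul C x y) = φ x y := TensorProduct.lift.tmul x y
  rw [e]
  exact (h x y).trans (mul_le_one₀ hx (norm_nonneg _) hy)

theorem coe_smul_algTensor (c : C.toStarSubalgebra) (v : AlgTensor C X Y) :
    ((c • v : AlgTensor C X Y) : NuTensor C X Y) = c • (v : NuTensor C X Y) :=
  UniformSpace.Completion.coe_smul c v

/-- The algebraic tensor product as a subspace of its completion. -/
noncomputable def algRange (C : VonNeumannAlgebra H₀) [IsMulCommutative C.toStarSubalgebra]
    (X Y : Type u)
    [NormedAddCommGroup X] [NormedSpace ℂ X] [Module C.toStarSubalgebra X]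
    [IsScalarTower ℂ C.toStarSubalgebra X]
    [NormedAddCommGroup Y] [NormedSpace ℂ Y] [Module C.toStarSubalgebra Y]
    [IsScalarTower ℂ C.toStarSubalgebra Y] : Submodule ℂ (NuTensor C X Y) :=
  LinearMap.range
    (UniformSpace.Completion.toComplₗᵢ (𝕜 := ℂ) (E := AlgTensor C X Y)).toLinearMap

theorem dense_algRange : Dense (algRange C X Y : Set (NuTensor C X Y)) :=
  UniformSpace.Completion.denseRange_coe

theorem smul_mem_algRange (c : C.toStarSubalgebra) :
    ∀ z ∈ algRange C X Y, c • z ∈ algRange C X Y := by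
  rintro _ ⟨v, rfl⟩
  exact ⟨c • v, coe_smul_algTensor c v⟩

namespace IsRepresentation

variable {w : K →L[ℂ] H} {J : Type u} {c : J → C.toStarSubalgebra} {x : J → X} {y : J → Y}
  {s : C.toStarSubalgebra}

theorem isLUB (h : IsRepresentation C E w c x y s) :
    IsLUB (Set.range fun F : Finset J => ∑ j ∈ F, c j) s :=
  isLUB_of_hasSum h.nonneg fun ξ => h.hasSum_coeff.weak ξ ξ

theorem norm_le (h : IsRepresentation C E w c x y s) : ‖w‖ ≤ ‖s‖ :=
  (E.dominated h.nonneg h.isLUB fun j =>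
    norm_nuTmul_le (h.norm_left_le j) (h.norm_right_le j)).norm_le (norm_rep_le _ s)
      (norm_rep_le _ s) h.hasSum

end IsRepresentation

/-- `w` has a representation with coefficients that sum up to `s`. -/
def HasRep (E : NormalEmbedding C (NuTensor C X Y) K H) (w : K →L[ℂ] H)
    (s : C.toStarSubalgebra) : Prop :=
  ∃ (J : Type u) (c : J → C.toStarSubalgebra) (x : J → X) (y : J → Y),
    IsRepresentation C E w c x y s

namespace HasRep

theorem norm_le {w : K →L[ℂ] H} {s : C.toStarSubalgebra} (h : HasRep E w s) : ‖w‖ ≤ ‖s‖ := by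
  obtain ⟨J, c, x, y, h⟩ := h
  exact h.norm_le

/-- Representations are concatenated over the disjoint union of their index sets. Domination makes
the combined family summable against every weak* continuous functional, so its sum can be taken
block by block. -/
theorem hasSum {I : Type u} {w : I → K →L[ℂ] H} {s : I → C.toStarSubalgebra}
    (h : ∀ i, HasRep E (w i) (s i)) {w₀ : K →L[ℂ] H} {s₀ : C.toStarSubalgebra}
    (hw : HasWeakStarSum w w₀)
    (hs : HasWeakStarSum (fun i => (s i : H₀ →L[ℂ] H₀)) (s₀ : H₀ →L[ℂ] H₀)) :
    HasRep E w₀ s₀ := by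
  choose J c x y h using h
  have hlub := isLUB_sigma (fun i => (h i).nonneg) (fun i => (h i).hasSum_coeff) hs
  have hc : ∀ p : Σ i, J i, 0 ≤ c p.1 p.2 := fun p => (h p.1).nonneg p.2
  have hdom := E.dominated hc hlub (z := fun p => nuTmul C (x p.1 p.2) (y p.1 p.2)) fun p =>
    norm_nuTmul_le ((h p.1).norm_left_le p.2) ((h p.1).norm_right_le p.2)
  refine ⟨Σ i, J i, fun p => c p.1 p.2, fun p => x p.1 p.2, fun p => y p.1 p.2,
    hc, fun p => (h p.1).norm_left_le p.2, fun p => (h p.1).norm_right_le p.2,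
    hasWeakStarSum_of_isLUB hc hlub, fun ξ η hξ hη => ?_⟩
  exact HasSum.sigma_of_hasSum (hw ξ η hξ hη) (fun i => (h i).hasSum ξ η hξ hη)
    (hdom.summable_weakStar hξ hη)

end HasRep

theorem FinRep.emb_eq {v : AlgTensor C X Y} {ι : Type u} [Fintype ι] {c : ι → C.toStarSubalgebra}
    {x : ι → X} {y : ι → Y} (hv : v = ∑ i, c i • algTmul C (x i) (y i)) :
    E.emb (v : NuTensor C X Y) = ∑ i, E.emb (c i • nuTmul C (x i) (y i)) := by
  rw [← map_sum, hv]
  congr 1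
  have := map_sum (UniformSpace.Completion.toComplₗᵢ (𝕜 := ℂ) (E := AlgTensor C X Y))
    (fun i => c i • algTmul C (x i) (y i)) Finset.univ
  refine this.trans (Finset.sum_congr rfl fun i _ => ?_)
  exact coe_smul_algTensor _ _

theorem FinRep.hasRep (E : NormalEmbedding C (NuTensor C X Y) K H) {v : AlgTensor C X Y}
    {s : C.toStarSubalgebra} (h : FinRep C v s) : HasRep E (E.emb (v : NuTensor C X Y)) s := by
  obtain ⟨ι, _, c, x, y, hc, hx, hy, rfl, hv⟩ := h
  refine ⟨ι, c, x, y, hc, hx, hy, ?_, ?_⟩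
  · rw [AddSubmonoidClass.coe_finsetSum]
    exact hasWeakStarSum_of_hasSum (hasSum_fintype _)
  · rw [FinRep.emb_eq hv]
    exact hasWeakStarSum_of_hasSum (hasSum_fintype _)

theorem FinRep.norm_inner_le (E : NormalEmbedding C (NuTensor C X Y) K H) {v : AlgTensor C X Y}
    {s : C.toStarSubalgebra} (h : FinRep C v s) (ξ : K) (η : H) :
    ‖inner ℂ η (E.emb (v : NuTensor C X Y) ξ)‖ ≤
      ((inner ℂ η (E.left s η)).re + (inner ℂ ξ (E.right s ξ)).re) / 2 := by
  obtain ⟨ι, _, c, x, y, hc, hx, hy, rfl, hv⟩ := h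
  rw [FinRep.emb_eq hv, map_sum, map_sum, sum_apply, sum_apply, sum_apply, inner_sum, inner_sum,
    inner_sum, Complex.re_sum, Complex.re_sum, ← Finset.sum_add_distrib, Finset.sum_div]
  exact norm_sum_le_of_le _ fun i _ =>
    E.norm_inner_smul_le (hc i) (norm_nuTmul_le (hx i) (hy i)) ξ η

theorem sum_le_of_le_proj {J : Type u} {p s : J → C.toStarSubalgebra} (hp : IsPartition p) {r : ℝ}
    (hr : 0 ≤ r) (hs : ∀ j, s j ≤ (r : ℂ) • p j) (F : Finset J) :
    ∑ j ∈ F, s j ≤ (r : ℂ) • (1 : C.toStarSubalgebra) := by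
  have h1 : ∑ j ∈ F, s j ≤ (r : ℂ) • ∑ j ∈ F, p j := by
    change ((∑ j ∈ F, s j : C.toStarSubalgebra) : H₀ →L[ℂ] H₀) ≤
      (((r : ℂ) • ∑ j ∈ F, p j : C.toStarSubalgebra) : H₀ →L[ℂ] H₀)
    rw [Finset.smul_sum, AddSubmonoidClass.coe_finsetSum, AddSubmonoidClass.coe_finsetSum]
    exact Finset.sum_le_sum fun j _ => hs j
  refine h1.trans ?_
  have h2 := nonneg_smul (proj_nonneg (hp.sum_proj F).one_sub) hr
  rw [smul_sub] at h2
  exact sub_nonneg.1 (show (0 : H₀ →L[ℂ] H₀) ≤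
    (((r : ℂ) • (1 : C.toStarSubalgebra) : C.toStarSubalgebra) : H₀ →L[ℂ] H₀) -
      (((r : ℂ) • ∑ j ∈ F, p j : C.toStarSubalgebra) : H₀ →L[ℂ] H₀) from h2)

theorem norm_le_of_le_smul_one {s : C.toStarSubalgebra} (hs : 0 ≤ s) {r : ℝ} (hr : 0 ≤ r)
    (h : s ≤ (r : ℂ) • (1 : C.toStarSubalgebra)) : ‖s‖ ≤ r := by
  have h1 : ‖(s : H₀ →L[ℂ] H₀)‖ ≤ ‖(r : ℂ) • (1 : H₀ →L[ℂ] H₀)‖ :=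
    CStarAlgebra.norm_le_norm_of_nonneg_of_le hs h
  refine h1.trans ?_
  rw [norm_smul, Complex.norm_real, Real.norm_eq_abs, abs_of_nonneg hr]
  exact mul_le_of_le_one_right hr ContinuousLinearMap.norm_id_le

/-- Elements of the local hull have local finite representations, up to a small error. -/
theorem exists_partition_finRep (hX : IsCNRM C X) {w : K →L[ℂ] H}
    (hw : w ∈ localHull E (algRange C X Y)) {r δ : ℝ} (hδ : 0 < δ) (hr : ‖w‖ + δ < r) :
    ∃ (J : Type u) (p s : J → C.toStarSubalgebra) (v : J → AlgTensor C X Y), IsPartition p ∧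
      ∀ j, FinRep C (v j) (s j) ∧ p j • v j = v j ∧ s j ≤ (r : ℂ) • p j ∧
        ‖E.left (p j) ∘L w - E.emb (v j : NuTensor C X Y)‖ ≤ δ := by
  obtain ⟨J, p, hp, h⟩ := exists_partition (C := C) (fun p => ∃ (s : C.toStarSubalgebra)
    (v : AlgTensor C X Y), FinRep C v s ∧ p • v = v ∧ s ≤ (r : ℂ) • p ∧
      ‖E.left p ∘L w - E.emb (v : NuTensor C X Y)‖ ≤ δ) fun q hq hq0 => by
    obtain ⟨p₁, hp₁, hp₁0, hp₁q, _, ⟨z, rfl⟩, hz⟩ := hw.2 δ hδ q hq hq0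
    change ‖E.left p₁ ∘L (w - E.emb (z : NuTensor C X Y))‖ ≤ δ at hz
    -- On `p₁` the tensor `z` is `δ`-close to `w`, so cutting it down by `p₁` brings its `ν`-norm
    -- below `r`. A finite representation of `p₁ z` is then cut down further by `p`.
    have hnu : nu C (p₁ • z) < r := by
      rw [← norm_coe_algTensor, coe_smul_algTensor, ← E.emb.norm_map, E.emb_left]
      have e : E.left p₁ ∘L E.emb (z : NuTensor C X Y) =
          E.left p₁ ∘L w - E.left p₁ ∘L (w - E.emb (z : NuTensor C X Y)) := by
        rw [← ContinuousLinearMap.comp_sub, sub_sub_cancel]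
      rw [e]
      calc _ ≤ _ := norm_sub_le _ _
        _ ≤ ‖w‖ + δ := add_le_add (norm_rep_proj_comp_le_self _ hp₁ w) hz
        _ < r := hr
    obtain ⟨p, s, hp, hp0, hpp, hs, hps⟩ := exists_finRep_local hX hnu hp₁ hp₁0
    refine ⟨p, hp, hp0, by rw [← hpp, mul_assoc, hp₁q], p * s, p • p₁ • z, hs.proj_smul hp, ?_, hps,
      ?_⟩
    · rw [smul_smul p p, hp.1]
    · have e : E.left p ∘L w - E.emb ((p • p₁ • z : AlgTensor C X Y) : NuTensor C X Y) =
          E.left p ∘L (w - E.emb (z : NuTensor C X Y)) := by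
        rw [smul_smul, hpp, coe_smul_algTensor, E.emb_left, ContinuousLinearMap.comp_sub]
      rw [e]
      exact (norm_rep_proj_comp_le _ hp hpp _).trans hz
  choose s v h using h
  exact ⟨J, p, s, v, hp, h⟩

/-- The local finite representations are glued along a partition. Since `s j ≤ r p j` with
orthogonal `p j`, the coefficient sums have a supremum of norm at most `r = ‖w‖ + δ`. The glued
element stays in the local hull, so the remainder can be approximated again. -/
theorem exists_hasRep_approx (hX : IsCNRM C X) {w : K →L[ℂ] H}
    (hw : w ∈ localHull E (algRange C X Y)) {δ : ℝ} (hδ : 0 < δ) :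
    ∃ w₀ ∈ localHull E (algRange C X Y), ∃ s, HasRep E w₀ s ∧ ‖s‖ ≤ ‖w‖ + δ ∧ ‖w - w₀‖ ≤ δ := by
  obtain ⟨J, p, s, v, hp, h⟩ := exists_partition_finRep hX hw (half_pos hδ)
    (r := ‖w‖ + δ) (by linarith)
  have hr : 0 ≤ ‖w‖ + δ := by positivity
  have hs0 : ∀ j, 0 ≤ s j := fun j => (h j).1.nonneg
  have hle := sum_le_of_le_proj hp hr fun j => (h j).2.2.1
  obtain ⟨s₀, hs₀, -, -⟩ := exists_isLUB_of_monotone (monotone_sum hs0) hle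
  have hsn : ‖s₀‖ ≤ ‖w‖ + δ := norm_le_of_le_smul_one (by simpa using hs₀.1 ⟨∅, rfl⟩) hr
    (hs₀.2 (by rintro _ ⟨F, rfl⟩; exact hle F))
  have hdom : Dominated (fun j => E.emb (v j : NuTensor C X Y)) (fun j => E.left (s j)) (E.left s₀)
      (fun j => E.right (s j)) (E.right s₀) :=
    { left_nonneg := fun j => rep_nonneg _ (hs0 j)
      right_nonneg := fun j => rep_nonneg _ (hs0 j)
      hasSum_left := fun ξ => E.left_normal.hasSum_diag hs0 hs₀ ξ
      hasSum_right := fun ξ => E.right_normal.hasSum_diag hs0 hs₀ ξ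
      le := fun j ξ η => (h j).1.norm_inner_le E ξ η }
  obtain ⟨w₀, -, hw₀⟩ := hdom.exists_hasWeakStarSum (norm_rep_le _ _) (norm_rep_le _ _)
  have hemb : ∀ j, E.left (p j) ∘L E.emb (v j : NuTensor C X Y) =
      E.emb (v j : NuTensor C X Y) := fun j => by
    rw [← E.emb_left, ← coe_smul_algTensor, (h j).2.1]
  have hw₀' : HasWeakStarSum (fun j => E.left (p j) ∘L E.emb (v j : NuTensor C X Y)) w₀ := by
    simpa only [hemb] using hw₀
  have hbdd : ∀ j, ‖E.emb (v j : NuTensor C X Y)‖ ≤ ‖w‖ + δ := fun j => by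
    have h1 := (h j).2.2.2
    have h2 := norm_rep_proj_comp_le_self E.left (hp.proj j) w
    have h3 := norm_sub_norm_le (E.emb (v j : NuTensor C X Y)) (E.left (p j) ∘L w)
    rw [norm_sub_rev] at h3
    linarith
  have hmem : w₀ ∈ localHull E (algRange C X Y) :=
    (isStrong_localHull smul_mem_algRange).sum_mem J p _ hp.proj hp.orth
      (fun j => emb_mem_localHull dense_algRange _) ⟨_, hbdd⟩ w₀ hw₀'
  refine ⟨w₀, hmem, s₀, ?_, hsn, ?_⟩
  · exact HasRep.hasSum (fun j => (h j).1.hasRep E) hw₀ (hasWeakStarSum_of_isLUB hs0 hs₀)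
  -- The difference `w - w₀` is central, so it is enough to estimate it on each `p j`, where `w₀`
  -- coincides with `v j`.
  · refine hp.norm_le E.left_normal E.right_normal
      ((isStrong_localHull smul_mem_algRange).central · _ (Submodule.sub_mem _ hw hmem)) hδ.le
      fun j => ?_
    rw [ContinuousLinearMap.comp_sub, rep_comp_of_hasWeakStarSum hp.proj hp.orth hw₀' j, hemb]
    linarith [(h j).2.2.2]

theorem exists_hasRep (hX : IsCNRM C X) {w : K →L[ℂ] H}
    (hw : w ∈ localHull E (algRange C X Y)) {ε : ℝ} (hε : 0 < ε) :
    ∃ s, HasRep E w s ∧ ‖s‖ ≤ ‖w‖ + ε := by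
  have : CompleteSpace C.toStarSubalgebra := (isClosed_carrier C).completeSpace_coe
  obtain ⟨v, s, s₀, hvs, hv, hs, hs₀⟩ := exists_series_of_approx
    (W := (localHull E (algRange C X Y)).toAddSubgroup) (R := HasRep E) (fun _ _ h => h.norm_le)
    (fun δ hδ u hu => exists_hasRep_approx hX hu hδ) hw hε
  refine ⟨s₀, ?_, hs₀⟩
  have hgs : HasSum (fun n => (s n : H₀ →L[ℂ] H₀)) (s₀ : H₀ →L[ℂ] H₀) :=
    hs.map C.toStarSubalgebra.subtype continuous_subtype_val
  exact HasRep.hasSum (I := ULift.{u} ℕ) (w := fun n => v n.down) (s := fun n => s n.down)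
    (fun n => hvs n.down) (hasWeakStarSum_of_hasSum ((Equiv.ulift.hasSum_iff (f := v)).2 hv))
    (hasWeakStarSum_of_hasSum ((Equiv.ulift.hasSum_iff
      (f := fun n => (s n : H₀ →L[ℂ] H₀))).2 hgs))

theorem isGLB_norm (hX : IsCNRM C X) {w : K →L[ℂ] H} (hw : w ∈ E.strongHull) :
    (∃ s, HasRep E w s) ∧ IsGLB {r : ℝ | ∃ s, HasRep E w s ∧ r = ‖s‖} ‖w‖ := by
  have hw' : w ∈ localHull E (algRange C X Y) := (isLeast_strongHull E).2
    ⟨isStrong_localHull smul_mem_algRange, emb_mem_localHull dense_algRange⟩ hw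
  refine ⟨(exists_hasRep hX hw' one_pos).imp fun s h => h.1, ?_, fun b hb => ?_⟩
  · rintro _ ⟨s, h, rfl⟩
    exact h.norm_le
  · refine le_of_forall_pos_le_add fun ε hε => ?_
    obtain ⟨s, hs, hsn⟩ := exists_hasRep hX hw' hε
    exact (hb ⟨s, hs, rfl⟩).trans hsn

end Representations

/-! ### Hilbert space direct sums of normal representations -/

section DirectSum

variable {I : Type*} {K H : I → Type*}
  [∀ i, NormedAddCommGroup (K i)] [∀ i, InnerProductSpace ℂ (K i)]
  [∀ i, NormedAddCommGroup (H i)] [∀ i, InnerProductSpace ℂ (H i)]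

theorem norm_le_norm_mapCLM (T : ∀ i, K i →L[ℂ] H i) {M : ℝ} (hM : 0 ≤ M) (hT : ∀ i, ‖T i‖ ≤ M)
    (i : I) : ‖T i‖ ≤ ‖lp.mapCLM 2 T hM hT‖ := by
  classical
  refine (T i).opNorm_le_bound (ContinuousLinearMap.opNorm_nonneg _) fun ξ => ?_
  have h1 := (lp.mapCLM 2 T hM hT).le_opNorm (lp.single 2 i ξ)
  rw [lp.norm_single (by norm_num)] at h1
  refine le_trans ?_ h1
  have h2 := lp.norm_apply_le_norm (p := 2) (by norm_num)
    (lp.mapCLM 2 T hM hT (lp.single 2 i ξ)) i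
  have h3 : (lp.mapCLM 2 T hM hT (lp.single 2 i ξ)) i = T i ξ := by
    change T i (lp.single 2 i ξ i) = T i ξ
    rw [lp.single_apply_self]
  rwa [h3] at h2

variable {H₀ : Type u} [NormedAddCommGroup H₀] [InnerProductSpace ℂ H₀] [CompleteSpace H₀]
  {C : VonNeumannAlgebra H₀} {I : Type u} {H : I → Type u}
  [∀ i, NormedAddCommGroup (H i)] [∀ i, InnerProductSpace ℂ (H i)] [∀ i, CompleteSpace (H i)]

/-- The direct sum of a family of representations. -/
noncomputable def directSumRep (π : ∀ i, C.toStarSubalgebra →⋆ₐ[ℂ] (H i →L[ℂ] H i)) :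
    C.toStarSubalgebra →⋆ₐ[ℂ] (lp H 2 →L[ℂ] lp H 2) where
  toFun c := lp.mapCLM 2 (fun i => π i c) (norm_nonneg c) fun i => norm_rep_le (π i) c
  map_one' := by
    ext x i
    change π i 1 (x i) = x i
    rw [map_one]
    rfl
  map_mul' a b := by
    ext x i
    change π i (a * b) (x i) = π i a (π i b (x i))
    rw [map_mul]
    rfl
  map_zero' := by
    ext x i
    change π i 0 (x i) = 0
    rw [map_zero]
    rfl
  map_add' a b := by
    ext x i
    change π i (a + b) (x i) = π i a (x i) + π i b (x i)
    rw [map_add]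
    rfl
  commutes' a := by
    ext x i
    change π i (algebraMap ℂ _ a) (x i) = a • x i
    rw [AlgHomClass.commutes, Algebra.algebraMap_eq_smul_one]
    rfl
  map_star' a := by
    rw [ContinuousLinearMap.star_eq_adjoint, ContinuousLinearMap.eq_adjoint_iff]
    intro x y
    rw [lp.inner_eq_tsum, lp.inner_eq_tsum]
    refine tsum_congr fun i => ?_
    change inner ℂ (π i (star a) (x i)) (y i) = inner ℂ (x i) (π i a (y i))
    rw [map_star, ContinuousLinearMap.star_eq_adjoint, ContinuousLinearMap.adjoint_inner_left]

theorem directSumRep_apply (π : ∀ i, C.toStarSubalgebra →⋆ₐ[ℂ] (H i →L[ℂ] H i))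
    (c : C.toStarSubalgebra) (x : lp H 2) (i : I) : directSumRep π c x i = π i c (x i) := rfl

/-- Along an increasing net each coordinate converges by normality. The net is eventually bounded in
norm, so dominated convergence handles the sum over coordinates. -/
theorem isNormal_directSumRep {π : ∀ i, C.toStarSubalgebra →⋆ₐ[ℂ] (H i →L[ℂ] H i)}
    (hπ : ∀ i, IsNormal C (π i)) : IsNormal C (directSumRep π) := by
  refine isNormal_of_tendsto fun S s hne hdir hs ξ => ?_
  have := hne.to_subtype
  have : IsDirectedOrder S := ⟨fun a b => by
    obtain ⟨c, hc, h1, h2⟩ := hdir a a.2 b b.2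
    exact ⟨⟨c, hc⟩, h1, h2⟩⟩
  have hmono : Monotone fun a : S => (a : C.toStarSubalgebra) := fun a b hab => hab
  have hlub : IsLUB (Set.range fun a : S => (a : C.toStarSubalgebra)) s := by
    rwa [Subtype.range_coe]
  obtain ⟨c₀, hc₀⟩ := hne
  -- Beyond `c₀` one has `0 ≤ s - a ≤ s - c₀`, so `‖a‖ ≤ ‖s‖ + ‖s - c₀‖`.
  let M := ‖s‖ + ‖s - c₀‖
  have hM : ∀ᶠ a : S in atTop, ‖(a : C.toStarSubalgebra)‖ ≤ M := by
    filter_upwards [eventually_ge_atTop (⟨c₀, hc₀⟩ : S)] with a ha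
    have h1 : ‖(s : H₀ →L[ℂ] H₀) - (a : C.toStarSubalgebra)‖ ≤ ‖(s : H₀ →L[ℂ] H₀) - c₀‖ :=
      CStarAlgebra.norm_le_norm_of_nonneg_of_le
        (sub_nonneg.2 (show ((a : C.toStarSubalgebra) : H₀ →L[ℂ] H₀) ≤ s from hs.1 a.2))
        (sub_le_sub_left (show (c₀ : H₀ →L[ℂ] H₀) ≤ (a : C.toStarSubalgebra) from ha) _)
    have h2 := norm_sub_le (s : H₀ →L[ℂ] H₀)
      ((s : H₀ →L[ℂ] H₀) - ((a : C.toStarSubalgebra) : H₀ →L[ℂ] H₀))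
    rw [sub_sub_cancel] at h2
    exact h2.trans (add_le_add le_rfl h1)
  simp only [lp.inner_eq_tsum, directSumRep_apply]
  have hξ : Summable fun i => ‖ξ i‖ ^ 2 := by
    simpa using (lp.memℓp ξ).summable (by norm_num)
  refine tendsto_tsum_of_dominated_convergence (bound := fun i => M * ‖ξ i‖ ^ 2)
    (hξ.mul_left M) (fun i => (hπ i).tendsto hmono hlub (ξ i) (ξ i)) ?_
  filter_upwards [hM] with a ha i
  calc ‖inner ℂ (ξ i) (π i a (ξ i))‖ ≤ ‖ξ i‖ * ‖π i a (ξ i)‖ := norm_inner_le_norm _ _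
    _ ≤ ‖ξ i‖ * (M * ‖ξ i‖) := by
      gcongr
      exact (π i a).le_of_opNorm_le ((norm_rep_le _ _).trans ha) _
    _ = M * ‖ξ i‖ ^ 2 := by ring

end DirectSum

/-! ### The normal projective tensor product is normal representable -/

section TensorCNRM

variable {H₀ : Type u} [NormedAddCommGroup H₀] [InnerProductSpace ℂ H₀] [CompleteSpace H₀]
  (C : VonNeumannAlgebra H₀) [IsMulCommutative C.toStarSubalgebra]
  (X Y : Type u)
  [NormedAddCommGroup X] [NormedSpace ℂ X] [Module C.toStarSubalgebra X]
  [IsScalarTower ℂ C.toStarSubalgebra X]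
  [NormedAddCommGroup Y] [NormedSpace ℂ Y] [Module C.toStarSubalgebra Y]
  [IsScalarTower ℂ C.toStarSubalgebra Y]

/-- A contractive representation of the algebraic tensor product between normal Hilbert
`C`-modules. -/
structure TensorRep where
  /-- the domain -/
  K : Type u
  /-- the codomain -/
  H : Type u
  [normK : NormedAddCommGroup K]
  [innerK : InnerProductSpace ℂ K]
  [completeK : CompleteSpace K]
  [normH : NormedAddCommGroup H]
  [innerH : InnerProductSpace ℂ H]
  [completeH : CompleteSpace H]
  /-- the action of `C` on the codomain -/
  left : C.toStarSubalgebra →⋆ₐ[ℂ] (H →L[ℂ] H)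
  /-- the action of `C` on the domain -/
  right : C.toStarSubalgebra →⋆ₐ[ℂ] (K →L[ℂ] K)
  left_normal : IsNormal C left
  right_normal : IsNormal C right
  /-- the contractive module map -/
  map : AlgTensor C X Y →ₗ[ℂ] (K →L[ℂ] H)
  norm_map_le : ∀ v, ‖map v‖ ≤ nu C v
  map_left : ∀ (c : C.toStarSubalgebra) v, map (c • v) = left c ∘L map v
  map_right : ∀ (c : C.toStarSubalgebra) v, map (c • v) = map v ∘L right c

attribute [instance] TensorRep.normK TensorRep.innerK TensorRep.completeK TensorRep.normH
  TensorRep.innerH TensorRep.completeH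

variable {C X Y}

theorem exists_tensorRep (hX : IsCNRM C X) (v : AlgTensor C X Y) {ε : ℝ} (hε : 0 < ε) :
    ∃ R : TensorRep C X Y, nu C v - ε < ‖R.map v‖ := by
  -- The zero map into `X` shows that the supremum is over a nonempty set.
  have hne : (nuSet C v).Nonempty :=
    ⟨_, X, inferInstance, inferInstance, inferInstance, 0, hX, fun x y => by
      simpa using mul_nonneg (norm_nonneg x) (norm_nonneg y), rfl⟩
  obtain ⟨_, ⟨Z, _, _, _, φ, hZ, hφ, rfl⟩, hlt⟩ := exists_lt_of_lt_csSup hne (sub_lt_self (nu C v) hε)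
  have hZ' := hZ
  obtain ⟨-, K, H, _, _, _, _, _, _, ⟨E⟩⟩ := hZ
  have hC : ∀ (c : C.toStarSubalgebra) (w : AlgTensor C X Y),
      TensorProduct.lift φ (c • w) = c • TensorProduct.lift φ w := fun c w =>
    map_smul (TensorProduct.lift φ) c w
  let L : AlgTensor C X Y →ₗ[ℂ] (K →L[ℂ] H) :=
    { toFun := fun w => E.emb (TensorProduct.lift φ w)
      map_add' := fun w w' => by
        have : TensorProduct.lift φ (w + w') = TensorProduct.lift φ w + TensorProduct.lift φ w' :=
          map_add (TensorProduct.lift φ) w w'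
        rw [this, map_add]
      map_smul' := fun a w => by
        rw [← IsScalarTower.algebraMap_smul C.toStarSubalgebra a w, hC, hZ'.algebraMap_smul,
          map_smul, RingHom.id_apply] }
  have hL : ∀ w, L w = E.emb (TensorProduct.lift φ w) := fun w => rfl
  refine ⟨{
    K := K
    H := H
    left := E.left
    right := E.right
    left_normal := E.left_normal
    right_normal := E.right_normal
    map := L
    norm_map_le := fun w => by
      rw [hL, E.emb.norm_map]
      exact le_csSup (nuSet_bddAbove C w) ⟨Z, _, _, _, φ, hZ', hφ, rfl⟩
    map_left := fun c w => by rw [hL, hL, hC, E.emb_left]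
    map_right := fun c w => by rw [hL, hL, hC, E.emb_right] }, ?_⟩
  change nu C v - ε < ‖L v‖
  rwa [hL, E.emb.norm_map]

/-- The direct sum of a family of representations of the algebraic tensor product. -/
noncomputable def directSumMap {I : Type u} (R : I → TensorRep C X Y) :
    AlgTensor C X Y →ₗ[ℂ] (lp (fun i => (R i).K) 2 →L[ℂ] lp (fun i => (R i).H) 2) where
  toFun v := lp.mapCLM 2 (fun i => (R i).map v) (nu_nonneg C v) fun i => (R i).norm_map_le v
  map_add' v w := by
    ext x i
    change (R i).map (v + w) (x i) = (R i).map v (x i) + (R i).map w (x i)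
    rw [map_add]
    rfl
  map_smul' a v := by
    ext x i
    change (R i).map (a • v) (x i) = a • (R i).map v (x i)
    rw [map_smul]
    rfl

/-- One representation per pair `(v, n)`, norming `v` up to `1 / (n + 1)`, is enough for isometry.
This index set lies in the universe of the spaces, whereas the collection of all representations
does not. -/
theorem norm_directSumMap {R : AlgTensor C X Y × ℕ → TensorRep C X Y}
    (hR : ∀ v (n : ℕ), nu C v - 1 / (n + 1 : ℝ) < ‖(R (v, n)).map v‖) (v : AlgTensor C X Y) :
    ‖directSumMap R v‖ = nu C v := by
  refine le_antisymm (lp.norm_mapCLM_le 2 _ (nu_nonneg C v) fun i => (R i).norm_map_le v) ?_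
  have h : ∀ n : ℕ, nu C v ≤ ‖directSumMap R v‖ + 1 / (n + 1 : ℝ) := fun n => by
    have h1 := norm_le_norm_mapCLM (fun i => (R i).map v) (nu_nonneg C v)
      (fun i => (R i).norm_map_le v) (v, n)
    have h2 := hR v n
    have h3 : ‖(R (v, n)).map v‖ ≤ ‖directSumMap R v‖ := h1
    linarith
  have hlim : Tendsto (fun n : ℕ => ‖directSumMap R v‖ + 1 / (n + 1 : ℝ)) atTop
      (𝓝 (‖directSumMap R v‖ + 0)) := tendsto_one_div_add_atTop_nhds_zero_nat.const_add _
  rw [add_zero] at hlim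
  exact ge_of_tendsto' hlim h

/-- An isometric module map on the dense algebraic tensor product extends to the completion. The
norm identity and both module identities are closed conditions, so they extend too. -/
theorem isCNRM_of_isometry {K H : Type u}
    [NormedAddCommGroup K] [InnerProductSpace ℂ K] [CompleteSpace K]
    [NormedAddCommGroup H] [InnerProductSpace ℂ H] [CompleteSpace H]
    {π : C.toStarSubalgebra →⋆ₐ[ℂ] (H →L[ℂ] H)} {σ : C.toStarSubalgebra →⋆ₐ[ℂ] (K →L[ℂ] K)}
    (hπ : IsNormal C π) (hσ : IsNormal C σ) {L : AlgTensor C X Y →ₗ[ℂ] (K →L[ℂ] H)}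
    (hL : ∀ v, ‖L v‖ = nu C v) (hleft : ∀ (c : C.toStarSubalgebra) v, L (c • v) = π c ∘L L v)
    (hright : ∀ (c : C.toStarSubalgebra) v, L (c • v) = L v ∘L σ c) :
    IsCNRM C (NuTensor C X Y) := by
  let e : AlgTensor C X Y →ₗ[ℂ] NuTensor C X Y :=
    (UniformSpace.Completion.toComplₗᵢ (𝕜 := ℂ) (E := AlgTensor C X Y)).toLinearMap
  have hdense : DenseRange e := UniformSpace.Completion.denseRange_coe
  have hnorm : ∀ v, ‖L v‖ ≤ 1 * ‖e v‖ := fun v => by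
    rw [one_mul, hL]
    exact (norm_coe_algTensor v).ge
  let F : NuTensor C X Y →L[ℂ] (K →L[ℂ] H) := L.extendOfNorm e
  have hF : ∀ v : AlgTensor C X Y, F (v : NuTensor C X Y) = L v :=
    LinearMap.extendOfNorm_eq hdense ⟨1, hnorm⟩
  refine ⟨inferInstance, K, H, inferInstance, inferInstance, inferInstance, inferInstance,
    inferInstance, inferInstance, ⟨{
      left := π
      right := σ
      left_normal := hπ
      right_normal := hσ
      emb := { toLinearMap := F.toLinearMap, norm_map' := fun z => ?_ }
      emb_left := fun c z => ?_
      emb_right := fun c z => ?_ }⟩⟩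
  · change ‖F z‖ = ‖z‖
    induction z using UniformSpace.Completion.induction_on with
    | hp => exact isClosed_eq (by fun_prop) (by fun_prop)
    | ih v => rw [hF, hL, norm_coe_algTensor]
  · change F (c • z) = π c ∘L F z
    induction z using UniformSpace.Completion.induction_on with
    | hp => exact isClosed_eq (F.continuous.comp (continuous_const_smul c)) (by fun_prop)
    | ih v => rw [← coe_smul_algTensor, hF, hF, hleft]
  · change F (c • z) = F z ∘L σ c
    induction z using UniformSpace.Completion.induction_on with
    | hp => exact isClosed_eq (F.continuous.comp (continuous_const_smul c)) (by fun_prop)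
    | ih v => rw [← coe_smul_algTensor, hF, hF, hright]

theorem isCNRM_nuTensor (hX : IsCNRM C X) : IsCNRM C (NuTensor C X Y) := by
  have hex : ∀ i : AlgTensor C X Y × ℕ, ∃ R : TensorRep C X Y,
      nu C i.1 - 1 / (i.2 + 1 : ℝ) < ‖R.map i.1‖ := fun i =>
    exists_tensorRep hX i.1 (by positivity)
  choose R hR using hex
  refine isCNRM_of_isometry (L := directSumMap R)
    (isNormal_directSumRep fun i => (R i).left_normal)
    (isNormal_directSumRep fun i => (R i).right_normal)
    (norm_directSumMap fun v n => hR (v, n)) (fun c v => ?_) fun c v => ?_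
  · ext x i
    change (R i).map (c • v) (x i) = (R i).left c ((R i).map v (x i))
    rw [(R i).map_left]
    rfl
  · ext x i
    change (R i).map (c • v) (x i) = (R i).map v ((R i).right c (x i))
    rw [(R i).map_right]
    rfl

end TensorCNRM

end CNRM

/-! ### The main theorem -/

open CNRM

theorem mainTheorem8 {H₀ : Type u} [NormedAddCommGroup H₀] [InnerProductSpace ℂ H₀]
    [CompleteSpace H₀] (C : VonNeumannAlgebra H₀) [IsMulCommutative C.toStarSubalgebra]
    (X Y : Type u)
    [NormedAddCommGroup X] [NormedSpace ℂ X] [Module C.toStarSubalgebra X]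
    [IsScalarTower ℂ C.toStarSubalgebra X]
    [NormedAddCommGroup Y] [NormedSpace ℂ Y] [Module C.toStarSubalgebra Y]
    [IsScalarTower ℂ C.toStarSubalgebra Y]
    (hX : IsCNRM C X) (hY : IsCNRM C Y) :
    IsCNRM C (NuTensor C X Y) ∧
    ∀ (K H : Type u)
      [NormedAddCommGroup K] [InnerProductSpace ℂ K] [CompleteSpace K]
      [NormedAddCommGroup H] [InnerProductSpace ℂ H] [CompleteSpace H]
      (E : NormalEmbedding C (NuTensor C X Y) K H),
      IsLeast {W | IsStrong E.left E.right W ∧ ∀ z, E.emb z ∈ W} E.strongHull ∧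
      ∀ w ∈ E.strongHull,
        (∃ (J : Type u) (c : J → C.toStarSubalgebra) (x : J → X) (y : J → Y)
          (s : C.toStarSubalgebra), IsRepresentation C E w c x y s) ∧
        IsGLB {r : ℝ | ∃ (J : Type u) (c : J → C.toStarSubalgebra) (x : J → X) (y : J → Y)
          (s : C.toStarSubalgebra), IsRepresentation C E w c x y s ∧ r = ‖s‖} ‖w‖ := by
  refine ⟨isCNRM_nuTensor hX, fun K H _ _ _ _ _ _ E => ⟨isLeast_strongHull E, fun w hw => ?_⟩⟩
  obtain ⟨⟨s, J, c, x, y, h⟩, hglb⟩ := isGLB_norm hX hw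
  refine ⟨⟨J, c, x, y, s, h⟩, ?_⟩
  convert hglb using 1
  ext r
  constructor
  · rintro ⟨J, c, x, y, s, h, rfl⟩
    exact ⟨s, ⟨J, c, x, y, h⟩, rfl⟩
  · rintro ⟨s, ⟨J, c, x, y, h⟩, rfl⟩
    exact ⟨J, c, x, y, s, h, rfl⟩
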